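/- Time is measured on a deterministic unit-cost RAM whose words have a number of bits logarithmic in the input length plus the time bound. All-Pairs Max-Flow asks, given a directed graph with edge capacities (as a list of edges), for the value of a maximum flow from $u$ to $v$ for every pair of distinct nodes $u,v$. MAX-CNF-SAT asks for the maximum number of clauses of a given CNF formula that can be satisfied simultaneously. SETH states that for every $\varepsilon>0$ there is an integer $k\ge 3$ such that $k$-SAT on $n$ variables and $m$ clauses cannot be solved in time $2^{(1-\varepsilon)n}\,\mathrm{poly}(m)$. Theorem. For every $\varepsilon>0$ there is a $\delta=\delta(\varepsilon)>0$ such that the following holds. If, for some constant $C\ge 1$, All-Pairs Max-Flow on simple directed graphs with $n\ge 1$ nodes, $m$ edges, $n\le m\le Cn$, and capacities in $\{1,\dots,n\}$ can be solved in time $O((n^2m)^{1-\varepsilon})$, then for every constant $C'$, MAX-CNF-SAT on $n'$ variables and at most $C'n'$ clauses can be solved in time $O(2^{(1-\delta)n'})$; in particular, SETH is false. -/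

import Mathlib

/-! ## Machine model: the unit-cost random access machine with bounded words

A program uses finitely many registers and finitely many unbounded arrays, all of them holding
natural numbers.  (Finitely many arrays are interchangeable with one memory by interleaving the
addresses, and jumps with loops by keeping a program counter in a register, at the price of a
constant factor in time.)  Every instruction and every test takes one step.  Words are bounded:
an instruction that would produce a number above the word bound cannot be executed. -/

namespace RAM

/-- Contents of the registers and of the arrays. -/
structure State where
  reg : ℕ → ℕ
  arr : ℕ → ℕ → ℕ

/-- Arithmetic and bitwise word operations (subtraction is truncated, `x / 0 = 0`). -/
inductive Op
  | add | sub | mul | div | mod | and | or | xor | shl | shr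

/-- The value of a word operation. -/
def Op.eval : Op → ℕ → ℕ → ℕ
  | .add, a, b => a + b
  | .sub, a, b => a - b
  | .mul, a, b => a * b
  | .div, a, b => a / b
  | .mod, a, b => a % b
  | .and, a, b => a &&& b
  | .or, a, b => a ||| b
  | .xor, a, b => a ^^^ b
  | .shl, a, b => a <<< b
  | .shr, a, b => a >>> b

/-- Programs. -/
inductive Prog
  /-- `const x k` is `R x := k` -/
  | const (x k : ℕ)
  /-- `op o x y z` is `R x := o (R y) (R z)` -/
  | op (o : Op) (x y z : ℕ)
  /-- `load x a y` is `R x := A a [R y]` -/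
  | load (x a y : ℕ)
  /-- `store a x y` is `A a [R x] := R y` -/
  | store (a x y : ℕ)
  /-- first `p`, then `q` -/
  | seq (p q : Prog)
  /-- if `R x < R y` then `p` else `q` -/
  | ite (x y : ℕ) (p q : Prog)
  /-- while `R x < R y` do `p` -/
  | loop (x y : ℕ) (p : Prog)

/-- Assignment to a register. -/
def State.setReg (s : State) (x v : ℕ) : State :=
  { s with reg := Function.update s.reg x v }

/-- Assignment to an array cell. -/
def State.setArr (s : State) (a i v : ℕ) : State :=
  { s with arr := Function.update s.arr a (Function.update (s.arr a) i v) }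

/-- `Exec B p s t s'`: started in state `s`, the program `p` halts in state `s'` after exactly
`t` steps, and no number that it computes on the way exceeds the word bound `B`. -/
inductive Exec (B : ℕ) : Prog → State → ℕ → State → Prop
  | const {s : State} {x k : ℕ} (h : k ≤ B) :
      Exec B (.const x k) s 1 (s.setReg x k)
  | op {s : State} {o : Op} {x y z : ℕ} (h : o.eval (s.reg y) (s.reg z) ≤ B) :
      Exec B (.op o x y z) s 1 (s.setReg x (o.eval (s.reg y) (s.reg z)))
  | load {s : State} {x a y : ℕ} :
      Exec B (.load x a y) s 1 (s.setReg x (s.arr a (s.reg y)))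
  | store {s : State} {a x y : ℕ} :
      Exec B (.store a x y) s 1 (s.setArr a (s.reg x) (s.reg y))
  | seq {p q : Prog} {s s₁ s₂ : State} {t₁ t₂ : ℕ}
      (h₁ : Exec B p s t₁ s₁) (h₂ : Exec B q s₁ t₂ s₂) :
      Exec B (.seq p q) s (t₁ + t₂) s₂
  | ite_true {x y : ℕ} {p q : Prog} {s s' : State} {t : ℕ}
      (h : s.reg x < s.reg y) (hp : Exec B p s t s') :
      Exec B (.ite x y p q) s (t + 1) s'
  | ite_false {x y : ℕ} {p q : Prog} {s s' : State} {t : ℕ}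
      (h : ¬ s.reg x < s.reg y) (hq : Exec B q s t s') :
      Exec B (.ite x y p q) s (t + 1) s'
  | loop_stop {x y : ℕ} {p : Prog} {s : State} (h : ¬ s.reg x < s.reg y) :
      Exec B (.loop x y p) s 1 s
  | loop_step {x y : ℕ} {p : Prog} {s s₁ s₂ : State} {t₁ t₂ : ℕ}
      (h : s.reg x < s.reg y) (h₁ : Exec B p s t₁ s₁) (h₂ : Exec B (.loop x y p) s₁ t₂ s₂) :
      Exec B (.loop x y p) s (t₁ + t₂ + 1) s₂

/-- The initial state: the input is written in array `0`, everything else is `0`. -/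
def init (input : List ℕ) : State where
  reg := fun _ => 0
  arr := fun a i => if a = 0 then input.getD i 0 else 0

end RAM

/-- A computational problem: its instances, their encoding as a sequence of words, and which
contents of the output array are correct for an instance. -/
structure Problem where
  Inst : Type
  enc : Inst → List ℕ
  Correct : Inst → (ℕ → ℕ) → Prop

/-- Some algorithm solves all instances `x` of `P` with `D x` in time `O(T x)`, on words whose
number of bits is logarithmic in the input length plus the time bound: the word bound is
polynomial in these.  The output is left in array `1`. -/
def SolvableInTime (P : Problem) (D : P.Inst → Prop) (T : P.Inst → ℝ) : Prop :=
  ∃ (p : RAM.Prog) (K : ℕ), ∀ x : P.Inst, D x →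
    ∃ (B t : ℕ) (s : RAM.State),
      RAM.Exec B p (RAM.init (P.enc x)) t s ∧
      P.Correct x (s.arr 1) ∧
      (t : ℝ) ≤ K * T x ∧
      (B : ℝ) ≤ (K * ((P.enc x).length + T x + 1)) ^ K

/-! ## All-Pairs Max-Flow -/

/-- A finite directed graph on the nodes `0, …, n - 1`, without loops and parallel edges,
given by the list of its edges, with natural numbers as capacities. -/
structure Network where
  n : ℕ
  /-- tail, head and capacity of each edge -/
  edges : List (Fin n × Fin n × ℕ)
  nodup : (edges.map fun e => (e.1, e.2.1)).Nodup
  loopless : ∀ e ∈ edges, e.1 ≠ e.2.1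

namespace Network

/-- The number of edges. -/
def m (G : Network) : ℕ := G.edges.length

/-- The capacity from `u` to `v`, which is `0` if there is no such edge. -/
def cap (G : Network) (u v : Fin G.n) : ℕ :=
  ((G.edges.filter fun e => e.1 = u ∧ e.2.1 = v).map fun e => e.2.2).sum

/-- `f` is a feasible flow from `s` to `t`. -/
def IsFlow (G : Network) (s t : Fin G.n) (f : Fin G.n → Fin G.n → ℝ) : Prop :=
  (∀ u v, 0 ≤ f u v ∧ f u v ≤ G.cap u v) ∧
  ∀ v, v ≠ s → v ≠ t → ∑ u, f u v = ∑ u, f v u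

/-- `x` is the maximum amount of flow that can be shipped from `s` to `t`. -/
def IsMaxFlowValue (G : Network) (s t : Fin G.n) (x : ℝ) : Prop :=
  IsGreatest {y : ℝ | ∃ f, G.IsFlow s t f ∧ y = ∑ v, f s v - ∑ v, f v s} x

/-- The numbers of nodes and edges, followed by tail, head and capacity of every edge. -/
def enc (G : Network) : List ℕ :=
  G.n :: G.m :: G.edges.flatMap fun e => [e.1.val, e.2.1.val, e.2.2]

/-- All edge capacities are in `{1, …, U}`. -/
def CapacitiesIn (G : Network) (U : ℕ) : Prop :=
  ∀ e ∈ G.edges, 1 ≤ e.2.2 ∧ e.2.2 ≤ U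

end Network

/-- Given a network, output for all pairs of distinct nodes `u`, `v` the maximum flow value
from `u` to `v`, as entry `u * n + v` of the output. -/
def AllPairsMaxFlow : Problem where
  Inst := Network
  enc := Network.enc
  Correct G out := ∀ u v : Fin G.n, u ≠ v →
    G.IsMaxFlowValue u v (out (u.val * G.n + v.val) : ℝ)

/-! ## Satisfiability -/

/-- A formula in conjunctive normal form on the variables `0, …, n - 1`: a list of clauses, each
of which is a list of distinct literals, a literal being a variable and its sign. -/
structure CNF where
  n : ℕ
  clauses : List (List (Fin n × Bool))
  nodup : ∀ c ∈ clauses, c.Nodup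

namespace CNF

/-- The number of clauses. -/
def m (F : CNF) : ℕ := F.clauses.length

/-- The number of clauses that an assignment satisfies. -/
def numSat (F : CNF) (a : Fin F.n → Bool) : ℕ :=
  F.clauses.countP fun c => c.any fun l => a l.1 == l.2

/-- Some assignment satisfies all clauses. -/
def Satisfiable (F : CNF) : Prop :=
  ∃ a : Fin F.n → Bool, ∀ c ∈ F.clauses, ∃ l ∈ c, a l.1 = l.2

/-- The numbers of variables and clauses, followed by every clause: its length and its literals,
where `2 * v` and `2 * v + 1` stand for the negative and positive literal of the variable `v`. -/
def enc (F : CNF) : List ℕ :=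
  F.n :: F.m :: F.clauses.flatMap fun c =>
    c.length :: c.map fun l => 2 * l.1.val + l.2.toNat

/-- All clauses have at most `k` literals. -/
def WidthLE (F : CNF) (k : ℕ) : Prop :=
  ∀ c ∈ F.clauses, c.length ≤ k

end CNF

/-- Output the maximum number of clauses of a CNF formula that can be satisfied. -/
def MaxCNFSAT : Problem where
  Inst := CNF
  enc := CNF.enc
  Correct F out := IsGreatest (Set.range F.numSat) (out 0)

/-- Decide whether a CNF formula is satisfiable: output `1` if it is, and `0` if not. -/
def CNFSAT : Problem where
  Inst := CNF
  enc := CNF.enc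
  Correct F out := (F.Satisfiable ∧ out 0 = 1) ∨ (¬ F.Satisfiable ∧ out 0 = 0)

/-- The Strong Exponential Time Hypothesis: for every `ε > 0` there is `k ≥ 3` such that `k`-SAT on
`n` variables and `m` clauses cannot be solved in time `2 ^ ((1 - ε) n) poly(m)`.
(The polynomials are `(m + 1) ^ c`, so that they do not vanish at `m = 0`.) -/
def SETH : Prop :=
  ∀ ε : ℝ, 0 < ε → ∃ k : ℕ, 3 ≤ k ∧ ∀ c : ℕ,
    ¬ SolvableInTime CNFSAT (fun F : CNF => F.WidthLE k)
      (fun F : CNF => (2 : ℝ) ^ ((1 - ε) * (F.n : ℝ)) * ((F.m : ℝ) + 1) ^ c)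

/-!
A formula with `n` variables is split into three blocks of about `n / 3` variables, with
`N ≈ 2 ^ (n / 3)` partial assignments each. An empty clause is added, so that every assignment
violates some clause, and `M` is the number of clauses then. For a partial assignment `a` of the
first block, `b` of the second and `c` of the third, let `unsatCount` be the number of clauses that
none of the three satisfies, and `passCount` the number of those that only `c` satisfies.

The gadget network has a source for every `a`, and a sink for every `c` and every threshold
`k + 1 ≤ M`. A clause that `a` violates can receive flow from the source of `a`; it passes on one
unit to each `b` that violates it as well. From there the unit may proceed directly to the sinks of
those `c` that satisfy the clause, or else through a bottleneck that belongs to `b` and has capacity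
`k + 1` on the way to the sinks with threshold `k + 1`. So the maximum flow from `a` to `(c, k)` is
`∑ b, (passCount + min (k + 1) unsatCount)` (`RAM.gadget_isMaxFlowValue`). This amount is attained
by an explicit superposition of paths (`Network.exists_isFlow_of_paths`, `RAM.pathFlow_le_cap`), and
bounded by an explicit cut (`Network.IsFlow.value_le`, `RAM.gadgetEdges_cut`).

As `unsatCount ≥ 1`, raising the threshold from `1` to `k + 1` increases the flow by `N * k` unless
some `b` has `unsatCount ≤ k` (`RAM.gadgetFlow_lt_iff`). Hence the all-pairs values reveal whether
some assignment violates at most `k` clauses, and so the maximum number of satisfied clauses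
(`CNF.isGreatest_scan`). The point is that only `a` and `c` are enumerated as pairs of nodes,
whereas the sum over `b` is the work of the flow algorithm.

The network has `E ≤ 16 * N * M` edges, as many nodes, and capacities at most `E`. Therefore
`(E ^ 3) ^ (1 - ε)` is at most `2 ^ ((1 - ε) * n)` up to a polynomial in `M`, while the network is
written in time `N * poly (n, M)`, and the final scan takes `N ^ 2 * M` steps up to a constant. The
program `RAM.solver` writes the network, calls the given program on fresh registers and arrays
(`RAM.Exec.shift`) and scans the output; `RAM.solver_halts` gives its result and running time, and
`exists_maxSat_program` the bounds in terms of the formula.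

If the number of clauses is linear in `n`, the polynomial factor is absorbed by halving the gain in
the exponent. For the refutation of SETH a polynomial factor in the number of clauses is allowed, so
that the same program, followed by a comparison with the number of clauses, decides `k`-SAT for all
`k` at once, and no sparsification is needed.
-/

/-! ### Reasoning about RAM programs -/

namespace RAM

/-- Sequential composition of programs. -/
infixr:60 " ;; " => Prog.seq

@[simp] theorem State.setReg_reg (s : State) (x v r : ℕ) :
    (s.setReg x v).reg r = if r = x then v else s.reg r := by
  simp [State.setReg, Function.update_apply]

@[simp] theorem State.setReg_arr (s : State) (x v : ℕ) : (s.setReg x v).arr = s.arr := rfl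

@[simp] theorem State.setArr_reg (s : State) (a i v : ℕ) : (s.setArr a i v).reg = s.reg := rfl

theorem State.setArr_arr (s : State) (a i v b : ℕ) :
    (s.setArr a i v).arr b = if b = a then Function.update (s.arr a) i v else s.arr b := by
  simp [State.setArr, Function.update_apply]

/-- The array whose first cells hold the list `l`, all further cells being `0`. -/
def listArr (l : List ℕ) : ℕ → ℕ := fun i => l.getD i 0

theorem update_listArr_length (l : List ℕ) (v : ℕ) :
    Function.update (listArr l) l.length v = listArr (l ++ [v]) := by
  funext i
  rcases lt_trichotomy i l.length with h | rfl | h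
  · rw [Function.update_of_ne h.ne]
    simp [listArr, List.getD_eq_getElem?_getD, List.getElem?_append_left h]
  · simp [listArr, List.getD_eq_getElem?_getD]
  · rw [Function.update_of_ne h.ne']
    have h' : (l ++ [v]).length ≤ i := by simpa using h
    simp [listArr, List.getD_eq_getElem?_getD, h.le, List.getElem?_eq_none h']

/-- Correctness together with a time bound: started in `s`, the program `p` halts within `T` steps,
on words bounded by `B`, in a state satisfying `Q`. -/
def Halts (B : ℕ) (p : Prog) (T : ℕ) (Q : State → Prop) (s : State) : Prop :=
  ∃ t s', t ≤ T ∧ Exec B p s t s' ∧ Q s'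

theorem Exec.mono {B B' : ℕ} (hB : B ≤ B') {p : Prog} {s s' : State} {t : ℕ}
    (h : Exec B p s t s') : Exec B' p s t s' := by
  induction h with
  | const h => exact .const (h.trans hB)
  | op h => exact .op (h.trans hB)
  | load => exact .load
  | store => exact .store
  | seq _ _ h₁ h₂ => exact .seq h₁ h₂
  | ite_true h _ hp => exact .ite_true h hp
  | ite_false h _ hq => exact .ite_false h hq
  | loop_stop h => exact Exec.loop_stop h
  | loop_step h _ _ h₁ h₂ => exact .loop_step h h₁ h₂

namespace Halts

variable {B T T' T₁ T₂ : ℕ} {p q : Prog} {Q Q' : State → Prop} {s : State}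

theorem mono (h : Halts B p T Q s) (hT : T ≤ T') (hQ : ∀ s', Q s' → Q' s') :
    Halts B p T' Q' s := by
  obtain ⟨t, s', ht, he, hq⟩ := h
  exact ⟨t, s', ht.trans hT, he, hQ _ hq⟩

theorem const {x k : ℕ} (hk : k ≤ B) (h : Q (s.setReg x k)) : Halts B (.const x k) 1 Q s :=
  ⟨1, _, le_rfl, .const hk, h⟩

theorem op {o : Op} {x y z v : ℕ} (hv : o.eval (s.reg y) (s.reg z) = v) (hk : v ≤ B)
    (h : Q (s.setReg x v)) : Halts B (.op o x y z) 1 Q s := by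
  subst hv
  exact ⟨1, _, le_rfl, .op hk, h⟩

theorem load {x a y v : ℕ} (hv : s.arr a (s.reg y) = v) (h : Q (s.setReg x v)) :
    Halts B (.load x a y) 1 Q s := by
  subst hv
  exact ⟨1, _, le_rfl, .load, h⟩

theorem store {a x y : ℕ} (h : Q (s.setArr a (s.reg x) (s.reg y))) :
    Halts B (.store a x y) 1 Q s :=
  ⟨1, _, le_rfl, .store, h⟩

theorem seq (h : Halts B p T₁ (fun s' => Halts B q T₂ Q s') s) :
    Halts B (p ;; q) (T₁ + T₂) Q s := by
  obtain ⟨t₁, s₁, ht₁, he₁, t₂, s₂, ht₂, he₂, hq⟩ := h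
  exact ⟨_, _, Nat.add_le_add ht₁ ht₂, .seq he₁ he₂, hq⟩

theorem ite {x y : ℕ} (hp : s.reg x < s.reg y → Halts B p T Q s)
    (hq : ¬ s.reg x < s.reg y → Halts B q T Q s) : Halts B (.ite x y p q) (T + 1) Q s := by
  by_cases h : s.reg x < s.reg y
  · obtain ⟨t, s', ht, he, hQ⟩ := hp h
    exact ⟨_, _, Nat.succ_le_succ ht, .ite_true h he, hQ⟩
  · obtain ⟨t, s', ht, he, hQ⟩ := hq h
    exact ⟨_, _, Nat.succ_le_succ ht, .ite_false h he, hQ⟩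

end Halts

/-- Whether the program contains an assignment to register `r`. -/
def Prog.setsReg : Prog → ℕ → Bool
  | .const x _, r => r == x
  | .op _ x _ _, r => r == x
  | .load x _ _, r => r == x
  | .store _ _ _, _ => false
  | .seq p q, r => p.setsReg r || q.setsReg r
  | .ite _ _ p q, r => p.setsReg r || q.setsReg r
  | .loop _ _ p, r => p.setsReg r

/-- Whether the program contains an assignment to a cell of array `b`. -/
def Prog.setsArr : Prog → ℕ → Bool
  | .const _ _, _ => false
  | .op _ _ _ _, _ => false
  | .load _ _ _, _ => false
  | .store a _ _, b => b == a
  | .seq p q, b => p.setsArr b || q.setsArr b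
  | .ite _ _ p q, b => p.setsArr b || q.setsArr b
  | .loop _ _ p, b => p.setsArr b

/-- The states `s` and `s'` agree on everything that `p` does not assign to. -/
def Frame (p : Prog) (s s' : State) : Prop :=
  (∀ r, p.setsReg r = false → s'.reg r = s.reg r) ∧
    ∀ a, p.setsArr a = false → s'.arr a = s.arr a

theorem Frame.refl (p : Prog) (s : State) : Frame p s s := ⟨fun _ _ => rfl, fun _ _ => rfl⟩

theorem Frame.trans {p : Prog} {s₁ s₂ s₃ : State} (h : Frame p s₁ s₂) (h' : Frame p s₂ s₃) :
    Frame p s₁ s₃ :=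
  ⟨fun r hr => (h'.1 r hr).trans (h.1 r hr), fun a ha => (h'.2 a ha).trans (h.2 a ha)⟩

theorem Exec.frame {B : ℕ} {p : Prog} {s s' : State} {t : ℕ} (h : Exec B p s t s') :
    Frame p s s' := by
  induction h with
  | const h => exact ⟨fun r hr => by simp_all [Prog.setsReg], fun _ _ => rfl⟩
  | op h => exact ⟨fun r hr => by simp_all [Prog.setsReg], fun _ _ => rfl⟩
  | load => exact ⟨fun r hr => by simp_all [Prog.setsReg], fun _ _ => rfl⟩
  | store =>
    exact ⟨fun _ _ => rfl, fun b hb => by simp_all [Prog.setsArr, State.setArr_arr]⟩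
  | seq _ _ h₁ h₂ =>
    refine ⟨fun r hr => ?_, fun a ha => ?_⟩
    · simp only [Prog.setsReg, Bool.or_eq_false_iff] at hr
      rw [h₂.1 r hr.2, h₁.1 r hr.1]
    · simp only [Prog.setsArr, Bool.or_eq_false_iff] at ha
      rw [h₂.2 a ha.2, h₁.2 a ha.1]
  | ite_true h _ hp =>
    refine ⟨fun r hr => ?_, fun a ha => ?_⟩
    · simp only [Prog.setsReg, Bool.or_eq_false_iff] at hr
      exact hp.1 r hr.1
    · simp only [Prog.setsArr, Bool.or_eq_false_iff] at ha
      exact hp.2 a ha.1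
  | ite_false h _ hq =>
    refine ⟨fun r hr => ?_, fun a ha => ?_⟩
    · simp only [Prog.setsReg, Bool.or_eq_false_iff] at hr
      exact hq.1 r hr.2
    · simp only [Prog.setsArr, Bool.or_eq_false_iff] at ha
      exact hq.2 a ha.2
  | loop_stop h => exact Frame.refl _ _
  | loop_step h _ _ h₁ h₂ =>
    exact Frame.trans (p := .loop _ _ _) ⟨fun r hr => h₁.1 r hr, fun a ha => h₁.2 a ha⟩ h₂

theorem Halts.frame {B T : ℕ} {p : Prog} {Q : State → Prop} {s : State} (h : Halts B p T Q s) :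
    Halts B p T (fun s' => Q s' ∧ Frame p s s') s := by
  obtain ⟨t, s', ht, he, hq⟩ := h
  exact ⟨t, s', ht, he, hq, he.frame⟩

/-- Loop rule for a loop with exactly `n` iterations. The invariant `I` has to speak only about
what the loop body assigns to; the rest is provided by `Frame`. -/
theorem Halts.loop {B T : ℕ} {x y : ℕ} {p : Prog} {s₀ : State} (I : ℕ → State → Prop) (n : ℕ)
    (h₀ : I 0 s₀)
    (hstep : ∀ i < n, ∀ s, I i s → Frame p s₀ s →
      s.reg x < s.reg y ∧ Halts B p T (I (i + 1)) s)
    (hend : ∀ s, I n s → Frame p s₀ s → ¬ s.reg x < s.reg y) :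
    Halts B (.loop x y p) (n * (T + 1) + 1) (fun s => I n s ∧ Frame p s₀ s) s₀ := by
  suffices H : ∀ k i, i + k = n → ∀ s, I i s → Frame p s₀ s →
      Halts B (.loop x y p) (k * (T + 1) + 1) (fun s => I n s ∧ Frame p s₀ s) s from
    H n 0 (by omega) s₀ h₀ (Frame.refl _ _)
  intro k
  induction k with
  | zero =>
    intro i hi s hI hf
    obtain rfl : i = n := by omega
    exact ⟨1, s, by omega, Exec.loop_stop (hend s hI hf), hI, hf⟩
  | succ k ih =>
    intro i hi s hI hf
    obtain ⟨hlt, t₁, s₁, ht₁, he₁, hI₁⟩ := hstep i (by omega) s hI hf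
    obtain ⟨t₂, s₂, ht₂, he₂, hQ⟩ := ih (i + 1) (by omega) s₁ hI₁ (hf.trans he₁.frame)
    refine ⟨_, s₂, ?_, .loop_step hlt he₁ he₂, hQ⟩
    have : (k + 1) * (T + 1) = k * (T + 1) + (T + 1) := by ring
    omega

/-! ### Running a program as a subroutine -/

/-- The program `p` with its registers shifted by `d` and its arrays shifted by `e`. -/
def Prog.shift (d e : ℕ) : Prog → Prog
  | .const x k => .const (x + d) k
  | .op o x y z => .op o (x + d) (y + d) (z + d)
  | .load x a y => .load (x + d) (a + e) (y + d)
  | .store a x y => .store (a + e) (x + d) (y + d)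
  | .seq p q => .seq (p.shift d e) (q.shift d e)
  | .ite x y p q => .ite (x + d) (y + d) (p.shift d e) (q.shift d e)
  | .loop x y p => .loop (x + d) (y + d) (p.shift d e)

/-- The part of the state that starts with register `d` and array `e`. -/
def State.upper (d e : ℕ) (s : State) : State where
  reg x := s.reg (x + d)
  arr a := s.arr (a + e)

theorem State.upper_setReg (d e : ℕ) (s : State) (x v : ℕ) :
    (s.setReg (x + d) v).upper d e = (s.upper d e).setReg x v := by
  simp only [State.upper, State.setReg, State.mk.injEq, and_true]
  funext r
  simp [Function.update_apply]

theorem State.upper_setArr (d e : ℕ) (s : State) (a i v : ℕ) :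
    (s.setArr (a + e) i v).upper d e = (s.upper d e).setArr a i v := by
  simp only [State.upper, State.setArr, State.mk.injEq, true_and]
  funext r
  simp [Function.update_apply]

/-- A shifted program runs on the upper part of the state as the program itself does on the whole
state, in the same time. -/
theorem Exec.shift (d e : ℕ) {B : ℕ} {p : Prog} {s s' : State} {t : ℕ} (h : Exec B p s t s') :
    ∀ S : State, S.upper d e = s →
      ∃ S' : State, Exec B (p.shift d e) S t S' ∧ S'.upper d e = s' := by
  induction h with
  | const h =>
    rintro S rfl
    exact ⟨_, .const h, State.upper_setReg d e S _ _⟩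
  | op h =>
    rintro S rfl
    exact ⟨_, .op h, State.upper_setReg d e S _ _⟩
  | load =>
    rintro S rfl
    exact ⟨_, .load, State.upper_setReg d e S _ _⟩
  | store =>
    rintro S rfl
    exact ⟨_, .store, State.upper_setArr d e S _ _ _⟩
  | seq _ _ h₁ h₂ =>
    intro S hS
    obtain ⟨S₁, e₁, hS₁⟩ := h₁ S hS
    obtain ⟨S₂, e₂, hS₂⟩ := h₂ S₁ hS₁
    exact ⟨S₂, .seq e₁ e₂, hS₂⟩
  | ite_true h _ hp =>
    rintro S rfl
    obtain ⟨S₁, e₁, hS₁⟩ := hp S rfl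
    exact ⟨S₁, .ite_true h e₁, hS₁⟩
  | ite_false h _ hq =>
    rintro S rfl
    obtain ⟨S₁, e₁, hS₁⟩ := hq S rfl
    exact ⟨S₁, .ite_false h e₁, hS₁⟩
  | loop_stop h =>
    rintro S rfl
    exact ⟨S, Exec.loop_stop h, rfl⟩
  | loop_step h _ _ h₁ h₂ =>
    rintro S rfl
    obtain ⟨S₁, e₁, hS₁⟩ := h₁ S rfl
    obtain ⟨S₂, e₂, hS₂⟩ := h₂ S₁ hS₁
    exact ⟨S₂, .loop_step h e₁ e₂, hS₂⟩

theorem Prog.setsReg_shift {d e r : ℕ} (hr : r < d) (p : Prog) :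
    (p.shift d e).setsReg r = false := by
  induction p <;> simp_all [Prog.shift, Prog.setsReg]; all_goals omega

theorem Prog.setsArr_shift {d e a : ℕ} (ha : a < e) (p : Prog) :
    (p.shift d e).setsArr a = false := by
  induction p <;> simp_all [Prog.shift, Prog.setsArr]; all_goals omega

end RAM

/-! ### Tabulating which partial assignments satisfy which clauses -/

namespace RAM

-- Names for registers, after their contents. The registers `rT` and `rD` hold intermediate results,
-- and `rZero` keeps its initial value `0`.
notation "rZero" => (0 : ℕ)
notation "rOne" => (1 : ℕ)
notation "rVars" => (2 : ℕ)
notation "rCls" => (3 : ℕ)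
notation "rH" => (4 : ℕ)
notation "rN" => (5 : ℕ)
notation "rNM" => (6 : ℕ)
notation "rTwo" => (7 : ℕ)
notation "rEight" => (8 : ℕ)
notation "rThreeN" => (9 : ℕ)
notation "rV" => (10 : ℕ)
notation "rW" => (11 : ℕ)
notation "rPtr" => (12 : ℕ)
notation "rJ" => (13 : ℕ)
notation "rLen" => (14 : ℕ)
notation "rFlag" => (15 : ℕ)
notation "rL" => (16 : ℕ)
notation "rLit" => (17 : ℕ)
notation "rT" => (18 : ℕ)
notation "rD" => (19 : ℕ)
notation "rCnt" => (20 : ℕ)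
notation "rBlk" => (21 : ℕ)
notation "rAsg" => (22 : ℕ)

/-- Whether the partial assignment with number `w` makes the literal with code `lit` true.  The
variables come in three blocks of `h` variables each, with `N = 2 ^ h` assignments, and `w` stands
for the assignment `w % N` of the block `w / N`. -/
def litTrue (h N w lit : ℕ) : Bool :=
  lit / 2 / h = w / N ∧ ((w % N) >>> (lit / 2 % h)) % 2 = lit % 2

/-- The indicator of `litTrue` for some literal of the clause `c`. -/
def clauseFlag (h N w : ℕ) (c : List ℕ) : ℕ := (c.any (litTrue h N w)).toNat

/-- Test of one literal, whose address is in `rPtr`. -/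
def litTest : Prog :=
  .load rLit 0 rPtr ;; .op .add rPtr rPtr rOne ;; .op .div rT rLit rTwo ;;
  .op .mod rLit rLit rTwo ;; .op .div rD rT rH ;; .op .mod rT rT rH ;;
  .op .shr rT rAsg rT ;; .op .mod rT rT rTwo ;;
  -- the sum of the two truncated differences vanishes only between equal numbers
  .op .sub rCnt rT rLit ;; .op .sub rLit rLit rT ;; .op .add rLit rLit rCnt ;;
  .op .sub rT rBlk rD ;; .op .sub rD rD rBlk ;; .op .add rD rD rT ;;
  .op .add rD rD rLit ;;
  .ite rD rOne (.const rFlag 1) (.const rT 0) ;;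
  .op .add rL rL rOne

/-- Test of all literals of a clause, whose length is in `rLen`. -/
def clauseTest : Prog :=
  .load rLen 0 rPtr ;; .op .add rPtr rPtr rOne ;; .const rFlag 0 ;; .const rL 0 ;;
  .loop rL rLen litTest ;;
  .op .mul rT rW rCls ;; .op .add rT rT rJ ;; .store 2 rT rFlag ;; .op .add rJ rJ rOne

/-- Test of all clauses under the partial assignment `rW`. -/
def assignmentTest : Prog :=
  .op .div rBlk rW rN ;; .op .mod rAsg rW rN ;; .const rPtr 2 ;; .const rJ 0 ;;
  .loop rJ rCls clauseTest ;; .op .add rW rW rOne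

/-- The table of all clauses under all partial assignments, row by row, is left in array `2`. -/
def tabulate : Prog := .const rW 0 ;; .loop rW rThreeN assignmentTest

theorem litTest_halts {B h N w x p i f : ℕ} {s : State} (h1 : s.reg rOne = 1)
    (h2 : s.reg rTwo = 2) (hH : s.reg rH = h) (hBlk : s.reg rBlk = w / N)
    (hAsg : s.reg rAsg = w % N) (hp : s.reg rPtr = p) (hx : s.arr 0 p = x)
    (hi : s.reg rL = i) (hf : s.reg rFlag = f)
    (hxB : x + 1 ≤ B) (hwB : w + 1 ≤ B) (hpB : p + 1 ≤ B) (hiB : i + 1 ≤ B) :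
    Halts B litTest 18 (fun s' => s'.reg rPtr = p + 1 ∧ s'.reg rL = i + 1 ∧
      s'.reg rFlag = if litTrue h N w x then 1 else f) s := by
  have hshr : (w % N) >>> (x / 2 % h) ≤ w % N := by
    rw [Nat.shiftRight_eq_div_pow]; exact Nat.div_le_self _ _
  have hmod := Nat.mod_le w N
  have hdiv := Nat.div_le_self w N
  have hd := Nat.div_le_self (x / 2) h
  have hm := Nat.mod_le (x / 2) h
  have hlit : litTrue h N w x = true ↔ x / 2 / h = w / N ∧
      ((w % N) >>> (x / 2 % h)) % 2 = x % 2 := by simp [litTrue]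
  obtain ⟨y, hy⟩ : ∃ y, y = x / 2 := ⟨_, rfl⟩
  obtain ⟨z, hz⟩ : ∃ z, z = x % 2 := ⟨_, rfl⟩
  obtain ⟨b, hb⟩ : ∃ b, b = y / h := ⟨_, rfl⟩
  obtain ⟨q, hq⟩ : ∃ q, q = y % h := ⟨_, rfl⟩
  obtain ⟨k, hk⟩ : ∃ k, k = w / N := ⟨_, rfl⟩
  obtain ⟨a, ha⟩ : ∃ a, a = w % N := ⟨_, rfl⟩
  obtain ⟨c, hc⟩ : ∃ c, c = a >>> q := ⟨_, rfl⟩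
  obtain ⟨e, he⟩ : ∃ e, e = c % 2 := ⟨_, rfl⟩
  rw [← hy, ← hz, ← hb, ← hq, ← hk, ← ha, ← hc, ← he] at hlit
  rw [← hy, ← hq, ← ha, ← hc] at hshr
  rw [← hk] at hBlk hdiv
  rw [← ha] at hAsg hmod
  rw [← hy, ← hb] at hd
  rw [← hy, ← hq] at hm
  refine (Halts.seq <| Halts.load (v := x) ?_ <|
    Halts.seq <| Halts.op (v := p + 1) ?_ ?_ <|
    Halts.seq <| Halts.op (v := y) ?_ ?_ <|
    Halts.seq <| Halts.op (v := z) ?_ ?_ <|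
    Halts.seq <| Halts.op (v := b) ?_ ?_ <|
    Halts.seq <| Halts.op (v := q) ?_ ?_ <|
    Halts.seq <| Halts.op (v := c) ?_ ?_ <|
    Halts.seq <| Halts.op (v := e) ?_ ?_ <|
    Halts.seq <| Halts.op (v := e - z) ?_ ?_ <|
    Halts.seq <| Halts.op (v := z - e) ?_ ?_ <|
    Halts.seq <| Halts.op (v := z - e + (e - z)) ?_ ?_ <|
    Halts.seq <| Halts.op (v := k - b) ?_ ?_ <|
    Halts.seq <| Halts.op (v := b - k) ?_ ?_ <|
    Halts.seq <| Halts.op (v := b - k + (k - b)) ?_ ?_ <|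
    Halts.seq <| Halts.op (v := b - k + (k - b) + (z - e + (e - z))) ?_ ?_ <|
    Halts.seq <| Halts.ite (T := 1)
      (fun hlt => Halts.const (by omega) <| Halts.op (v := i + 1) ?_ hiB ?_)
      (fun hlt => Halts.const (by omega) <| Halts.op (v := i + 1) ?_ hiB ?_)).mono
      (by norm_num) (fun _ h => h)
  all_goals try (clear hlit; simp [Op.eval, *]; done)
  all_goals try omega
  · simp only [State.setReg_reg] at hlt
    norm_num [h1] at hlt
    rw [if_pos (hlit.2 (by omega))]
    simp
  · simp only [State.setReg_reg] at hlt
    norm_num [h1] at hlt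
    rw [if_neg (fun h => by have := hlit.1 h; omega)]
    simp [hf]

/-- The list of words that describes the clauses `cs` in the input. -/
def clauseWords (cs : List (List ℕ)) : List ℕ := cs.flatMap fun c => c.length :: c

theorem clauseWords_take_succ (cs : List (List ℕ)) {j : ℕ} (hj : j < cs.length) :
    clauseWords (cs.take (j + 1)) = clauseWords (cs.take j) ++ (cs[j].length :: cs[j]) := by
  rw [clauseWords, List.take_succ_eq_append_getElem hj, List.flatMap_append]
  rw [List.flatMap_singleton, clauseWords]

theorem clauseWords_split (cs : List (List ℕ)) {j : ℕ} (hj : j < cs.length) :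
    clauseWords cs =
      clauseWords (cs.take j) ++ (cs[j].length :: cs[j]) ++ clauseWords (cs.drop (j + 1)) := by
  rw [← clauseWords_take_succ cs hj]
  simp only [clauseWords, ← List.flatMap_append, List.take_append_drop]

/-- The address in the input where clause `j` begins. -/
def clausePos (cs : List (List ℕ)) (j : ℕ) : ℕ := 2 + (clauseWords (cs.take j)).length

theorem clausePos_succ (cs : List (List ℕ)) {j : ℕ} (hj : j < cs.length) :
    clausePos cs (j + 1) = clausePos cs j + 1 + cs[j].length := by
  rw [clausePos, clauseWords_take_succ cs hj, clausePos]
  simp only [List.length_append, List.length_cons]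
  ring

theorem clausePos_le (cs : List (List ℕ)) (j : ℕ) :
    clausePos cs j ≤ 2 + (clauseWords cs).length := by
  conv_rhs => rw [← List.take_append_drop j cs]
  rw [clauseWords, List.flatMap_append, List.length_append, clausePos, clauseWords]
  omega

theorem listArr_clausePos (n m : ℕ) (cs : List (List ℕ)) {j : ℕ} (hj : j < cs.length) :
    listArr (n :: m :: clauseWords cs) (clausePos cs j) = cs[j].length := by
  rw [clausePos, Nat.add_comm, clauseWords_split cs hj]
  simp [listArr]

theorem listArr_clausePos_add (n m : ℕ) (cs : List (List ℕ)) {j i : ℕ} (hj : j < cs.length)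
    (hi : i < cs[j].length) :
    listArr (n :: m :: clauseWords cs) (clausePos cs j + 1 + i) = cs[j][i] := by
  rw [clausePos, show 2 + (clauseWords (cs.take j)).length + 1 + i =
    (clauseWords (cs.take j)).length + (i + 1) + 2 by ring, clauseWords_split cs hj]
  simp [listArr, List.getElem?_append, hi]

theorem clauseFlag_take_succ (h N w : ℕ) (l : List ℕ) {i : ℕ} (hi : i < l.length) :
    clauseFlag h N w (l.take (i + 1)) =
      if litTrue h N w l[i] then 1 else clauseFlag h N w (l.take i) := by
  unfold clauseFlag
  rw [List.take_succ_eq_append_getElem hi, List.any_append]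
  by_cases h' : litTrue h N w l[i] <;> simp [h']

/-- The values of `f` on `0, …, k - 1`, as array contents. -/
def tableArr (f : ℕ → ℕ) (k : ℕ) : ℕ → ℕ := fun x => if x < k then f x else 0

theorem update_tableArr (f : ℕ → ℕ) (k : ℕ) :
    Function.update (tableArr f k) k (f k) = tableArr f (k + 1) := by
  funext x
  rcases lt_trichotomy x k with h | rfl | h
  · rw [Function.update_of_ne h.ne]
    simp [tableArr, h, h.trans (Nat.lt_succ_self k)]
  · simp [tableArr]
  · rw [Function.update_of_ne h.ne']
    simp [tableArr, show ¬ x < k by omega, show ¬ x < k + 1 by omega]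

/-- The registers hold the parameters of the reduction, and array `0` holds the input: the clauses
are `cs`, the last of which may be the empty clause that is read behind the end of the input. -/
structure Setup (n m h N : ℕ) (cs : List (List ℕ)) (s : State) : Prop where
  zero : s.reg rZero = 0
  one : s.reg rOne = 1
  cls : s.reg rCls = cs.length
  hgt : s.reg rH = h
  asg : s.reg rN = N
  prod : s.reg rNM = N * cs.length
  two : s.reg rTwo = 2
  eight : s.reg rEight = 8
  threeN : s.reg rThreeN = 3 * N
  nodes : s.reg rV = 8 * (N * cs.length)
  input : s.arr 0 = listArr (n :: m :: clauseWords cs)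

theorem Setup.frame {n m h N : ℕ} {cs : List (List ℕ)} {s s' : State} {p : Prog}
    (hs : Setup n m h N cs s) (hf : Frame p s s')
    (hr : ∀ r < 11, r ≠ rVars → p.setsReg r = false) (ha : p.setsArr 0 = false) :
    Setup n m h N cs s' where
  zero := (hf.1 _ (hr _ (by norm_num) (by norm_num))).trans hs.zero
  one := (hf.1 _ (hr _ (by norm_num) (by norm_num))).trans hs.one
  cls := (hf.1 _ (hr _ (by norm_num) (by norm_num))).trans hs.cls
  hgt := (hf.1 _ (hr _ (by norm_num) (by norm_num))).trans hs.hgt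
  asg := (hf.1 _ (hr _ (by norm_num) (by norm_num))).trans hs.asg
  prod := (hf.1 _ (hr _ (by norm_num) (by norm_num))).trans hs.prod
  two := (hf.1 _ (hr _ (by norm_num) (by norm_num))).trans hs.two
  eight := (hf.1 _ (hr _ (by norm_num) (by norm_num))).trans hs.eight
  threeN := (hf.1 _ (hr _ (by norm_num) (by norm_num))).trans hs.threeN
  nodes := (hf.1 _ (hr _ (by norm_num) (by norm_num))).trans hs.nodes
  input := (hf.2 _ ha).trans hs.input

theorem clauseTest_halts {B n m h N w j D : ℕ} {cs : List (List ℕ)} {f : ℕ → ℕ} {s : State}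
    (hs : Setup n m h N cs s) (hBlk : s.reg rBlk = w / N) (hAsg : s.reg rAsg = w % N)
    (hW : s.reg rW = w) (hp : s.reg rPtr = clausePos cs j) (hJ : s.reg rJ = j)
    (hj : j < cs.length) (hD : cs[j].length ≤ D)
    (hf : f (w * cs.length + j) = clauseFlag h N w cs[j])
    (hA : s.arr 2 = tableArr f (w * cs.length + j))
    (hcs : (clauseWords cs).length + 3 ≤ B) (hlit : ∀ x ∈ cs[j], x + 1 ≤ B)
    (hB : (w + 1) * cs.length + 1 ≤ B) (hwB : w + 1 ≤ B) :
    Halts B clauseTest (D * 19 + 9) (fun s' => s'.reg rPtr = clausePos cs (j + 1) ∧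
      s'.reg rJ = j + 1 ∧ s'.arr 2 = tableArr f (w * cs.length + (j + 1))) s := by
  have hpos := clausePos_le cs (j + 1)
  rw [clausePos_succ cs hj] at hpos
  have hB' : w * cs.length + cs.length + 1 ≤ B := by rw [add_mul, one_mul] at hB; exact hB
  refine (Halts.seq <| Halts.load (v := cs[j].length) ?_ <|
    Halts.seq <| Halts.op (v := clausePos cs j + 1) ?_ ?_ <|
    Halts.seq <| Halts.const (Nat.zero_le _) <|
    Halts.seq <| Halts.const (Nat.zero_le _) <|
    Halts.seq (T₂ := 4) <| (Halts.loop (T := 18) (fun i s =>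
      s.reg rPtr = clausePos cs j + 1 + i ∧ s.reg rL = i ∧
      s.reg rFlag = clauseFlag h N w (cs[j].take i)) cs[j].length ?_ ?_ ?_).mono le_rfl ?_ :
    Halts B clauseTest (1 + (1 + (1 + (1 + (cs[j].length * (18 + 1) + 1 + 4))))) _ s).mono ?_
    (fun _ h => h)
  · simp [hp, hs.input, listArr_clausePos n m cs hj]
  · simp [Op.eval, hp, hs.one]
  · omega
  · simp [clauseFlag]
  · rintro i hi s' ⟨hP, hL, hF⟩ hfr
    have hone := hfr.1 rOne rfl
    have htwo := hfr.1 rTwo rfl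
    have hH := hfr.1 rH rfl
    have hblk := hfr.1 rBlk rfl
    have hasg := hfr.1 rAsg rfl
    have hlen := hfr.1 rLen rfl
    have hin := hfr.2 0 rfl
    simp [hs.one, hs.two, hs.hgt, hBlk, hAsg, hs.input] at hone htwo hH hblk hasg hlen hin
    refine ⟨by rw [hL, hlen]; exact hi, ?_⟩
    refine (litTest_halts hone htwo hH hblk hasg hP (x := cs[j][i]) ?_ hL hF
      (hlit _ (List.getElem_mem hi)) hwB (by omega) (by omega)).mono le_rfl ?_
    · rw [hin, listArr_clausePos_add n m cs hj hi]
    · rintro s'' ⟨h1, h2, h3⟩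
      exact ⟨by rw [h1]; ring, h2, by rw [h3, clauseFlag_take_succ _ _ _ _ hi]⟩
  · rintro s' ⟨hP, hL, hF⟩ hfr
    have hlen := hfr.1 rLen rfl
    simp at hlen
    omega
  · rintro s' ⟨⟨hP, hL, hF⟩, hfr⟩
    have h1 := hfr.1 rW rfl
    have h2 := hfr.1 rCls rfl
    have h3 := hfr.1 rJ rfl
    have h4 := hfr.1 rOne rfl
    have h5 := hfr.2 2 rfl
    simp [hW, hs.cls, hJ, hs.one, hA] at h1 h2 h3 h4 h5
    rw [List.take_length] at hF
    refine Halts.seq <| Halts.op (v := w * cs.length) ?_ ?_ <|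
      Halts.seq <| Halts.op (v := w * cs.length + j) ?_ ?_ <|
      Halts.seq <| Halts.store <| Halts.op (v := j + 1) ?_ ?_ ?_
    · simp [Op.eval, h1, h2]
    · omega
    · simp [Op.eval, h3]
    · omega
    · simp [Op.eval, h3, h4]
    · omega
    · simp [State.setArr_arr, hF, hP, clausePos_succ cs hj, h5, ← hf, update_tableArr, add_assoc]
  · omega

theorem assignmentTest_halts {B n m h N w D : ℕ} {cs : List (List ℕ)} {f : ℕ → ℕ} {s : State}
    (hs : Setup n m h N cs s) (hW : s.reg rW = w) (hD : ∀ c ∈ cs, c.length ≤ D)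
    (hf : ∀ j, ∀ hj : j < cs.length, f (w * cs.length + j) = clauseFlag h N w cs[j])
    (hA : s.arr 2 = tableArr f (w * cs.length))
    (hcs : (clauseWords cs).length + 3 ≤ B) (hlit : ∀ c ∈ cs, ∀ x ∈ c, x + 1 ≤ B)
    (hB : (w + 1) * cs.length + 1 ≤ B) (hwB : w + 1 ≤ B) :
    Halts B assignmentTest (cs.length * (D * 19 + 10) + 6) (fun s' => s'.reg rW = w + 1 ∧
      s'.arr 2 = tableArr f ((w + 1) * cs.length)) s := by
  have hmod := Nat.mod_le w N
  have hdiv := Nat.div_le_self w N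
  refine (Halts.seq <| Halts.op (v := w / N) ?_ ?_ <|
    Halts.seq <| Halts.op (v := w % N) ?_ ?_ <|
    Halts.seq <| Halts.const (by omega) <|
    Halts.seq <| Halts.const (by omega) <|
    Halts.seq (T₂ := 1) <| (Halts.loop (T := D * 19 + 9) (fun j s =>
      s.reg rPtr = clausePos cs j ∧ s.reg rJ = j ∧
      s.arr 2 = tableArr f (w * cs.length + j)) cs.length ?_ ?_ ?_).mono le_rfl ?_ :
    Halts B assignmentTest (1 + (1 + (1 + (1 + (cs.length * (D * 19 + 9 + 1) + 1 + 1))))) _ s).mono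
    ?_ (fun _ h => h)
  · simp [Op.eval, hW, hs.asg]
  · omega
  · simp [Op.eval, hW, hs.asg]
  · omega
  · simp [clausePos, clauseWords, hA]
  · rintro j hj s' ⟨hP, hJ, hT⟩ hfr
    have hs' : Setup n m h N cs s' := by
      refine Setup.frame ?_ hfr (by decide) rfl
      constructor <;> simp [hs.zero, hs.one, hs.two, hs.eight, hs.threeN, hs.nodes, hs.cls,
        hs.hgt, hs.asg, hs.prod, hs.input]
    have h1 := hfr.1 rBlk rfl
    have h2 := hfr.1 rAsg rfl
    have h3 := hfr.1 rW rfl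
    simp [hW] at h1 h2 h3
    exact ⟨by rw [hJ, hs'.cls]; exact hj, clauseTest_halts hs' h1 h2 h3 hP hJ hj
      (hD _ (List.getElem_mem hj)) (hf j hj) hT hcs (hlit _ (List.getElem_mem hj)) hB hwB⟩
  · rintro s' ⟨hP, hJ, hT⟩ hfr
    have h1 := hfr.1 rCls rfl
    simp [hs.cls] at h1
    omega
  · rintro s' ⟨⟨hP, hL, hF⟩, hfr⟩
    have h1 := hfr.1 rW rfl
    have h2 := hfr.1 rOne rfl
    simp [hW, hs.one] at h1 h2
    refine Halts.op (v := w + 1) ?_ hwB ?_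
    · simp [Op.eval, h1, h2]
    · simp [hF, add_mul]
  · rw [show D * 19 + 9 + 1 = D * 19 + 10 from rfl]
    omega

theorem tabulate_halts {B n m h N D : ℕ} {cs : List (List ℕ)} {f : ℕ → ℕ} {s : State}
    (hs : Setup n m h N cs s) (hD : ∀ c ∈ cs, c.length ≤ D)
    (hf : ∀ w, ∀ j, ∀ hj : j < cs.length, f (w * cs.length + j) = clauseFlag h N w cs[j])
    (hA : s.arr 2 = fun _ => 0)
    (hcs : (clauseWords cs).length + 3 ≤ B) (hlit : ∀ c ∈ cs, ∀ x ∈ c, x + 1 ≤ B)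
    (hB : 3 * N * cs.length + 1 ≤ B) (hN : 3 * N ≤ B) :
    Halts B tabulate (3 * N * (cs.length * (D * 19 + 10) + 7) + 2)
      (fun s' => s'.arr 2 = tableArr f (3 * N * cs.length)) s := by
  refine (Halts.seq <| Halts.const (Nat.zero_le _) <| (Halts.loop
    (T := cs.length * (D * 19 + 10) + 6) (fun w s => s.reg rW = w ∧
      s.arr 2 = tableArr f (w * cs.length)) (3 * N) ?_ ?_ ?_).mono le_rfl <|
    fun s' ⟨⟨_, hT⟩, _⟩ => hT).mono ?_ (fun _ h => h)
  · simp only [State.setReg_reg, State.setReg_arr, hA, zero_mul, if_true, true_and]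
    funext x
    simp [tableArr]
  · rintro w hw s' ⟨hW, hT⟩ hfr
    have hs' : Setup n m h N cs s' := by
      refine Setup.frame ?_ hfr (by decide) rfl
      constructor <;> simp [hs.zero, hs.one, hs.two, hs.eight, hs.threeN, hs.nodes, hs.cls,
        hs.hgt, hs.asg, hs.prod, hs.input]
    have : (w + 1) * cs.length ≤ 3 * N * cs.length := Nat.mul_le_mul_right _ hw
    exact ⟨by rw [hW, hs'.threeN]; exact hw,
      assignmentTest_halts hs' hW hD (hf w) hT hcs hlit (by omega) (by omega)⟩
  · rintro s' ⟨hW, hT⟩ hfr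
    have h1 := hfr.1 rThreeN rfl
    simp [hs.threeN] at h1
    omega
  · rw [show cs.length * (D * 19 + 10) + 6 + 1 = cs.length * (D * 19 + 10) + 7 from rfl]
    omega

end RAM

/-! ### Writing the network -/

namespace RAM

notation "rI" => (23 : ℕ)
notation "rOut" => (24 : ℕ)
notation "rNodeA" => (25 : ℕ)
notation "rNodeL" => (26 : ℕ)
notation "rNodeX" => (27 : ℕ)
notation "rNodeP" => (28 : ℕ)
notation "rNodeR" => (29 : ℕ)
notation "rNodeQ" => (30 : ℕ)
notation "rNodeG" => (31 : ℕ)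
notation "rNodeS" => (32 : ℕ)
notation "rSatA" => (33 : ℕ)
notation "rSatB" => (34 : ℕ)
notation "rSatC" => (35 : ℕ)
notation "rK" => (36 : ℕ)
notation "rE" => (37 : ℕ)

/-- Block `i = w * M + j` of the edges of the gadget network, for a partial assignment `w < N` and a
clause `j < M`, where `sat t w j` says whether the assignment `w` of the variable block `t`
satisfies clause `j`. A node is coded as `8 * (w * M + j)` plus its kind, where `w` or `j` is `0` if
the node does not depend on it: `0` for the source of the assignment `w` of the first block, `1` for
clause `j` after the first block, `2` for clause `j` at the assignment `w` of the second block, `3`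
for the bottleneck of that assignment, `4` for clause `j` having passed the second block, `5` for
the threshold `j + 1`, `6` for the sink of the assignment `w` of the third block with threshold
`j + 1`, and `7` for that assignment itself. The capacity `N * M` serves as infinity. -/
def gadgetBlock (N M : ℕ) (sat : ℕ → ℕ → ℕ → Bool) (i : ℕ) : List (ℕ × ℕ × ℕ) :=
  (if sat 0 (i / M) (i % M) then [] else [(i / M * M * 8, i % M * 8 + 1, N * M)]) ++
  (if sat 1 (i / M) (i % M) then [] else [(i % M * 8 + 1, i * 8 + 2, 1)]) ++
  [(i * 8 + 2, i / M * M * 8 + 3, 1)] ++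
  [(i * 8 + 2, i % M * 8 + 4, 1)] ++
  [(i / M * M * 8 + 3, i % M * 8 + 5, i % M + 1)] ++
  (if sat 2 (i / M) (i % M) then [(i % M * 8 + 4, i / M * M * 8 + 7, N * M)] else []) ++
  [(i / M * M * 8 + 7, i * 8 + 6, N * M)] ++
  [(i % M * 8 + 5, i * 8 + 6, N * M)]

/-- The edges of the gadget network. An additional node `8 * (N * M)`, into which no edge leads,
sends edges to all nodes of these kinds. It does not affect the flows, and makes the number of edges
large enough to serve as the number of nodes. -/
def gadgetEdges (N M : ℕ) (sat : ℕ → ℕ → ℕ → Bool) : List (ℕ × ℕ × ℕ) :=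
  (List.range (N * M)).flatMap (gadgetBlock N M sat) ++
    (List.range (8 * (N * M))).map fun v => (8 * (N * M), v, 1)

/-- The words that describe the edges `es` in the encoding of a network. -/
def edgeWords (es : List (ℕ × ℕ × ℕ)) : List ℕ := es.flatMap fun e => [e.1, e.2.1, e.2.2]

theorem edgeWords_append (es es' : List (ℕ × ℕ × ℕ)) :
    edgeWords (es ++ es') = edgeWords es ++ edgeWords es' := List.flatMap_append

theorem length_edgeWords (es : List (ℕ × ℕ × ℕ)) : (edgeWords es).length = 3 * es.length := by
  induction es with
  | nil => rfl
  | cons e es ih => simp only [edgeWords, List.flatMap_cons] at ih ⊢; simp [ih]; ring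

theorem length_gadgetBlock_le (N M : ℕ) (sat : ℕ → ℕ → ℕ → Bool) (i : ℕ) :
    (gadgetBlock N M sat i).length ≤ 8 := by
  unfold gadgetBlock
  split_ifs <;> simp

theorem length_gadgetEdges_le (N M : ℕ) (sat : ℕ → ℕ → ℕ → Bool) :
    (gadgetEdges N M sat).length ≤ 16 * (N * M) := by
  have : ((List.range (N * M)).flatMap (gadgetBlock N M sat)).length ≤ N * M * 8 := by
    rw [List.length_flatMap]
    refine (List.sum_le_card_nsmul _ 8 ?_).trans (by simp)
    simp only [List.mem_map]
    rintro x ⟨i, -, rfl⟩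
    exact length_gadgetBlock_le N M sat i
  simp only [gadgetEdges, List.length_append, List.length_map, List.length_range]
  omega

/-- The list `l` has been written to array `3`, and otherwise nothing has changed since `s₀`. -/
structure Emitted (s₀ : State) (l : List ℕ) (s : State) : Prop where
  arr : s.arr 3 = listArr l
  ptr : s.reg rOut = l.length
  reg : ∀ r, r ≠ rOut → r ≠ rT → s.reg r = s₀.reg r
  other : ∀ a, a ≠ 3 → s.arr a = s₀.arr a

/-- Append the edge from `R u` to `R v` of capacity `R c`. -/
def pushEdge (u v c : ℕ) : Prog :=
  .store 3 rOut u ;; .op .add rOut rOut rOne ;;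
  .store 3 rOut v ;; .op .add rOut rOut rOne ;;
  .store 3 rOut c ;; .op .add rOut rOut rOne

theorem pushEdge_halts {B u v c : ℕ} {s₀ s : State} {l : List ℕ} (h : Emitted s₀ l s)
    (h1 : s₀.reg rOne = 1) (hB : l.length + 3 ≤ B) (hu : u ≠ rOut ∧ u ≠ rT)
    (hv : v ≠ rOut ∧ v ≠ rT) (hc : c ≠ rOut ∧ c ≠ rT) :
    Halts B (pushEdge u v c) 8
      (Emitted s₀ (l ++ edgeWords [(s₀.reg u, s₀.reg v, s₀.reg c)])) s := by
  have e1 := h.reg rOne (by norm_num) (by norm_num)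
  have eu := h.reg u hu.1 hu.2
  have ev := h.reg v hv.1 hv.2
  have ec := h.reg c hc.1 hc.2
  rw [h1] at e1
  refine (Halts.seq <| Halts.store <| Halts.seq <| Halts.op (v := l.length + 1) ?_ ?_ <|
    Halts.seq <| Halts.store <| Halts.seq <| Halts.op (v := l.length + 2) ?_ ?_ <|
    Halts.seq <| Halts.store <| Halts.op (v := l.length + 3) ?_ ?_ ?_).mono (by norm_num)
    (fun _ h => h)
  · simp [Op.eval, h.ptr, e1]
  · omega
  · simp [Op.eval, e1]
  · omega
  · simp [Op.eval, e1]
  · omega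
  · constructor
    · have hl := update_listArr_length l (s₀.reg u)
      have hl' := update_listArr_length (l ++ [s₀.reg u]) (s₀.reg v)
      have hl'' := update_listArr_length (l ++ [s₀.reg u] ++ [s₀.reg v]) (s₀.reg c)
      simp only [List.length_append, List.length_singleton] at hl' hl''
      simp [State.setArr_arr, h.ptr, h.arr, eu, ev, ec, hv.1, hc.1, hl, hl', edgeWords]
      simpa using hl''
    · simp [edgeWords]
    · intro r hr hr'
      simp [hr, h.reg r hr hr']
    · intro a ha
      simp [State.setArr_arr, ha, h.other a ha]

/-- Append an edge if `R f = 1`. -/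
def pushIf (f u v c : ℕ) : Prog := .ite rZero f (pushEdge u v c) (.const rT 0)

/-- Append an edge unless `R f = 1`. -/
def pushUnless (f u v c : ℕ) : Prog := .ite f rOne (pushEdge u v c) (.const rT 0)

theorem Emitted.skip {s₀ s : State} {l : List ℕ} (h : Emitted s₀ l s) :
    Emitted s₀ (l ++ edgeWords []) (s.setReg rT 0) := by
  refine ⟨by simpa [edgeWords] using h.arr, by simpa [edgeWords] using h.ptr, ?_,
    fun a ha => by simpa using h.other a ha⟩
  intro r hr hr'
  simp [hr', h.reg r hr hr']

theorem pushIf_halts {B f u v c : ℕ} {s₀ s : State} {l : List ℕ} {b : Bool}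
    (h : Emitted s₀ l s) (h0 : s₀.reg rZero = 0)
    (h1 : s₀.reg rOne = 1) (hb : s₀.reg f = b.toNat) (hB : l.length + 3 ≤ B)
    (hf : f ≠ rOut ∧ f ≠ rT) (hu : u ≠ rOut ∧ u ≠ rT)
    (hv : v ≠ rOut ∧ v ≠ rT) (hc : c ≠ rOut ∧ c ≠ rT) :
    Halts B (pushIf f u v c) 9
      (Emitted s₀ (l ++ edgeWords (if b then [(s₀.reg u, s₀.reg v, s₀.reg c)] else []))) s := by
  have e0 := h.reg rZero (by norm_num) (by norm_num)
  have ef := h.reg f hf.1 hf.2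
  refine Halts.ite (fun hlt => ?_) (fun hlt => ?_)
  · rw [e0, h0, ef, hb] at hlt
    cases b
    · simp at hlt
    · exact pushEdge_halts h h1 hB hu hv hc
  · rw [e0, h0, ef, hb] at hlt
    cases b
    · exact (Halts.const (Nat.zero_le _) h.skip).mono (by norm_num) fun _ h => h
    · simp at hlt

theorem pushUnless_halts {B f u v c : ℕ} {s₀ s : State} {l : List ℕ} {b : Bool}
    (h : Emitted s₀ l s)
    (h1 : s₀.reg rOne = 1) (hb : s₀.reg f = b.toNat) (hB : l.length + 3 ≤ B)
    (hf : f ≠ rOut ∧ f ≠ rT) (hu : u ≠ rOut ∧ u ≠ rT)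
    (hv : v ≠ rOut ∧ v ≠ rT) (hc : c ≠ rOut ∧ c ≠ rT) :
    Halts B (pushUnless f u v c) 9
      (Emitted s₀ (l ++ edgeWords (if b then [] else [(s₀.reg u, s₀.reg v, s₀.reg c)]))) s := by
  have e0 := h.reg rOne (by norm_num) (by norm_num)
  have ef := h.reg f hf.1 hf.2
  refine Halts.ite (fun hlt => ?_) (fun hlt => ?_)
  · rw [e0, h1, ef, hb] at hlt
    cases b
    · exact pushEdge_halts h h1 hB hu hv hc
    · simp at hlt
  · rw [e0, h1, ef, hb] at hlt
    cases b
    · simp at hlt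
    · exact (Halts.const (Nat.zero_le _) h.skip).mono (by norm_num) fun _ h => h

/-- Computes the nodes that occur in the block of edges with number `rI`. -/
def blockNodes : Prog :=
  .op .div rW rI rCls ;; .op .mod rJ rI rCls ;;
  .op .mul rNodeA rW rCls ;; .op .mul rNodeA rNodeA rEight ;;
  .op .mul rNodeL rJ rEight ;; .op .mul rNodeX rI rEight ;;
  .const rT 3 ;; .op .add rNodeP rNodeA rT ;;
  .const rT 7 ;; .op .add rNodeS rNodeA rT ;;
  .const rT 4 ;; .op .add rNodeR rNodeL rT ;;
  .const rT 5 ;; .op .add rNodeQ rNodeL rT ;;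
  .const rT 6 ;; .op .add rNodeG rNodeX rT ;;
  .op .add rNodeX rNodeX rTwo ;; .op .add rNodeL rNodeL rOne ;;
  .op .add rK rJ rOne

/-- Looks up which partial assignments `w` satisfy clause `j`, where `rI = w * M + j`. -/
def blockFlags : Prog :=
  .load rSatA 2 rI ;; .op .add rT rI rNM ;; .load rSatB 2 rT ;;
  .op .add rT rT rNM ;; .load rSatC 2 rT

/-- Appends the edges of a block. -/
def blockPush : Prog :=
  pushUnless rSatA rNodeA rNodeL rNM ;; pushUnless rSatB rNodeL rNodeX rOne ;;
  pushEdge rNodeX rNodeP rOne ;; pushEdge rNodeX rNodeR rOne ;;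
  pushEdge rNodeP rNodeQ rK ;; pushIf rSatC rNodeR rNodeS rNM ;;
  pushEdge rNodeS rNodeG rNM ;; pushEdge rNodeQ rNodeG rNM

/-- Writes one block of edges. -/
def blockBody : Prog := blockNodes ;; blockFlags ;; blockPush ;; .op .add rI rI rOne

theorem blockNodes_halts {B i N M : ℕ} {s : State} (h1 : s.reg rOne = 1) (h2 : s.reg rTwo = 2)
    (h8 : s.reg rEight = 8) (hM : s.reg rCls = M) (hI : s.reg rI = i) (hi : i < N * M)
    (hB : 8 * (N * M) ≤ B) :
    Halts B blockNodes 19 (fun s' => s'.reg rNodeA = i / M * M * 8 ∧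
      s'.reg rNodeL = i % M * 8 + 1 ∧ s'.reg rNodeX = i * 8 + 2 ∧
      s'.reg rNodeP = i / M * M * 8 + 3 ∧ s'.reg rNodeR = i % M * 8 + 4 ∧
      s'.reg rNodeQ = i % M * 8 + 5 ∧ s'.reg rNodeG = i * 8 + 6 ∧
      s'.reg rNodeS = i / M * M * 8 + 7 ∧ s'.reg rK = i % M + 1) s := by
  have hmod := Nat.mod_le i M
  have hdiv := Nat.div_le_self i M
  have hmul := Nat.div_mul_le_self i M
  obtain ⟨w, hw⟩ : ∃ w, w = i / M := ⟨_, rfl⟩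
  obtain ⟨j, hj⟩ : ∃ j, j = i % M := ⟨_, rfl⟩
  rw [← hw] at hdiv hmul
  rw [← hj] at hmod
  rw [← hw, ← hj]
  refine (Halts.seq <| Halts.op (v := w) ?_ ?_ <|
    Halts.seq <| Halts.op (v := j) ?_ ?_ <|
    Halts.seq <| Halts.op (v := w * M) ?_ ?_ <|
    Halts.seq <| Halts.op (v := w * M * 8) ?_ ?_ <|
    Halts.seq <| Halts.op (v := j * 8) ?_ ?_ <|
    Halts.seq <| Halts.op (v := i * 8) ?_ ?_ <|
    Halts.seq <| Halts.const ?_ <| Halts.seq <| Halts.op (v := w * M * 8 + 3) ?_ ?_ <|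
    Halts.seq <| Halts.const ?_ <| Halts.seq <| Halts.op (v := w * M * 8 + 7) ?_ ?_ <|
    Halts.seq <| Halts.const ?_ <| Halts.seq <| Halts.op (v := j * 8 + 4) ?_ ?_ <|
    Halts.seq <| Halts.const ?_ <| Halts.seq <| Halts.op (v := j * 8 + 5) ?_ ?_ <|
    Halts.seq <| Halts.const ?_ <| Halts.seq <| Halts.op (v := i * 8 + 6) ?_ ?_ <|
    Halts.seq <| Halts.op (v := i * 8 + 2) ?_ ?_ <|
    Halts.seq <| Halts.op (v := j * 8 + 1) ?_ ?_ <|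
    Halts.op (v := j + 1) ?_ ?_ ?_).mono (by norm_num) (fun _ h => h)
  all_goals try omega
  all_goals simp [Op.eval, h1, h2, h8, hM, hI, hw, hj]

theorem blockFlags_halts {B i n m h N : ℕ} {cs : List (List ℕ)} {f : ℕ → ℕ} {s : State}
    (hs : Setup n m h N cs s) (hI : s.reg rI = i) (hi : i < N * cs.length)
    (hA : s.arr 2 = tableArr f (3 * (N * cs.length))) (hB : 3 * (N * cs.length) ≤ B) :
    Halts B blockFlags 5 (fun s' => s'.reg rSatA = f i ∧ s'.reg rSatB = f (N * cs.length + i) ∧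
      s'.reg rSatC = f (2 * (N * cs.length) + i)) s := by
  refine (Halts.seq <| Halts.load (v := f i) ?_ <|
    Halts.seq <| Halts.op (v := N * cs.length + i) ?_ ?_ <|
    Halts.seq <| Halts.load (v := f (N * cs.length + i)) ?_ <|
    Halts.seq <| Halts.op (v := 2 * (N * cs.length) + i) ?_ ?_ <|
    Halts.load (v := f (2 * (N * cs.length) + i)) ?_ ?_).mono (by norm_num) (fun _ h => h)
  · rw [hA, hI, tableArr, if_pos (by omega)]
  · simp [Op.eval, hI, hs.prod, add_comm]
  · omega
  · simp only [State.setReg_reg, State.setReg_arr, hA, if_true]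
    rw [tableArr, if_pos (by omega)]
  · simp [Op.eval, hs.prod]; ring
  · omega
  · simp only [State.setReg_reg, State.setReg_arr, hA, if_true]
    rw [tableArr, if_pos (by omega)]
  · simp

theorem blockPush_halts {B i N M : ℕ} {sat : ℕ → ℕ → ℕ → Bool} {l : List ℕ} {s : State}
    (h0 : s.reg rZero = 0) (h1 : s.reg rOne = 1) (hNM : s.reg rNM = N * M)
    (hn : s.reg rNodeA = i / M * M * 8 ∧
      s.reg rNodeL = i % M * 8 + 1 ∧ s.reg rNodeX = i * 8 + 2 ∧
      s.reg rNodeP = i / M * M * 8 + 3 ∧ s.reg rNodeR = i % M * 8 + 4 ∧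
      s.reg rNodeQ = i % M * 8 + 5 ∧ s.reg rNodeG = i * 8 + 6 ∧
      s.reg rNodeS = i / M * M * 8 + 7 ∧ s.reg rK = i % M + 1)
    (ha : s.reg rSatA = (sat 0 (i / M) (i % M)).toNat)
    (hb : s.reg rSatB = (sat 1 (i / M) (i % M)).toNat)
    (hc : s.reg rSatC = (sat 2 (i / M) (i % M)).toNat)
    (hA : s.arr 3 = listArr l) (hP : s.reg rOut = l.length) (hB : l.length + 24 ≤ B) :
    Halts B blockPush 67 (Emitted s (l ++ edgeWords (gadgetBlock N M sat i))) s := by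
  obtain ⟨n1, n2, n3, n4, n5, n6, n7, n8, n9⟩ := hn
  have hE : Emitted s l s := ⟨hA, hP, fun _ _ _ => rfl, fun _ _ => rfl⟩
  have hlen : ∀ es : List (ℕ × ℕ × ℕ), es.length ≤ 7 → (l ++ edgeWords es).length + 3 ≤ B := by
    intro es hes
    rw [List.length_append, length_edgeWords]
    omega
  rw [gadgetBlock]
  refine (Halts.seq <| (pushUnless_halts hE h1 ha (by omega) (by decide) (by decide) (by decide)
    (by decide)).mono le_rfl fun s₁ hE => ?_ :
    Halts B blockPush (9 + (9 + (8 + (8 + (8 + (9 + (8 + 8))))))) _ s).mono le_rfl fun _ h => h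
  rw [n1, n2, hNM] at hE
  refine Halts.seq <| (pushUnless_halts hE h1 hb (hlen _ ?_) (by decide) (by decide) (by decide)
    (by decide)).mono le_rfl fun s₂ hE => ?_
  · split_ifs <;> simp
  rw [n2, n3, h1, List.append_assoc, ← edgeWords_append] at hE
  refine Halts.seq <| (pushEdge_halts hE h1 (hlen _ ?_) (by decide) (by decide)
    (by decide)).mono le_rfl fun s₂ hE => ?_
  · split_ifs <;> simp
  rw [n3, n4, h1, List.append_assoc, ← edgeWords_append] at hE
  refine Halts.seq <| (pushEdge_halts hE h1 (hlen _ ?_) (by decide) (by decide)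
    (by decide)).mono le_rfl fun s₂ hE => ?_
  · split_ifs <;> simp
  rw [n3, n5, h1, List.append_assoc, ← edgeWords_append] at hE
  refine Halts.seq <| (pushEdge_halts hE h1 (hlen _ ?_) (by decide) (by decide)
    (by decide)).mono le_rfl fun s₂ hE => ?_
  · split_ifs <;> simp
  rw [n4, n6, n9, List.append_assoc, ← edgeWords_append] at hE
  refine Halts.seq <| (pushIf_halts hE h0 h1 hc (hlen _ ?_) (by decide) (by decide) (by decide)
    (by decide)).mono le_rfl fun s₂ hE => ?_
  · split_ifs <;> simp
  rw [n5, n8, hNM, List.append_assoc, ← edgeWords_append] at hE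
  refine Halts.seq <| (pushEdge_halts hE h1 (hlen _ ?_) (by decide) (by decide)
    (by decide)).mono le_rfl fun s₂ hE => ?_
  · split_ifs <;> simp
  rw [n7, n8, hNM, List.append_assoc, ← edgeWords_append] at hE
  refine (pushEdge_halts hE h1 (hlen _ ?_) (by decide) (by decide)
    (by decide)).mono le_rfl fun s₂ hE => ?_
  · split_ifs <;> simp
  rw [n6, n7, hNM, List.append_assoc, ← edgeWords_append] at hE
  exact hE

theorem blockBody_halts {B i n m h N : ℕ} {cs : List (List ℕ)} {f : ℕ → ℕ}
    {sat : ℕ → ℕ → ℕ → Bool} {l : List ℕ} {s : State}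
    (hs : Setup n m h N cs s) (hI : s.reg rI = i) (hi : i < N * cs.length)
    (hT : s.arr 2 = tableArr f (3 * (N * cs.length)))
    (ha : f i = (sat 0 (i / cs.length) (i % cs.length)).toNat)
    (hb : f (N * cs.length + i) = (sat 1 (i / cs.length) (i % cs.length)).toNat)
    (hc : f (2 * (N * cs.length) + i) = (sat 2 (i / cs.length) (i % cs.length)).toNat)
    (hA : s.arr 3 = listArr l) (hP : s.reg rOut = l.length) (hB : l.length + 24 ≤ B)
    (hB' : 8 * (N * cs.length) ≤ B) :
    Halts B blockBody 92 (fun s' => s'.reg rI = i + 1 ∧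
      s'.arr 3 = listArr (l ++ edgeWords (gadgetBlock N cs.length sat i)) ∧
      s'.reg rOut = (l ++ edgeWords (gadgetBlock N cs.length sat i)).length) s := by
  refine (Halts.seq <| (blockNodes_halts hs.one hs.two hs.eight hs.cls hI hi hB').frame.mono
    le_rfl fun s₁ ⟨hn, hf₁⟩ => ?_ : Halts B blockBody (19 + (5 + (67 + 1))) _ s).mono le_rfl
    fun _ h => h
  have hs₁ := hs.frame hf₁ (by decide) rfl
  refine Halts.seq <| (blockFlags_halts hs₁ ((hf₁.1 rI rfl).trans hI) hi
    ((hf₁.2 2 rfl).trans hT) (by omega)).frame.mono le_rfl fun s₂ ⟨⟨f1, f2, f3⟩, hf₂⟩ => ?_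
  have hs₂ := hs₁.frame hf₂ (by decide) rfl
  rw [ha] at f1
  rw [hb] at f2
  rw [hc] at f3
  refine Halts.seq <| (blockPush_halts hs₂.zero hs₂.one hs₂.prod ?_ f1 f2 f3
    ((hf₂.2 3 rfl).trans ((hf₁.2 3 rfl).trans hA))
    ((hf₂.1 rOut rfl).trans ((hf₁.1 rOut rfl).trans hP)) hB).mono le_rfl fun s₃ hE => ?_
  · rwa [hf₂.1 rNodeA rfl, hf₂.1 rNodeL rfl, hf₂.1 rNodeX rfl, hf₂.1 rNodeP rfl,
      hf₂.1 rNodeR rfl, hf₂.1 rNodeQ rfl, hf₂.1 rNodeG rfl, hf₂.1 rNodeS rfl, hf₂.1 rK rfl]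
  have e1 := hE.reg rI (by norm_num) (by norm_num)
  have e2 := hE.reg rOne (by norm_num) (by norm_num)
  rw [hf₂.1 rI rfl, hf₁.1 rI rfl, hI] at e1
  rw [hs₂.one] at e2
  refine Halts.op (v := i + 1) (by simp [Op.eval, e1, e2]) (by omega) ?_
  simp [hE.arr, hE.ptr]

/-- Writes the gadget network to array `3`. The numbers of nodes and edges, which come first in the
encoding, are known only at the end. -/
def writeNetwork : Prog :=
  .const rOut 2 ;; .const rI 0 ;; .loop rI rNM blockBody ;;
  .const rI 0 ;; .loop rI rV (pushEdge rV rI rOne ;; .op .add rI rI rOne) ;;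
  .op .sub rE rOut rTwo ;; .const rT 3 ;; .op .div rE rE rT ;;
  .store 3 rZero rE ;; .store 3 rOne rE

theorem writeNetwork_halts {B n m h N : ℕ} {cs : List (List ℕ)} {f : ℕ → ℕ}
    {sat : ℕ → ℕ → ℕ → Bool} {s : State}
    (hs : Setup n m h N cs s)
    (hT : s.arr 2 = tableArr f (3 * (N * cs.length)))
    (ha : ∀ i < N * cs.length, f i = (sat 0 (i / cs.length) (i % cs.length)).toNat)
    (hb : ∀ i < N * cs.length,
      f (N * cs.length + i) = (sat 1 (i / cs.length) (i % cs.length)).toNat)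
    (hc : ∀ i < N * cs.length,
      f (2 * (N * cs.length) + i) = (sat 2 (i / cs.length) (i % cs.length)).toNat)
    (hA : s.arr 3 = fun _ => 0) (hB : 48 * (N * cs.length) + 26 ≤ B) :
    Halts B writeNetwork (173 * (N * cs.length) + 10)
      (fun s' => s'.arr 3 = listArr ((gadgetEdges N cs.length sat).length ::
        (gadgetEdges N cs.length sat).length :: edgeWords (gadgetEdges N cs.length sat)) ∧
        s'.reg rE = (gadgetEdges N cs.length sat).length) s := by
  set M := cs.length
  have hlen : ∀ i ≤ N * M,
      (edgeWords ((List.range i).flatMap (gadgetBlock N M sat))).length ≤ 24 * i := by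
    intro i hi
    rw [length_edgeWords, List.length_flatMap]
    have := List.sum_le_card_nsmul
      ((List.range i).map fun a => (gadgetBlock N M sat a).length) 8 (by
        simp only [List.mem_map]
        rintro x ⟨i, -, rfl⟩
        exact length_gadgetBlock_le N M sat i)
    simp only [List.length_map, List.length_range, smul_eq_mul] at this
    omega
  refine (Halts.seq <| Halts.const (by omega) <| Halts.seq <| Halts.const (by omega) <|
    Halts.seq <| (Halts.loop (T := 92) (fun i s => s.reg rI = i ∧
      s.arr 3 = listArr ([0, 0] ++ edgeWords ((List.range i).flatMap (gadgetBlock N M sat))) ∧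
      s.reg rOut =
        ([0, 0] ++ edgeWords ((List.range i).flatMap (gadgetBlock N M sat))).length)
      (N * M) ?_ ?_ ?_).mono le_rfl ?_ : Halts B writeNetwork
      (1 + (1 + (N * M * 93 + 1 + (1 + (8 * (N * M) * 10 + 1 + (1 + (1 + (1 + (1 + 1))))))))) _
      s).mono (by omega) fun _ h => h
  · simp only [State.setReg_reg, State.setReg_arr, hA]
    refine ⟨by simp, ?_, by simp [edgeWords]⟩
    funext x
    rcases x with _ | _ | x <;> simp [listArr, edgeWords]
  · rintro i hi s' ⟨hI, hA', hP⟩ hfr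
    have hs' : Setup n m h N cs s' := by
      refine Setup.frame ?_ hfr (by decide) rfl
      constructor <;> simp [hs.zero, hs.one, hs.two, hs.eight, hs.threeN, hs.nodes, hs.cls,
        hs.hgt, hs.asg, hs.prod, hs.input]
    have hT' := hfr.2 2 rfl
    simp only [State.setReg_arr, hT] at hT'
    have := hlen i hi.le
    refine ⟨by rw [hI, hs'.prod]; exact hi, (blockBody_halts hs' hI hi hT' (ha i hi) (hb i hi)
      (hc i hi) hA' hP ?_ (show 8 * (N * M) ≤ B by omega)).mono le_rfl fun s'' hQ => ?_⟩
    · simp only [List.length_append, List.length_cons, List.length_nil]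
      omega
    · rw [List.range_succ, List.flatMap_append, List.flatMap_singleton, edgeWords_append,
        ← List.append_assoc]
      exact hQ
  · rintro s' ⟨hI, -, -⟩ hfr
    have := hfr.1 rNM rfl
    simp [hs.prod] at this
    rw [hI, this]
    exact lt_irrefl _
  rintro s₁ ⟨⟨hI, hA₁, hP₁⟩, hf₁⟩
  have hs₁ : Setup n m h N cs s₁ := by
    refine Setup.frame (p := .loop rI rNM blockBody) ?_ hf₁ (by decide) rfl
    constructor <;> simp [hs.zero, hs.one, hs.two, hs.eight, hs.threeN, hs.nodes, hs.cls,
      hs.hgt, hs.asg, hs.prod, hs.input]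
  set es := (List.range (N * M)).flatMap (gadgetBlock N M sat) with hes
  have hlen₁ : (edgeWords es).length ≤ 24 * (N * M) := hlen _ le_rfl
  refine Halts.seq <| Halts.const (by omega) <| Halts.seq <| (Halts.loop (T := 8 + 1) (fun v s =>
    s.reg rI = v ∧
      s.arr 3 = listArr
        ([0, 0] ++ edgeWords (es ++ (List.range v).map fun v => (8 * (N * M), v, 1))) ∧
      s.reg rOut =
        ([0, 0] ++ edgeWords (es ++ (List.range v).map fun v => (8 * (N * M), v, 1))).length)
      (8 * (N * M)) ?_ ?_ ?_).mono le_rfl ?_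
  · simp [hA₁, hP₁]
  · rintro v hv s' ⟨hI, hA', hP⟩ hfr
    have hs' : Setup n m h N cs s' := by
      refine Setup.frame ?_ hfr (by decide) rfl
      constructor <;> simp [hs₁.zero, hs₁.one, hs₁.two, hs₁.eight, hs₁.threeN, hs₁.nodes, hs₁.cls,
        hs₁.hgt, hs₁.asg, hs₁.prod, hs₁.input]
    refine ⟨by rw [hI, hs'.nodes]; exact hv, Halts.seq <| (pushEdge_halts
      (u := rV) (v := rI) (c := rOne) ⟨hA', hP, fun _ _ _ => rfl, fun _ _ => rfl⟩ hs'.one ?_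
      (by decide) (by decide) (by decide)).mono le_rfl fun s'' hE => ?_⟩
    · rw [length_edgeWords] at hlen₁
      rw [List.length_append, length_edgeWords]
      simp only [List.length_cons, List.length_nil, List.length_append, List.length_map,
        List.length_range]
      omega
    · have e1 := hE.reg rI (by norm_num) (by norm_num)
      have e2 := hE.reg rOne (by norm_num) (by norm_num)
      rw [hI] at e1
      rw [hs'.one] at e2
      refine Halts.op (v := v + 1) (by simp [Op.eval, e1, e2]) (by omega) ?_
      have h1 := hE.arr
      have h2 := hE.ptr
      rw [hs'.nodes, hI, hs'.one, List.append_assoc, ← edgeWords_append, List.append_assoc] at h1 h2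
      rw [List.range_succ, List.map_append, List.map_singleton]
      simpa using ⟨h1, by simpa using h2⟩
  · rintro s' ⟨hI, -, -⟩ hfr
    have := hfr.1 rV rfl
    simp [hs₁.nodes] at this
    rw [hI, this]
    exact lt_irrefl _
  rintro s₂ ⟨⟨-, hA₂, hP₂⟩, hf₂⟩
  have hs₂ : Setup n m h N cs s₂ := by
    refine Setup.frame (p := .loop rI rV (pushEdge rV rI rOne ;; .op .add rI rI rOne)) ?_ hf₂
      (by decide) rfl
    constructor <;> simp [hs₁.zero, hs₁.one, hs₁.two, hs₁.eight, hs₁.threeN, hs₁.nodes, hs₁.cls,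
      hs₁.hgt, hs₁.asg, hs₁.prod, hs₁.input]
  have hE : es ++ (List.range (8 * (N * M))).map (fun v => (8 * (N * M), v, 1)) =
    gadgetEdges N M sat := rfl
  rw [hE] at hA₂ hP₂
  have hle := length_gadgetEdges_le N M sat
  rw [List.length_append, length_edgeWords] at hP₂
  simp only [List.length_cons, List.length_nil] at hP₂
  set E := (gadgetEdges N M sat).length
  refine Halts.seq <| Halts.op (v := 3 * E) ?_ ?_ <| Halts.seq <| Halts.const (by omega) <|
    Halts.seq <| Halts.op (v := E) ?_ ?_ <| Halts.seq <| Halts.store <| Halts.store ?_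
  · simp [Op.eval, hP₂, hs₂.two]
  · omega
  · simp [Op.eval]
  · omega
  · refine ⟨?_, by simp⟩
    simp only [State.setArr_arr, State.setReg_reg, State.setReg_arr, hs₂.zero, hs₂.one, hA₂,
      State.setArr_reg]
    funext x
    rcases x with _ | _ | x <;> simp [listArr]

end RAM

/-! ### The whole program -/

namespace RAM

notation "rBest" => (38 : ℕ)
notation "rLim" => (39 : ℕ)
notation "rBase" => (40 : ℕ)
notation "rGap" => (41 : ℕ)
notation "rVal" => (42 : ℕ)
notation "rRef" => (43 : ℕ)

/-- Reads the numbers of variables and clauses and computes the parameters of the reduction. The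
number of clauses is increased by one, as the program treats the zeros behind the end of the input
as an additional, empty clause. -/
def readParams : Prog :=
  .const rOne 1 ;; .const rTwo 2 ;; .const rEight 8 ;; .load rVars 0 rZero ;;
  .load rCls 0 rOne ;; .op .add rCls rCls rOne ;; .const rH 3 ;; .op .div rH rVars rH ;;
  .op .add rH rH rOne ;; .op .shl rN rOne rH ;; .op .mul rNM rN rCls ;;
  .op .mul rV rEight rNM ;; .op .add rThreeN rN rN ;; .op .add rThreeN rThreeN rN

theorem readParams_halts {B n m : ℕ} {cs : List (List ℕ)} {s : State}
    (h0 : s.reg rZero = 0) (hin : s.arr 0 = listArr (n :: m :: clauseWords cs))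
    (hcs : cs.length = m + 1) (hB : 8 * (2 ^ (n / 3 + 1) * cs.length) ≤ B)
    (hn : n / 3 + 1 ≤ B) :
    Halts B readParams 14 (Setup n m (n / 3 + 1) (2 ^ (n / 3 + 1)) cs) s := by
  set N := 2 ^ (n / 3 + 1) with hN
  have hN0 : 0 < N := by positivity
  have h1 : N * (m + 1) = N * m + N := by ring
  have h2 : m + 1 ≤ N * (m + 1) := Nat.le_mul_of_pos_left _ hN0
  rw [hcs, h1] at hB
  rw [h1] at h2
  refine (Halts.seq <| Halts.const (by omega) <| Halts.seq <| Halts.const (by omega) <|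
    Halts.seq <| Halts.const (by omega) <| Halts.seq <| Halts.load (v := n) ?_ <|
    Halts.seq <| Halts.load (v := m) ?_ <| Halts.seq <| Halts.op (v := m + 1) ?_ ?_ <|
    Halts.seq <| Halts.const (by omega) <| Halts.seq <| Halts.op (v := n / 3) ?_ ?_ <|
    Halts.seq <| Halts.op (v := n / 3 + 1) ?_ ?_ <|
    Halts.seq <| Halts.op (v := N) ?_ ?_ <|
    Halts.seq <| Halts.op (v := N * m + N) ?_ ?_ <|
    Halts.seq <| Halts.op (v := 8 * (N * m + N)) ?_ ?_ <|
    Halts.seq <| Halts.op (v := N + N) ?_ ?_ <|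
    Halts.op (v := N + N + N) ?_ ?_ ?_).mono (by norm_num) (fun _ h => h)
  all_goals try omega
  all_goals try (simp [Op.eval, h0, hin, listArr]; done)
  · simp [Op.eval, Nat.shiftLeft_eq, hN]
  · simp [Op.eval, h1]
  · constructor <;> simp [h0, hcs, h1, hin]
    ring

/-- The contribution of the entry with number `x = a * (N * M) + (c * M + j)` to the final result,
read off from the maximum flow values `out` in a network with `E` nodes: if the flow for `a`, `c`
and threshold `j + 1` is less than that for threshold `1` plus `N * j`, then some assignment that
extends `a` and `c` violates at most `j` of the `M` clauses. -/
def scanGap (N M E : ℕ) (out : ℕ → ℕ) (x : ℕ) : ℕ :=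
  if out (x % (N * M) * 8 + 6 + x / (N * M) * M * 8 * E) <
      out ((x % (N * M) - x % (N * M) % M) * 8 + 6 + x / (N * M) * M * 8 * E) +
        N * (x % (N * M) % M)
  then M - x % (N * M) % M else 0

/-- Processes the entry with number `rI`. -/
def scanBody : Prog :=
  .op .div rW rI rNM ;; .op .mod rT rI rNM ;; .op .mod rJ rT rCls ;; .op .sub rBase rT rJ ;;
  .op .mul rW rW rCls ;; .op .mul rW rW rEight ;; .op .mul rW rW rE ;; .const rGap 6 ;;
  .op .mul rT rT rEight ;; .op .add rT rT rGap ;; .op .add rT rT rW ;;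
  .op .mul rBase rBase rEight ;; .op .add rBase rBase rGap ;; .op .add rBase rBase rW ;;
  .load rVal 4 rT ;; .load rRef 4 rBase ;; .op .mul rT rN rJ ;; .op .add rRef rRef rT ;;
  .op .sub rGap rCls rJ ;;
  .ite rVal rRef (.ite rBest rGap (.op .add rBest rGap rZero) (.const rT 0)) (.const rT 0) ;;
  .op .add rI rI rOne

/-- Inspects the maximum flow values in array `4` and computes the result. -/
def scan : Prog :=
  .op .mul rLim rN rNM ;; .const rI 0 ;; .const rBest 0 ;; .loop rI rLim scanBody

theorem scanBody_halts {B n m h N E x b V : ℕ} {cs : List (List ℕ)} {out : ℕ → ℕ} {s : State}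
    (hs : Setup n m h N cs s) (hE : s.reg rE = E) (hout : s.arr 4 = out) (hI : s.reg rI = x)
    (hb : s.reg rBest = b) (hx : x < N * (N * cs.length))
    (hV : out ((x % (N * cs.length) - x % (N * cs.length) % cs.length) * 8 + 6 +
      x / (N * cs.length) * cs.length * 8 * E) ≤ V)
    (hB : 8 * (N * cs.length) * E + 8 * (N * cs.length) ≤ B)
    (hVB : V + N * cs.length ≤ B) (hxB : x + 1 ≤ B) (hE1 : 1 ≤ E) :
    Halts B scanBody 23 (fun s' => s'.reg rI = x + 1 ∧
      s'.reg rBest = max b (scanGap N cs.length E out x)) s := by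
  set M := cs.length
  have hNM : 0 < N * M := by
    rcases Nat.eq_zero_or_pos (N * M) with h | h
    · simp [h] at hx
    · exact h
  have hM : 0 < M := Nat.pos_of_mul_pos_left hNM
  have ha : x / (N * M) ≤ N := ((Nat.div_lt_iff_lt_mul hNM).2 hx).le
  have hi : x % (N * M) < N * M := Nat.mod_lt _ hNM
  have hj : x % (N * M) % M < M := Nat.mod_lt _ hM
  have hdiv := Nat.div_le_self x (N * M)
  unfold scanGap
  obtain ⟨a, ea⟩ : ∃ a, a = x / (N * M) := ⟨_, rfl⟩
  obtain ⟨i, ei⟩ : ∃ i, i = x % (N * M) := ⟨_, rfl⟩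
  rw [← ei] at hi hj hV
  obtain ⟨j, ej⟩ : ∃ j, j = i % M := ⟨_, rfl⟩
  rw [← ea] at ha hdiv hV
  rw [← ej] at hj hV
  rw [← ea, ← ei, ← ej]
  have haM : a * M ≤ N * M := Nat.mul_le_mul_right _ ha
  have haE : a * M * 8 * E ≤ 8 * (N * M) * E := Nat.mul_le_mul_right _ (by omega)
  have haE' : a * M * 8 ≤ a * M * 8 * E := Nat.le_mul_of_pos_right _ hE1
  have hNj : N * j ≤ N * M := Nat.mul_le_mul_left _ hj.le
  have hMN : M ≤ N * M := Nat.le_mul_of_pos_left _ (Nat.pos_of_mul_pos_right hNM)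
  refine (Halts.seq <| Halts.op (v := a) ?_ ?_ <| Halts.seq <| Halts.op (v := i) ?_ ?_ <|
    Halts.seq <| Halts.op (v := j) ?_ ?_ <| Halts.seq <| Halts.op (v := i - j) ?_ ?_ <|
    Halts.seq <| Halts.op (v := a * M) ?_ ?_ <| Halts.seq <| Halts.op (v := a * M * 8) ?_ ?_ <|
    Halts.seq <| Halts.op (v := a * M * 8 * E) ?_ ?_ <| Halts.seq <| Halts.const ?_ <|
    Halts.seq <| Halts.op (v := i * 8) ?_ ?_ <| Halts.seq <| Halts.op (v := i * 8 + 6) ?_ ?_ <|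
    Halts.seq <| Halts.op (v := i * 8 + 6 + a * M * 8 * E) ?_ ?_ <|
    Halts.seq <| Halts.op (v := (i - j) * 8) ?_ ?_ <|
    Halts.seq <| Halts.op (v := (i - j) * 8 + 6) ?_ ?_ <|
    Halts.seq <| Halts.op (v := (i - j) * 8 + 6 + a * M * 8 * E) ?_ ?_ <|
    Halts.seq <| Halts.load (v := out (i * 8 + 6 + a * M * 8 * E)) ?_ <|
    Halts.seq <| Halts.load (v := out ((i - j) * 8 + 6 + a * M * 8 * E)) ?_ <|
    Halts.seq <| Halts.op (v := N * j) ?_ ?_ <|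
    Halts.seq <| Halts.op (v := out ((i - j) * 8 + 6 + a * M * 8 * E) + N * j) ?_ ?_ <|
    Halts.seq <| Halts.op (v := M - j) ?_ ?_ <|
    Halts.seq <| Halts.ite (T := 2)
      (fun hlt => Halts.ite (fun hlt' => Halts.op (v := M - j) ?_ ?_ <|
      Halts.op (v := x + 1) ?_ ?_ ?_) (fun hlt' => Halts.const ?_ <|
      Halts.op (v := x + 1) ?_ ?_ ?_))
      (fun hlt => (Halts.const ?_ <|
      Halts.op (v := x + 1) ?_ ?_ ?_).mono (by norm_num) (fun _ h => h))).mono (by norm_num)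
      (fun _ h => h)
  all_goals try omega
  all_goals try (simp [Op.eval, hs.zero, hs.one, hs.cls, hs.asg, hs.prod, hs.eight, hE, hI, hout,
    ea, ei, ej, M]; done)
  · simp [hb] at hlt hlt' ⊢
    rw [if_pos hlt, max_eq_right hlt'.le]
  · simp [hb] at hlt hlt' ⊢
    rw [if_pos hlt]
    omega
  · simp [hb] at hlt ⊢
    rw [if_neg (not_lt.2 hlt)]
    simp

theorem scan_halts {B n m h N E V : ℕ} {cs : List (List ℕ)} {out : ℕ → ℕ} {s : State}
    (hs : Setup n m h N cs s) (hE : s.reg rE = E) (hout : s.arr 4 = out)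
    (hV : ∀ x < N * (N * cs.length),
      out ((x % (N * cs.length) - x % (N * cs.length) % cs.length) * 8 + 6 +
      x / (N * cs.length) * cs.length * 8 * E) ≤ V)
    (hB : 8 * (N * cs.length) * E + 8 * (N * cs.length) ≤ B)
    (hVB : V + N * cs.length ≤ B) (hxB : N * (N * cs.length) ≤ B) (hE1 : 1 ≤ E) :
    Halts B scan (N * (N * cs.length) * 24 + 4) (fun s' =>
      s'.reg rBest = (Finset.range (N * (N * cs.length))).sup (scanGap N cs.length E out)) s := by
  refine (Halts.seq <| Halts.op (v := N * (N * cs.length)) ?_ ?_ <|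
    Halts.seq <| Halts.const (Nat.zero_le _) <| Halts.seq <| Halts.const (Nat.zero_le _) <|
    (Halts.loop (T := 23) (fun x s => s.reg rI = x ∧
      s.reg rBest = (Finset.range x).sup (scanGap N cs.length E out)) (N * (N * cs.length))
      ?_ ?_ ?_).mono le_rfl (fun s' h => h.1.2)).mono (by omega) (fun _ h => h)
  · simp [Op.eval, hs.asg, hs.prod]
  · exact hxB
  · simp
  · rintro x hx s' ⟨hI, hb⟩ hfr
    have hs' : Setup n m h N cs s' := by
      refine Setup.frame ?_ hfr (by decide) rfl
      constructor <;> simp [hs.zero, hs.one, hs.two, hs.eight, hs.threeN, hs.nodes, hs.cls,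
        hs.hgt, hs.asg, hs.prod, hs.input]
    have h1 := hfr.1 rLim rfl
    have h2 := hfr.1 rE rfl
    have h3 := hfr.2 4 rfl
    simp [hE, hout] at h1 h2 h3
    refine ⟨by rw [hI, h1]; exact hx, (scanBody_halts hs' h2 h3 hI hb hx (hV x hx) hB hVB
      (by omega) hE1).mono le_rfl fun s'' h => ⟨h.1, ?_⟩⟩
    rw [h.2, Finset.range_add_one, Finset.sup_insert, max_comm]
  · rintro s' ⟨hI, -⟩ hfr
    have h1 := hfr.1 rLim rfl
    simp at h1
    rw [hI, h1]
    exact lt_irrefl _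

/-- The program for MAX-CNF-SAT that calls a program `p` for All-Pairs Max-Flow. Its own
registers are below `50`, and its own arrays below `3`; so array `3` is the input and array `4` the
output of the shifted program. -/
def solver (p : Prog) : Prog :=
  (readParams ;; tabulate ;; writeNetwork) ;; p.shift 50 3 ;; scan ;; .store 1 rZero rBest

theorem listArr_append_zero (l : List ℕ) : listArr (l ++ [0]) = listArr l := by
  rw [← update_listArr_length]
  simp [listArr]

/-- The part of the program before the call of the subroutine. -/
theorem prepare_halts {B n m D : ℕ} {cs : List (List ℕ)} {f : ℕ → ℕ} {sat : ℕ → ℕ → ℕ → Bool}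
    (N : ℕ) (hN : N = 2 ^ (n / 3 + 1)) (hcs : cs.length = m + 1) (hD : ∀ c ∈ cs, c.length ≤ D)
    (hf : ∀ w, ∀ j, ∀ hj : j < cs.length,
      f (w * cs.length + j) = clauseFlag (n / 3 + 1) N w cs[j])
    (ha : ∀ i < N * cs.length, f i = (sat 0 (i / cs.length) (i % cs.length)).toNat)
    (hb : ∀ i < N * cs.length,
      f (N * cs.length + i) = (sat 1 (i / cs.length) (i % cs.length)).toNat)
    (hc : ∀ i < N * cs.length,
      f (2 * (N * cs.length) + i) = (sat 2 (i / cs.length) (i % cs.length)).toNat)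
    (hB₁ : (clauseWords cs).length + 3 ≤ B) (hB₂ : ∀ c ∈ cs, ∀ x ∈ c, x + 1 ≤ B)
    (hB₃ : 48 * (N * cs.length) + 26 ≤ B) (s : State) (hs0 : s.reg rZero = 0)
    (hs : ∀ a, a ≠ 0 → s.arr a = fun _ => 0)
    (hin : s.arr 0 = listArr (n :: m :: clauseWords cs)) :
    Halts B (readParams ;; tabulate ;; writeNetwork)
      (3 * N * (cs.length * (D * 19 + 10) + 7) + 173 * (N * cs.length) + 26) (fun s' =>
        Setup n m (n / 3 + 1) N cs s' ∧
        s'.arr 3 = listArr ((gadgetEdges N cs.length sat).length ::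
        (gadgetEdges N cs.length sat).length :: edgeWords (gadgetEdges N cs.length sat)) ∧
        s'.reg rE = (gadgetEdges N cs.length sat).length) s := by
  have hNM : N ≤ N * cs.length := Nat.le_mul_of_pos_right _ (by omega)
  have hlt : n / 3 + 1 < N := hN ▸ Nat.lt_two_pow_self
  have e : 3 * N * cs.length = 3 * (N * cs.length) := by ring
  refine (Halts.seq <| (readParams_halts hs0 hin hcs (by rw [← hN]; omega) (by omega)).frame.mono
    le_rfl fun s₁ ⟨hs₁, hf₁⟩ => ?_ : Halts B _ (14 +
    ((3 * N * (cs.length * (D * 19 + 10) + 7) + 2) + (173 * (N * cs.length) + 10))) _ s).mono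
    (by omega) fun _ h => h
  rw [← hN] at hs₁
  refine Halts.seq <| (tabulate_halts hs₁ hD hf ((hf₁.2 2 rfl).trans (hs _ (by norm_num))) hB₁ hB₂
    (by omega) (by omega)).frame.mono le_rfl fun s₂ ⟨ht, hf₂⟩ => ?_
  have hs₂ := hs₁.frame hf₂ (by decide) rfl
  rw [e] at ht
  refine (writeNetwork_halts hs₂ ht ha hb hc ((hf₂.2 3 rfl).trans ((hf₁.2 3 rfl).trans
    (hs _ (by norm_num)))) hB₃).frame.mono le_rfl fun s₃ ⟨hg, hf₃⟩ => ?_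
  exact ⟨hs₂.frame hf₃ (by decide) rfl, hg⟩

theorem prepare_setsReg {r : ℕ} (hr : 50 ≤ r) :
    (readParams ;; tabulate ;; writeNetwork).setsReg r = false := by
  simp [Prog.setsReg, readParams, tabulate, writeNetwork, assignmentTest, clauseTest, litTest,
    blockBody, blockNodes, blockFlags, blockPush, pushEdge, pushIf, pushUnless]
  omega

theorem prepare_setsArr {a : ℕ} (ha : 4 ≤ a) :
    (readParams ;; tabulate ;; writeNetwork).setsArr a = false := by
  simp [Prog.setsArr, readParams, tabulate, writeNetwork, assignmentTest, clauseTest, litTest,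
    blockBody, blockNodes, blockFlags, blockPush, pushEdge, pushIf, pushUnless]
  omega

/-- The program, run with a subroutine `p` that is only known on the gadget network, scans the
output `sp.arr 1` of `p`, and leaves the input untouched. -/
theorem solver_halts {B n m D V tp : ℕ} {cs : List (List ℕ)} {f : ℕ → ℕ}
    {sat : ℕ → ℕ → ℕ → Bool} {p : Prog} {sp : State}
    (N : ℕ) (hN : N = 2 ^ (n / 3 + 1)) (hcs : cs.length = m + 1) (hD : ∀ c ∈ cs, c.length ≤ D)
    (hf : ∀ w, ∀ j, ∀ hj : j < cs.length,
      f (w * cs.length + j) = clauseFlag (n / 3 + 1) N w cs[j])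
    (ha : ∀ i < N * cs.length, f i = (sat 0 (i / cs.length) (i % cs.length)).toNat)
    (hb : ∀ i < N * cs.length,
      f (N * cs.length + i) = (sat 1 (i / cs.length) (i % cs.length)).toNat)
    (hc : ∀ i < N * cs.length,
      f (2 * (N * cs.length) + i) = (sat 2 (i / cs.length) (i % cs.length)).toNat)
    (E : ℕ) (hE : E = (gadgetEdges N cs.length sat).length)
    (hp : Exec B p (init (E :: E :: edgeWords (gadgetEdges N cs.length sat))) tp sp)
    (hV : ∀ x < N * (N * cs.length),
      sp.arr 1 ((x % (N * cs.length) - x % (N * cs.length) % cs.length) * 8 + 6 +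
      x / (N * cs.length) * cs.length * 8 * E) ≤ V)
    (hVB : V + N * cs.length ≤ B)
    (hB₁ : (clauseWords cs).length + 3 ≤ B) (hB₂ : ∀ c ∈ cs, ∀ x ∈ c, x + 1 ≤ B)
    (hB₃ : 128 * (N * cs.length) ^ 2 + 48 * (N * cs.length) + 26 ≤ B) (s : State)
    (hs0 : s.reg = fun _ => 0)
    (hs : ∀ a, a ≠ 0 → s.arr a = fun _ => 0)
    (hin : s.arr 0 = listArr (n :: m :: clauseWords cs)) :
    Halts B (solver p)
      (3 * N * (cs.length * (D * 19 + 10) + 7) + 173 * (N * cs.length) + 24 * (N * (N * cs.length))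
        + 31 + tp) (fun s' =>
        s'.arr 1 0 = (Finset.range (N * (N * cs.length))).sup (scanGap N cs.length E (sp.arr 1)) ∧
        s'.arr 0 = s.arr 0) s := by
  have hM : 1 ≤ cs.length := by omega
  have hN1 : 1 ≤ N := hN ▸ Nat.one_le_two_pow
  have hNM : N ≤ N * cs.length := Nat.le_mul_of_pos_right _ hM
  have hEle : E ≤ 16 * (N * cs.length) := hE ▸ length_gadgetEdges_le _ _ _
  have hE1 : 1 ≤ E := by
    rw [hE, gadgetEdges, List.length_append, List.length_map, List.length_range]
    omega
  refine (Halts.seq <| (prepare_halts N hN hcs hD hf ha hb hc hB₁ hB₂ (by omega) s (by rw [hs0])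
    hs hin).frame.mono le_rfl fun s₁ ⟨⟨hs₁, hA₁, hE₁⟩, hf₁⟩ => ?_ : Halts B (solver p) (_ +
      (tp + ((N * (N * cs.length) * 24 + 4) + 1))) _ s).mono ?_ fun _ h => h
  swap
  · omega
  rw [← hE] at hA₁ hE₁
  have hup : s₁.upper 50 3 = init (E :: E :: edgeWords (gadgetEdges N cs.length sat)) := by
    simp only [State.upper, init, State.mk.injEq]
    constructor
    · funext x
      rw [hf₁.1 _ (prepare_setsReg (by omega)), hs0]
    · funext a
      rcases Nat.eq_zero_or_pos a with rfl | hpos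
      · rw [hA₁]
        rfl
      · rw [hf₁.2 _ (prepare_setsArr (by omega)), hs _ (by omega)]
        simp [hpos.ne']
  obtain ⟨s₂, he₂, hup₂⟩ := hp.shift 50 3 s₁ hup
  have hf₂ := he₂.frame
  have hs₂ : Setup n m (n / 3 + 1) N cs s₂ :=
    hs₁.frame hf₂ (fun r hr _ => Prog.setsReg_shift (by omega) p)
      (Prog.setsArr_shift (by norm_num) p)
  have hout : s₂.arr 4 = sp.arr 1 := by rw [← hup₂]; rfl
  refine Halts.seq ⟨tp, s₂, le_rfl, he₂, ?_⟩
  refine Halts.seq <| (scan_halts (V := V) hs₂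
    ((hf₂.1 _ (Prog.setsReg_shift (by norm_num) p)).trans hE₁) hout hV ?_ hVB ?_ hE1).frame.mono
    le_rfl fun s₃ ⟨hb₃, hf₃⟩ => Halts.store ?_
  · have : 8 * (N * cs.length) * E ≤ 8 * (N * cs.length) * (16 * (N * cs.length)) :=
      Nat.mul_le_mul_left _ hEle
    have e : 8 * (N * cs.length) * (16 * (N * cs.length)) = 128 * (N * cs.length) ^ 2 := by ring
    omega
  · have : N * (N * cs.length) ≤ (N * cs.length) * (N * cs.length) := Nat.mul_le_mul_right _ hNM
    rw [← sq] at this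
    omega
  · have hs₃ := hs₂.frame hf₃ (by decide) rfl
    have h0 : s₃.arr 0 = s.arr 0 := by
      rw [hf₃.2 0 rfl, hf₂.2 0 (Prog.setsArr_shift (by norm_num) p), hf₁.2 0 rfl]
    simp [State.setArr_arr, hs₃.zero, hb₃, h0]

end RAM

/-! ### Flows, cuts and paths in a network -/

namespace Network

/-- Sums of capacities over pairs of nodes are sums over the list of edges. -/
theorem sum_cap_ite (G : Network) (φ : Fin G.n → Fin G.n → Prop) [∀ u v, Decidable (φ u v)] :
    ∑ u, ∑ v, (if φ u v then G.cap u v else 0) =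
      (G.edges.map fun e => if φ e.1 e.2.1 then e.2.2 else 0).sum := by
  unfold cap
  induction G.edges with
  | nil => simp
  | cons e es ih =>
    rw [List.map_cons, List.sum_cons, ← ih]
    have h : ∀ u v, (if φ u v then (((e :: es).filter fun e => e.1 = u ∧ e.2.1 = v).map
        fun e => e.2.2).sum else 0) =
        (if u = e.1 then if v = e.2.1 then if φ e.1 e.2.1 then e.2.2 else 0 else 0 else 0) +
        if φ u v then ((es.filter fun e => e.1 = u ∧ e.2.1 = v).map fun e => e.2.2).sum else 0 := by
      intro u v
      by_cases h1 : u = e.1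
      · subst h1
        by_cases h2 : v = e.2.1
        · subst h2
          by_cases h3 : φ e.1 e.2.1 <;> simp [h3]
        · simp [h2, Ne.symm h2]
      · simp [h1, Ne.symm h1]
    simp_rw [h, Finset.sum_add_distrib]
    simp

/-- The value of a flow is at most the capacity of a cut. -/
theorem IsFlow.value_le {G : Network} {s t : Fin G.n} {f : Fin G.n → Fin G.n → ℝ}
    (hf : G.IsFlow s t f) (S : Fin G.n → Prop) [DecidablePred S] (hs : S s) (ht : ¬ S t) :
    ∑ v, f s v - ∑ v, f v s ≤
      ((G.edges.map fun e => if S e.1 ∧ ¬ S e.2.1 then e.2.2 else 0).sum : ℕ) := by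
  rw [← G.sum_cap_ite (fun u v => S u ∧ ¬ S v)]
  have h1 : ∑ v, f s v - ∑ v, f v s = ∑ u, if S u then (∑ v, f u v - ∑ v, f v u) else 0 := by
    symm
    rw [Finset.sum_eq_single s]
    · simp [hs]
    · intro u _ hu
      split_ifs with h
      · rw [hf.2 u hu (fun h' => ht (h' ▸ h)), sub_self]
      · rfl
    · simp
  have h2 : ∑ u, (if S u then (∑ v, f u v - ∑ v, f v u) else 0) =
      ∑ u, ∑ v, ((if S u then f u v else 0) - if S v then f u v else 0) := by
    simp_rw [Finset.sum_sub_distrib]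
    rw [Finset.sum_comm (f := fun u v => if S v then f u v else 0), ← Finset.sum_sub_distrib]
    refine Finset.sum_congr rfl fun u _ => ?_
    by_cases h : S u <;> simp [h]
  rw [h1, h2]
  push_cast
  refine Finset.sum_le_sum fun u _ => Finset.sum_le_sum fun v _ => ?_
  have := hf.1 u v
  by_cases h : S u <;> by_cases h' : S v <;> simp [h, h', this.1, this.2]

/-- The superposition over `k ∈ K` of the flows of `w k` units along the path `p k` of `l` edges. -/
def pathFlow {n : ℕ} {ι : Type*} (K : Finset ι) (l : ℕ) (w : ι → ℝ) (p : ι → ℕ → ℕ)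
    (u v : Fin n) : ℝ :=
  ∑ k ∈ K, w k * ∑ i ∈ Finset.range l, if u.val = p k i ∧ v.val = p k (i + 1) then 1 else 0

theorem pathFlow_nonneg {n : ℕ} {ι : Type*} {K : Finset ι} {l : ℕ} {w : ι → ℝ} {p : ι → ℕ → ℕ}
    (hw : ∀ k ∈ K, 0 ≤ w k) (u v : Fin n) : 0 ≤ pathFlow K l w p u v :=
  Finset.sum_nonneg fun k hk => mul_nonneg (hw k hk) <| Finset.sum_nonneg fun i _ => by
    split_ifs <;> simp

theorem sum_ite_val_eq {n x : ℕ} (hx : x < n) (P : Prop) [Decidable P] :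
    ∑ v : Fin n, (if P ∧ v.val = x then (1 : ℝ) else 0) = if P then 1 else 0 := by
  rw [Finset.sum_eq_single ⟨x, hx⟩]
  · simp
  · intro v _ hv
    rw [if_neg]
    rintro ⟨-, h⟩
    exact hv (Fin.ext h)
  · simp

/-- Paths from `s` to `t` conserve the flow at all other nodes. -/
theorem pathFlow_net {n : ℕ} {ι : Type*} {K : Finset ι} {l : ℕ} {w : ι → ℝ} {p : ι → ℕ → ℕ}
    {s t : ℕ} (hp : ∀ k ∈ K, ∀ i ≤ l, p k i < n) (hs : ∀ k ∈ K, p k 0 = s)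
    (ht : ∀ k ∈ K, p k l = t) (u : Fin n) :
    ∑ v, pathFlow K l w p u v - ∑ v, pathFlow K l w p v u =
      ((if u.val = s then 1 else 0) - if u.val = t then 1 else 0) * ∑ k ∈ K, w k := by
  have h1 : ∑ v, pathFlow K l w p u v =
      ∑ k ∈ K, w k * ∑ i ∈ Finset.range l, if u.val = p k i then 1 else 0 := by
    unfold pathFlow
    rw [Finset.sum_comm]
    refine Finset.sum_congr rfl fun k hk => ?_
    rw [← Finset.mul_sum, Finset.sum_comm]
    congr 1
    refine Finset.sum_congr rfl fun i hi => ?_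
    exact sum_ite_val_eq (hp k hk _ (Finset.mem_range.1 hi)) _
  have h2 : ∑ v, pathFlow K l w p v u =
      ∑ k ∈ K, w k * ∑ i ∈ Finset.range l, if u.val = p k (i + 1) then 1 else 0 := by
    unfold pathFlow
    rw [Finset.sum_comm]
    refine Finset.sum_congr rfl fun k hk => ?_
    rw [← Finset.mul_sum, Finset.sum_comm]
    congr 1
    refine Finset.sum_congr rfl fun i hi => ?_
    simp_rw [and_comm (a := _ = p k i)]
    exact sum_ite_val_eq (hp k hk _ (Finset.mem_range.1 hi).le) _
  rw [h1, h2, ← Finset.sum_sub_distrib, Finset.mul_sum]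
  refine Finset.sum_congr rfl fun k hk => ?_
  rw [← mul_sub, ← Finset.sum_sub_distrib,
    Finset.sum_range_sub' (fun i => if u.val = p k i then (1 : ℝ) else 0), hs k hk, ht k hk]
  ring

/-- Two families of paths from `s` to `t` that together respect the capacities give a flow. -/
theorem exists_isFlow_of_paths (G : Network) {s t : Fin G.n} (hst : s ≠ t) {ι : Type*}
    {K : Finset ι} {l : ℕ} {w w' : ι → ℝ} {p p' : ι → ℕ → ℕ}
    (hw : ∀ k ∈ K, 0 ≤ w k) (hw' : ∀ k ∈ K, 0 ≤ w' k)
    (hp : ∀ k ∈ K, ∀ i ≤ l, p k i < G.n) (hp' : ∀ k ∈ K, ∀ i ≤ l, p' k i < G.n)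
    (hs : ∀ k ∈ K, p k 0 = s) (hs' : ∀ k ∈ K, p' k 0 = s)
    (ht : ∀ k ∈ K, p k l = t) (ht' : ∀ k ∈ K, p' k l = t)
    (hcap : ∀ u v, pathFlow K l w p u v + pathFlow K l w' p' u v ≤ G.cap u v) :
    ∃ f, G.IsFlow s t f ∧ ∑ k ∈ K, (w k + w' k) = ∑ v, f s v - ∑ v, f v s := by
  have hnet : ∀ u : Fin G.n, ∑ v, (pathFlow K l w p u v + pathFlow K l w' p' u v) -
      ∑ v, (pathFlow K l w p v u + pathFlow K l w' p' v u) =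
      ((if u.val = s.val then 1 else 0) - if u.val = t.val then 1 else 0) *
        ∑ k ∈ K, (w k + w' k) := by
    intro u
    have h1 := pathFlow_net (w := w) hp hs ht u
    have h2 := pathFlow_net (w := w') hp' hs' ht' u
    simp only [Finset.sum_add_distrib]
    linarith
  refine ⟨fun u v => pathFlow K l w p u v + pathFlow K l w' p' u v, ⟨fun u v => ⟨?_, hcap u v⟩,
    fun v hvs hvt => ?_⟩, ?_⟩
  · exact add_nonneg (pathFlow_nonneg hw u v) (pathFlow_nonneg hw' u v)
  · have := hnet v
    rw [if_neg (fun h => hvs (Fin.ext h)), if_neg (fun h => hvt (Fin.ext h)), sub_zero,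
      zero_mul] at this
    linarith
  · have := hnet s
    rw [if_pos rfl, if_neg (fun h => hst (Fin.ext h)), sub_zero, one_mul] at this
    exact this.symm

/-- The network with nodes `0, …, n - 1` and edges `es`. -/
def ofEdges (n : ℕ) (es : List (ℕ × ℕ × ℕ)) (hlt : ∀ e ∈ es, e.1 < n ∧ e.2.1 < n)
    (hnd : (es.map fun e => (e.1, e.2.1)).Nodup) (hl : ∀ e ∈ es, e.1 ≠ e.2.1) : Network where
  n := n
  edges := es.pmap (fun e h => (⟨e.1, h.1⟩, ⟨e.2.1, h.2⟩, e.2.2)) hlt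
  nodup := by
    refine List.Nodup.of_map (fun e : Fin n × Fin n => (e.1.val, e.2.val)) ?_
    simpa [List.map_pmap] using hnd
  loopless := by
    intro e he
    obtain ⟨e', he', rfl⟩ := List.mem_pmap.1 he
    exact fun h => hl e' he' (congrArg Fin.val h)

section ofEdges

variable {n : ℕ} {es : List (ℕ × ℕ × ℕ)} {hlt : ∀ e ∈ es, e.1 < n ∧ e.2.1 < n}
  {hnd : (es.map fun e => (e.1, e.2.1)).Nodup} {hl : ∀ e ∈ es, e.1 ≠ e.2.1}

theorem ofEdges_m : (ofEdges n es hlt hnd hl).m = es.length := by simp [m, ofEdges]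

theorem ofEdges_enc : (ofEdges n es hlt hnd hl).enc = n :: es.length :: RAM.edgeWords es := by
  rw [enc, ofEdges_m]
  congr 2
  simp only [ofEdges, RAM.edgeWords, List.flatMap_def, List.map_pmap]
  simp

theorem ofEdges_capacitiesIn {U : ℕ} (h : ∀ e ∈ es, 1 ≤ e.2.2 ∧ e.2.2 ≤ U) :
    (ofEdges n es hlt hnd hl).CapacitiesIn U := by
  intro e he
  obtain ⟨e', he', rfl⟩ := List.mem_pmap.1 he
  exact h e' he'

theorem le_ofEdges_cap {u v c : ℕ} (h : (u, v, c) ∈ es) (u' v' : Fin (ofEdges n es hlt hnd hl).n)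
    (hu : u'.val = u) (hv : v'.val = v) : c ≤ (ofEdges n es hlt hnd hl).cap u' v' := by
  refine List.single_le_sum (by simp) c (List.mem_map.2 ⟨(u', v', c), List.mem_filter.2 ⟨?_, ?_⟩,
    rfl⟩)
  · subst hu hv
    exact List.mem_pmap.2 ⟨_, h, rfl⟩
  · simp

theorem ofEdges_cut (S : ℕ → Prop) [DecidablePred S] :
    ((ofEdges n es hlt hnd hl).edges.map fun e =>
      if S e.1.val ∧ ¬ S e.2.1.val then e.2.2 else 0).sum =
    (es.map fun e => if S e.1 ∧ ¬ S e.2.1 then e.2.2 else 0).sum := by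
  simp only [ofEdges, List.map_pmap]
  simp

end ofEdges

end Network

/-! ### Minimum cuts in the gadget network -/

namespace RAM

variable {N M : ℕ} {sat : ℕ → ℕ → ℕ → Bool}

theorem mul_add_div_of_lt {w j : ℕ} (hj : j < M) : (w * M + j) / M = w := by
  rw [Nat.add_comm, Nat.add_mul_div_right _ _ (by omega), Nat.div_eq_of_lt hj, zero_add]

theorem mul_add_mod_of_lt {w j : ℕ} (hj : j < M) : (w * M + j) % M = j := by
  rw [Nat.add_comm, Nat.add_mul_mod_self_right, Nat.mod_eq_of_lt hj]

theorem mul_add_lt {w j : ℕ} (hw : w < N) (hj : j < M) : w * M + j < N * M :=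
  calc w * M + j < w * M + M := by omega
    _ = (w + 1) * M := by ring
    _ ≤ N * M := Nat.mul_le_mul_right _ hw

theorem mul_add_inj {w j w' j' : ℕ} (hj : j < M) (hj' : j' < M)
    (h : w * M + j = w' * M + j') : w = w' ∧ j = j' := by
  have h1 := congrArg (· / M) h
  have h2 := congrArg (· % M) h
  simp only [mul_add_div_of_lt hj, mul_add_div_of_lt hj', mul_add_mod_of_lt hj,
    mul_add_mod_of_lt hj'] at h1 h2
  exact ⟨h1, h2⟩

theorem sum_range_mul {A : Type*} [AddCommMonoid A] (g : ℕ → A) (N M : ℕ) :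
    ∑ x ∈ Finset.range (N * M), g x =
      ∑ w ∈ Finset.range N, ∑ j ∈ Finset.range M, g (w * M + j) := by
  induction N with
  | zero => simp
  | succ N ih => rw [Nat.succ_mul, Finset.sum_range_add, ih, Finset.sum_range_succ]

theorem mem_gadgetEdges {w j : ℕ} (hw : w < N) (hj : j < M) {e : ℕ × ℕ × ℕ}
    (he : e ∈ gadgetBlock N M sat (w * M + j)) : e ∈ gadgetEdges N M sat :=
  List.mem_append_left _ <| List.mem_flatMap.2 ⟨_, List.mem_range.2 (mul_add_lt hw hj), he⟩

theorem gadgetBlock_eq {w j : ℕ} (hj : j < M) : gadgetBlock N M sat (w * M + j) =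
    (if sat 0 w j then [] else [(w * M * 8, j * 8 + 1, N * M)]) ++
    (if sat 1 w j then [] else [(j * 8 + 1, (w * M + j) * 8 + 2, 1)]) ++
    [((w * M + j) * 8 + 2, w * M * 8 + 3, 1)] ++
    [((w * M + j) * 8 + 2, j * 8 + 4, 1)] ++
    [(w * M * 8 + 3, j * 8 + 5, j + 1)] ++
    (if sat 2 w j then [(j * 8 + 4, w * M * 8 + 7, N * M)] else []) ++
    [(w * M * 8 + 7, (w * M + j) * 8 + 6, N * M)] ++
    [(j * 8 + 5, (w * M + j) * 8 + 6, N * M)] := by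
  rw [gadgetBlock, mul_add_div_of_lt hj, mul_add_mod_of_lt hj]

/-- The number of clauses violated by all three partial assignments. -/
def unsatCount (M : ℕ) (sat : ℕ → ℕ → ℕ → Bool) (a b c : ℕ) : ℕ :=
  ∑ j ∈ Finset.range M, if ¬ sat 0 a j ∧ ¬ sat 1 b j ∧ ¬ sat 2 c j then 1 else 0

/-- The number of clauses violated by the first two partial assignments, but not by the third. -/
def passCount (M : ℕ) (sat : ℕ → ℕ → ℕ → Bool) (a b c : ℕ) : ℕ :=
  ∑ j ∈ Finset.range M, if ¬ sat 0 a j ∧ ¬ sat 1 b j ∧ sat 2 c j then 1 else 0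

/-- The maximum flow value from the source for the partial assignment `a` to the sink for the
partial assignment `c` with threshold `k + 1`. -/
def gadgetFlow (N M : ℕ) (sat : ℕ → ℕ → ℕ → Bool) (a c k : ℕ) : ℕ :=
  ∑ b ∈ Finset.range N, (passCount M sat a b c + min (k + 1) (unsatCount M sat a b c))

/-- The source side of a minimum cut: `src b` says on which side the bottleneck of the partial
assignment `b` is. The cases are the kinds of nodes. -/
def cutSide (M : ℕ) (sat : ℕ → ℕ → ℕ → Bool) (a c k : ℕ) (src : ℕ → Bool) (u : ℕ) : Bool :=
  match u % 8 with
  | 0 => u / 8 / M == a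
  | 1 => !sat 0 a (u / 8 % M)
  | 2 => src (u / 8 / M) && !sat 0 a (u / 8 % M) && !sat 2 c (u / 8 % M)
  | 3 => src (u / 8 / M)
  | 4 => !sat 2 c (u / 8 % M)
  | 5 => !(u / 8 % M == k)
  | 6 => !(u / 8 / M == c && u / 8 % M == k)
  | _ => !(u / 8 / M == c)

section cut

variable {a c k w j : ℕ} {src : ℕ → Bool}

theorem cutSide_A (hM : 0 < M) : cutSide M sat a c k src (w * M * 8) = (w == a) := by
  simp [cutSide, Nat.mul_div_cancel _ hM]

theorem cutSide_L (hj : j < M) : cutSide M sat a c k src (j * 8 + 1) = !sat 0 a j := by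
  have h1 : (j * 8 + 1) % 8 = 1 := by omega
  have h2 : (j * 8 + 1) / 8 = j := by omega
  simp [cutSide, h1, h2, Nat.mod_eq_of_lt hj]

theorem cutSide_X (hj : j < M) : cutSide M sat a c k src ((w * M + j) * 8 + 2) =
    (src w && !sat 0 a j && !sat 2 c j) := by
  have h1 : ((w * M + j) * 8 + 2) % 8 = 2 := by omega
  have h2 : ((w * M + j) * 8 + 2) / 8 = w * M + j := by omega
  simp [cutSide, h1, h2, mul_add_div_of_lt hj, mul_add_mod_of_lt hj, -Nat.mul_add_mod_self_right]

theorem cutSide_P (hM : 0 < M) : cutSide M sat a c k src (w * M * 8 + 3) = src w := by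
  have h1 : (w * M * 8 + 3) % 8 = 3 := by omega
  have h2 : (w * M * 8 + 3) / 8 = w * M := by omega
  simp [cutSide, h1, h2, Nat.mul_div_cancel _ hM]

theorem cutSide_R (hj : j < M) : cutSide M sat a c k src (j * 8 + 4) = !sat 2 c j := by
  have h1 : (j * 8 + 4) % 8 = 4 := by omega
  have h2 : (j * 8 + 4) / 8 = j := by omega
  simp [cutSide, h1, h2, Nat.mod_eq_of_lt hj]

theorem cutSide_Q (hj : j < M) : cutSide M sat a c k src (j * 8 + 5) = !(j == k) := by
  have h1 : (j * 8 + 5) % 8 = 5 := by omega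
  have h2 : (j * 8 + 5) / 8 = j := by omega
  simp [cutSide, h1, h2, Nat.mod_eq_of_lt hj]

theorem cutSide_G (hj : j < M) : cutSide M sat a c k src ((w * M + j) * 8 + 6) =
    !(w == c && j == k) := by
  have h1 : ((w * M + j) * 8 + 6) % 8 = 6 := by omega
  have h2 : ((w * M + j) * 8 + 6) / 8 = w * M + j := by omega
  simp [cutSide, h1, h2, mul_add_div_of_lt hj, mul_add_mod_of_lt hj, -Nat.mul_add_mod_self_right]

theorem cutSide_S (hM : 0 < M) : cutSide M sat a c k src (w * M * 8 + 7) = !(w == c) := by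
  have h1 : (w * M * 8 + 7) % 8 = 7 := by omega
  have h2 : (w * M * 8 + 7) / 8 = w * M := by omega
  simp [cutSide, h1, h2, Nat.mul_div_cancel _ hM]

/-- The edges of a block that cross the cut: one for a clause that only the third assignment
satisfies, and either the bottleneck of `w` or its edges for the clauses that none of the three
satisfies. -/
theorem gadgetBlock_cut (hj : j < M) :
    ((gadgetBlock N M sat (w * M + j)).map fun e =>
      if cutSide M sat a c k src e.1 = true ∧ ¬ cutSide M sat a c k src e.2.1 = true
      then e.2.2 else 0).sum =
    (if ¬ sat 0 a j ∧ ¬ sat 1 w j ∧ sat 2 c j then 1 else 0) +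
    (if src w then if k = j then k + 1 else 0
      else if ¬ sat 0 a j ∧ ¬ sat 1 w j ∧ ¬ sat 2 c j then 1 else 0) := by
  have hM : 0 < M := by omega
  have h1 : ((if sat 0 w j then [] else [(w * M * 8, j * 8 + 1, N * M)]).map fun e =>
      if cutSide M sat a c k src e.1 = true ∧ ¬ cutSide M sat a c k src e.2.1 = true
      then e.2.2 else 0).sum = 0 := by
    split_ifs with h
    · rfl
    · simp only [List.map_cons, List.map_nil, List.sum_singleton, cutSide_A hM, cutSide_L hj]
      rw [if_neg]
      rintro ⟨h1, h2⟩
      obtain rfl : w = a := by simpa using h1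
      simp_all
  have h2 : ((if sat 2 w j then [(j * 8 + 4, w * M * 8 + 7, N * M)] else []).map fun e =>
      if cutSide M sat a c k src e.1 = true ∧ ¬ cutSide M sat a c k src e.2.1 = true
      then e.2.2 else 0).sum = 0 := by
    split_ifs with h
    · simp only [List.map_cons, List.map_nil, List.sum_singleton, cutSide_R hj, cutSide_S hM]
      rw [if_neg]
      rintro ⟨h1, h2⟩
      obtain rfl : w = c := by simpa using h2
      simp_all
    · rfl
  rw [gadgetBlock_eq hj]
  simp only [List.map_append, List.sum_append, h1, h2, List.map_cons, List.map_nil,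
    List.sum_singleton, cutSide_X hj, cutSide_P hM, cutSide_R hj, cutSide_Q hj, cutSide_G hj,
    cutSide_S hM]
  have h3 : ((if sat 1 w j then [] else [(j * 8 + 1, (w * M + j) * 8 + 2, 1)]).map fun e =>
      if cutSide M sat a c k src e.1 = true ∧ ¬ cutSide M sat a c k src e.2.1 = true
      then e.2.2 else 0).sum = if ¬ sat 1 w j ∧ ¬ sat 0 a j ∧ ¬ (src w ∧ ¬ sat 2 c j)
        then 1 else 0 := by
    by_cases h : sat 1 w j
    · simp [h]
    · by_cases h' : sat 0 a j <;> simp [h, cutSide_L hj, cutSide_X hj, h']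
  rw [h3]
  by_cases hjk : j = k
  · subst hjk
    cases sat 0 a j <;> cases sat 1 w j <;> cases sat 2 c j <;> cases src w <;>
      cases (w == c) <;> simp
  · have hjk' : ¬ k = j := fun h => hjk h.symm
    have hb : (j == k) = false := by simpa using hjk
    cases sat 0 a j <;> cases sat 1 w j <;> cases sat 2 c j <;> cases src w <;>
      cases (w == c) <;> simp [hb, hjk']

theorem gadgetEdges_cut (ha : a < N) (hk : k < M) :
    ((gadgetEdges N M sat).map fun e =>
      if cutSide M sat a c k (fun b => decide (k + 1 ≤ unsatCount M sat a b c)) e.1 = true ∧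
        ¬ cutSide M sat a c k (fun b => decide (k + 1 ≤ unsatCount M sat a b c)) e.2.1 = true
      then e.2.2 else 0).sum = gadgetFlow N M sat a c k := by
  have hM : 0 < M := by omega
  set src : ℕ → Bool := fun b => decide (k + 1 ≤ unsatCount M sat a b c) with hsrc
  have hZ : cutSide M sat a c k src (8 * (N * M)) = false := by
    rw [Nat.mul_comm 8, cutSide_A hM]
    simpa using ha.ne'
  rw [gadgetEdges, List.map_append, List.sum_append, List.map_map]
  have h0 : ((List.range (8 * (N * M))).map ((fun e : ℕ × ℕ × ℕ =>
      if cutSide M sat a c k src e.1 = true ∧ ¬ cutSide M sat a c k src e.2.1 = true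
      then e.2.2 else 0) ∘ fun v => (8 * (N * M), v, 1))).sum = 0 := by
    apply List.sum_eq_zero
    simp [hZ]
  rw [h0, add_zero, List.flatMap_def, List.map_flatten, List.sum_flatten, List.map_map,
    List.map_map]
  have h1 : ∀ g : ℕ → ℕ, ((List.range (N * M)).map g).sum = ∑ x ∈ Finset.range (N * M), g x :=
    fun g => rfl
  rw [h1, sum_range_mul, gadgetFlow]
  refine Finset.sum_congr rfl fun b _ => ?_
  have h2 : ∀ j ∈ Finset.range M, (List.sum ∘ (List.map fun e : ℕ × ℕ × ℕ =>
      if cutSide M sat a c k src e.1 = true ∧ ¬ cutSide M sat a c k src e.2.1 = true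
      then e.2.2 else 0) ∘ gadgetBlock N M sat) (b * M + j) =
      (if ¬ sat 0 a j ∧ ¬ sat 1 b j ∧ sat 2 c j then 1 else 0) +
      (if src b then if k = j then k + 1 else 0
      else if ¬ sat 0 a j ∧ ¬ sat 1 b j ∧ ¬ sat 2 c j then 1 else 0) :=
    fun j hj => gadgetBlock_cut (Finset.mem_range.1 hj)
  refine (Finset.sum_congr rfl h2).trans ?_
  rw [Finset.sum_add_distrib]
  congr 1
  by_cases hb : k + 1 ≤ unsatCount M sat a b c
  · rw [min_eq_left hb]
    simp only [hsrc, hb, decide_true, if_true]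
    rw [Finset.sum_ite_eq, if_pos (Finset.mem_range.2 hk)]
  · rw [min_eq_right (by omega)]
    simp only [hsrc, hb, decide_false, Bool.false_eq_true, if_false]
    rfl

end cut

end RAM

/-! ### Maximum flows in the gadget network -/

namespace RAM

variable {N M : ℕ} {sat : ℕ → ℕ → ℕ → Bool}

/-- The number of the block in which an edge of the gadget network occurs, as a function of its two
ends. In the last case one of the ends depends on `w` only and the other on `j` only. -/
def edgeIndex (e : ℕ × ℕ) : ℕ :=
  if e.1 % 8 = 2 then e.1 / 8
  else if e.2 % 8 = 2 ∨ e.2 % 8 = 6 then e.2 / 8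
  else e.1 / 8 + e.2 / 8

theorem edgeIndex_of_mem {i : ℕ} {e : ℕ × ℕ × ℕ} (he : e ∈ gadgetBlock N M sat i) :
    edgeIndex (e.1, e.2.1) = i := by
  have h := Nat.div_add_mod' i M
  generalize hA : i / M * M = A at *
  unfold gadgetBlock at he
  simp only [hA, List.mem_append, List.mem_ite_nil_left, List.mem_ite_nil_right,
    List.mem_singleton] at he
  rcases he with ((((((⟨-, rfl⟩ | ⟨-, rfl⟩) | rfl) | rfl) | rfl) | ⟨-, rfl⟩) | rfl) | rfl <;>
    (simp only [edgeIndex]; split_ifs <;> omega)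

theorem gadgetBlock_bounds {i : ℕ} (hi : i < N * M) {e : ℕ × ℕ × ℕ}
    (he : e ∈ gadgetBlock N M sat i) :
    e.1 < 8 * (N * M) ∧ e.2.1 < 8 * (N * M) ∧ e.1 ≠ e.2.1 ∧ 1 ≤ e.2.2 ∧ e.2.2 ≤ N * M := by
  have h := Nat.div_add_mod' i M
  generalize hA : i / M * M = A at *
  unfold gadgetBlock at he
  simp only [hA, List.mem_append, List.mem_ite_nil_left, List.mem_ite_nil_right,
    List.mem_singleton] at he
  rcases he with ((((((⟨-, rfl⟩ | ⟨-, rfl⟩) | rfl) | rfl) | rfl) | ⟨-, rfl⟩) | rfl) | rfl <;>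
    (dsimp only; omega)

theorem gadgetBlock_nodup (i : ℕ) :
    ((gadgetBlock N M sat i).map fun e => (e.1, e.2.1)).Nodup := by
  unfold gadgetBlock
  generalize i / M * M = A
  split_ifs <;> simp <;> omega

theorem le_length_gadgetEdges : 10 * (N * M) ≤ (gadgetEdges N M sat).length := by
  have : N * M * 2 ≤ ((List.range (N * M)).flatMap (gadgetBlock N M sat)).length := by
    rw [List.length_flatMap]
    have := List.card_nsmul_le_sum
      ((List.range (N * M)).map fun a => (gadgetBlock N M sat a).length) 2 (by
        simp only [List.mem_map]
        rintro x ⟨i, -, rfl⟩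
        unfold gadgetBlock
        split_ifs <;> simp)
    simpa using this
  rw [gadgetEdges, List.length_append, List.length_map, List.length_range]
  omega

theorem gadgetEdges_bounds (h : 0 < N * M) : ∀ e ∈ gadgetEdges N M sat,
    (e.1 < (gadgetEdges N M sat).length ∧ e.2.1 < (gadgetEdges N M sat).length) ∧
      e.1 ≠ e.2.1 ∧ 1 ≤ e.2.2 ∧ e.2.2 ≤ (gadgetEdges N M sat).length := by
  intro e he
  have hle := le_length_gadgetEdges (N := N) (M := M) (sat := sat)
  rw [gadgetEdges, List.mem_append] at he
  rcases he with he | he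
  · obtain ⟨i, hi, he⟩ := List.mem_flatMap.1 he
    have := gadgetBlock_bounds (List.mem_range.1 hi) he
    omega
  · obtain ⟨v, hv, rfl⟩ := List.mem_map.1 he
    have := List.mem_range.1 hv
    dsimp only
    omega

theorem gadgetEdges_nodup : ((gadgetEdges N M sat).map fun e => (e.1, e.2.1)).Nodup := by
  rw [gadgetEdges, List.map_append, List.map_map, List.nodup_append]
  refine ⟨?_, ?_, ?_⟩
  · rw [List.map_flatMap, List.nodup_flatMap]
    refine ⟨fun i _ => gadgetBlock_nodup i, List.nodup_range.imp fun {i i'} hne => ?_⟩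
    intro x hx hx'
    obtain ⟨e, he, rfl⟩ := List.mem_map.1 hx
    obtain ⟨e', he', h⟩ := List.mem_map.1 hx'
    have h1 := edgeIndex_of_mem he
    have h2 := edgeIndex_of_mem he'
    rw [h] at h2
    exact hne (h1.symm.trans h2)
  · refine List.nodup_range.map fun v v' h => ?_
    simpa using h
  · rintro x hx y hy rfl
    obtain ⟨e, he, rfl⟩ := List.mem_map.1 hx
    obtain ⟨i, hi, he⟩ := List.mem_flatMap.1 he
    have := gadgetBlock_bounds (List.mem_range.1 hi) he
    obtain ⟨v, -, h⟩ := List.mem_map.1 hy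
    simp only [Function.comp_apply, Prod.mk.injEq] at h
    omega

/-- The gadget network. It has as many nodes as edges; the nodes above `8 * (N * M)` are
isolated. -/
def gadget (N M : ℕ) (sat : ℕ → ℕ → ℕ → Bool) (h : 0 < N * M) : Network :=
  .ofEdges (gadgetEdges N M sat).length (gadgetEdges N M sat)
    (fun e he => (gadgetEdges_bounds h e he).1) gadgetEdges_nodup
    (fun e he => (gadgetEdges_bounds h e he).2.1)

theorem gadget_enc (h : 0 < N * M) : (gadget N M sat h).enc = (gadgetEdges N M sat).length ::
    (gadgetEdges N M sat).length :: edgeWords (gadgetEdges N M sat) := by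
  unfold gadget
  exact Network.ofEdges_enc

theorem gadget_m (h : 0 < N * M) : (gadget N M sat h).m = (gadgetEdges N M sat).length := by
  unfold gadget
  exact Network.ofEdges_m

theorem gadget_capacitiesIn (h : 0 < N * M) :
    (gadget N M sat h).CapacitiesIn (gadgetEdges N M sat).length := by
  unfold gadget
  exact Network.ofEdges_capacitiesIn fun e he => (gadgetEdges_bounds h e he).2.2

/-- The path that carries flow for the clause `x.2` past the assignment `x.1`. -/
def passPath (M a c k : ℕ) (x : ℕ × ℕ) : ℕ → ℕ
  | 0 => a * M * 8
  | 1 => x.2 * 8 + 1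
  | 2 => (x.1 * M + x.2) * 8 + 2
  | 3 => x.2 * 8 + 4
  | 4 => c * M * 8 + 7
  | _ => (c * M + k) * 8 + 6

/-- The path that carries flow for the clause `x.2` through the bottleneck of the assignment
`x.1`. -/
def bottleneckPath (M a c k : ℕ) (x : ℕ × ℕ) : ℕ → ℕ
  | 0 => a * M * 8
  | 1 => x.2 * 8 + 1
  | 2 => (x.1 * M + x.2) * 8 + 2
  | 3 => x.1 * M * 8 + 3
  | 4 => k * 8 + 5
  | _ => (c * M + k) * 8 + 6

/-- The amount of flow along `passPath`. -/
def passWeight (sat : ℕ → ℕ → ℕ → Bool) (a c : ℕ) (x : ℕ × ℕ) : ℝ :=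
  if ¬ sat 0 a x.2 ∧ ¬ sat 1 x.1 x.2 ∧ sat 2 c x.2 then 1 else 0

/-- The amount of flow along `bottleneckPath`: the clauses share the bottleneck equally. -/
noncomputable def bottleneckWeight (M : ℕ) (sat : ℕ → ℕ → ℕ → Bool) (a c k : ℕ) (x : ℕ × ℕ) : ℝ :=
  if ¬ sat 0 a x.2 ∧ ¬ sat 1 x.1 x.2 ∧ ¬ sat 2 c x.2 then
    (min (k + 1) (unsatCount M sat a x.1 c) : ℕ) / (unsatCount M sat a x.1 c : ℝ) else 0

section weights

variable {a c k : ℕ}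

theorem passWeight_nonneg (x : ℕ × ℕ) : 0 ≤ passWeight sat a c x := by
  unfold passWeight; split_ifs <;> simp

theorem passWeight_le_one (x : ℕ × ℕ) : passWeight sat a c x ≤ 1 := by
  unfold passWeight; split_ifs <;> simp

theorem bottleneckWeight_nonneg (x : ℕ × ℕ) : 0 ≤ bottleneckWeight M sat a c k x := by
  unfold bottleneckWeight; split_ifs <;> positivity

theorem bottleneckWeight_le_one (x : ℕ × ℕ) : bottleneckWeight M sat a c k x ≤ 1 := by
  unfold bottleneckWeight
  split_ifs
  · refine div_le_one_of_le₀ ?_ (Nat.cast_nonneg _)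
    exact_mod_cast min_le_right _ _
  · simp

theorem weight_add_le_one (x : ℕ × ℕ) :
    passWeight sat a c x + bottleneckWeight M sat a c k x ≤ 1 := by
  by_cases h : sat 2 c x.2
  · have := passWeight_le_one (sat := sat) (a := a) (c := c) x
    simpa [bottleneckWeight, h] using this
  · have := bottleneckWeight_le_one (sat := sat) (M := M) (a := a) (c := c) (k := k) x
    simpa [passWeight, h] using this

theorem weight_ne_zero {x : ℕ × ℕ}
    (h : passWeight sat a c x + bottleneckWeight M sat a c k x ≠ 0) :
    ¬ sat 0 a x.2 ∧ ¬ sat 1 x.1 x.2 := by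
  by_contra h'
  apply h
  rw [passWeight, bottleneckWeight, if_neg (by tauto), if_neg (by tauto), add_zero]

theorem passWeight_ne_zero {x : ℕ × ℕ} (h : passWeight sat a c x ≠ 0) : sat 2 c x.2 := by
  by_contra h'
  apply h
  rw [passWeight, if_neg (by tauto)]

theorem sum_passWeight (b : ℕ) :
    ∑ j ∈ Finset.range M, passWeight sat a c (b, j) = passCount M sat a b c := by
  simp [passWeight, passCount]

theorem sum_bottleneckWeight (b : ℕ) :
    ∑ j ∈ Finset.range M, bottleneckWeight M sat a c k (b, j) =
      (min (k + 1) (unsatCount M sat a b c) : ℕ) := by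
  have h : ∀ j, bottleneckWeight M sat a c k (b, j) =
      (if ¬ sat 0 a j ∧ ¬ sat 1 b j ∧ ¬ sat 2 c j then (1 : ℕ) else 0 : ℕ) *
      ((min (k + 1) (unsatCount M sat a b c) : ℕ) / (unsatCount M sat a b c : ℝ)) := by
    intro j
    unfold bottleneckWeight
    dsimp only
    split_ifs <;> simp
  simp_rw [h]
  rw [← Finset.sum_mul, ← Nat.cast_sum, ← unsatCount]
  rcases Nat.eq_zero_or_pos (unsatCount M sat a b c) with h0 | h0
  · simp [h0]
  · have : (unsatCount M sat a b c : ℝ) ≠ 0 := by exact_mod_cast h0.ne'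
    field_simp

end weights

/-- To bound a sum, a nonzero term may be assumed: it shows that the edge in question exists. -/
theorem sum_ite_le_of_exists {ι : Type*} {K : Finset ι} {g : ι → ℝ} {φ : ι → Prop}
    [DecidablePred φ] {b : ℝ} (hb : 0 ≤ b)
    (h : ∀ x ∈ K, φ x → g x ≠ 0 → ∑ x ∈ K, (if φ x then g x else 0) ≤ b) :
    ∑ x ∈ K, (if φ x then g x else 0) ≤ b := by
  by_cases hex : ∃ x ∈ K, φ x ∧ g x ≠ 0
  · obtain ⟨x, hx, h1, h2⟩ := hex
    exact h x hx h1 h2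
  · rw [Finset.sum_eq_zero]
    · exact hb
    · intro x hx
      by_contra h'
      exact hex ⟨x, hx, by simpa using h'⟩

theorem sum_ite_le_mul {g : ℕ × ℕ → ℝ} {φ : ℕ × ℕ → Prop} [DecidablePred φ]
    (hg : ∀ x, g x ≤ 1) :
    ∑ x ∈ Finset.range N ×ˢ Finset.range M, (if φ x then g x else 0) ≤ (N * M : ℕ) := by
  have := Finset.sum_le_card_nsmul (Finset.range N ×ˢ Finset.range M)
    (fun x => if φ x then g x else 0) 1 (by intro x _; split_ifs <;> simp [hg])
  simpa using this

theorem sum_ite_le_one {ι : Type*} [DecidableEq ι] {K : Finset ι} {g : ι → ℝ} {φ : ι → Prop}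
    [DecidablePred φ] (hg : ∀ x, g x ≤ 1) {x : ι} (hφ : ∀ y ∈ K, φ y → y = x) :
    ∑ x ∈ K, (if φ x then g x else 0) ≤ (1 : ℕ) := by
  calc ∑ y ∈ K, (if φ y then g y else 0) ≤ ∑ y ∈ K, if y = x then 1 else 0 := by
        refine Finset.sum_le_sum fun y hy => ?_
        by_cases h : φ y
        · rw [if_pos h, if_pos (hφ y hy h)]
          exact hg y
        · rw [if_neg h]
          split_ifs <;> simp
    _ ≤ (1 : ℕ) := by
        rw [Finset.sum_ite_eq']
        split_ifs <;> simp

theorem gadget_le_cap {h : 0 < N * M} {w j : ℕ} (hw : w < N) (hj : j < M) {e : ℕ × ℕ × ℕ}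
    (he : e ∈ gadgetBlock N M sat (w * M + j)) (u v : Fin (gadget N M sat h).n)
    (hu : u.val = e.1) (hv : v.val = e.2.1) : ((e.2.2 : ℕ) : ℝ) ≤ (gadget N M sat h).cap u v := by
  exact_mod_cast Network.le_ofEdges_cap (mem_gadgetEdges hw hj he) u v hu hv

section capacity

variable {a c k : ℕ} {h : 0 < N * M}

/-- The superposition of the paths respects the capacities. -/
theorem pathFlow_le_cap (ha : a < N) (hc : c < N) (hk : k < M) (u v : Fin (gadget N M sat h).n) :
    Network.pathFlow (Finset.range N ×ˢ Finset.range M) 5 (passWeight sat a c) (passPath M a c k)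
      u v +
    Network.pathFlow (Finset.range N ×ˢ Finset.range M) 5 (bottleneckWeight M sat a c k)
      (bottleneckPath M a c k) u v ≤ (gadget N M sat h).cap u v := by
  have hM : 0 < M := by omega
  set K := Finset.range N ×ˢ Finset.range M with hK
  set r := passWeight sat a c
  set p := bottleneckWeight M sat a c k
  have hr0 := passWeight_nonneg (sat := sat) (a := a) (c := c)
  have hr1 := passWeight_le_one (sat := sat) (a := a) (c := c)
  have hp1 := bottleneckWeight_le_one (M := M) (sat := sat) (a := a) (c := c) (k := k)
  have hrp1 := weight_add_le_one (M := M) (sat := sat) (a := a) (c := c) (k := k)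
  have hcap0 : (0 : ℝ) ≤ (gadget N M sat h).cap u v := Nat.cast_nonneg _
  have hmem : ∀ x ∈ K, x.1 < N ∧ x.2 < M := fun x hx => by simpa [hK] using hx
  -- the two families share their first two edges
  have hsplit : Network.pathFlow K 5 r (passPath M a c k) u v +
      Network.pathFlow K 5 p (bottleneckPath M a c k) u v =
      ∑ x ∈ K, (if u.val = a * M * 8 ∧ v.val = x.2 * 8 + 1 then r x + p x else 0) +
      ∑ x ∈ K, (if u.val = x.2 * 8 + 1 ∧ v.val = (x.1 * M + x.2) * 8 + 2 then r x + p x else 0) +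
      ∑ x ∈ K, (if u.val = (x.1 * M + x.2) * 8 + 2 ∧ v.val = x.2 * 8 + 4 then r x else 0) +
      ∑ x ∈ K, (if u.val = x.2 * 8 + 4 ∧ v.val = c * M * 8 + 7 then r x else 0) +
      ∑ x ∈ K, (if u.val = c * M * 8 + 7 ∧ v.val = (c * M + k) * 8 + 6 then r x else 0) +
      ∑ x ∈ K, (if u.val = (x.1 * M + x.2) * 8 + 2 ∧ v.val = x.1 * M * 8 + 3 then p x else 0) +
      ∑ x ∈ K, (if u.val = x.1 * M * 8 + 3 ∧ v.val = k * 8 + 5 then p x else 0) +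
      ∑ x ∈ K, (if u.val = k * 8 + 5 ∧ v.val = (c * M + k) * 8 + 6 then p x else 0) := by
    simp only [Network.pathFlow, ← Finset.sum_add_distrib]
    refine Finset.sum_congr rfl fun x _ => ?_
    simp only [Finset.sum_range_succ, Finset.sum_range_zero, passPath, bottleneckPath]
    have : ∀ (P : Prop) [Decidable P], (if P then r x + p x else 0) =
      r x * (if P then 1 else 0) + p x * (if P then 1 else 0) := by
      intro P _
      split_ifs <;> simp
    rw [this, this]
    have : ∀ (P : Prop) [Decidable P] (y : ℝ),
        (if P then y else 0) = y * (if P then 1 else 0) := by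
      intro P _ y
      split_ifs <;> simp
    rw [this _ (r x), this _ (r x), this _ (r x), this _ (p x), this _ (p x), this _ (p x)]
    ring
  rw [hsplit]
  have hz : ∀ (g : ℕ × ℕ → ℝ) (φ : ℕ × ℕ → Prop) [DecidablePred φ], (∀ x, ¬ φ x) →
      ∑ x ∈ K, (if φ x then g x else 0) = 0 := by
    intro g φ _ hφ
    exact Finset.sum_eq_zero fun x _ => if_neg (hφ x)
  have b1 : ∑ x ∈ K, (if u.val = a * M * 8 ∧ v.val = x.2 * 8 + 1 then r x + p x else 0) ≤
      (gadget N M sat h).cap u v := by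
    refine sum_ite_le_of_exists hcap0 fun x hx hφ hne => (sum_ite_le_mul hrp1).trans ?_
    refine gadget_le_cap (e := (a * M * 8, x.2 * 8 + 1, N * M)) ha (hmem x hx).2 ?_ u v hφ.1 hφ.2
    rw [gadgetBlock_eq (hmem x hx).2]
    simp [(weight_ne_zero hne).1]
  have b2 : ∑ x ∈ K, (if u.val = x.2 * 8 + 1 ∧ v.val = (x.1 * M + x.2) * 8 + 2
      then r x + p x else 0) ≤ (gadget N M sat h).cap u v := by
    refine sum_ite_le_of_exists hcap0 fun x hx hφ hne =>
      (sum_ite_le_one hrp1 (x := x) fun y hy hφ' => ?_).trans ?_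
    · have := mul_add_inj (w := y.1) (w' := x.1) (hmem y hy).2 (hmem x hx).2 (by omega)
      exact Prod.ext this.1 this.2
    refine gadget_le_cap (e := (x.2 * 8 + 1, (x.1 * M + x.2) * 8 + 2, 1)) (hmem x hx).1
      (hmem x hx).2 ?_ u v hφ.1 hφ.2
    rw [gadgetBlock_eq (hmem x hx).2]
    simp [(weight_ne_zero hne).2]
  have b3 : ∑ x ∈ K, (if u.val = (x.1 * M + x.2) * 8 + 2 ∧ v.val = x.2 * 8 + 4
      then r x else 0) ≤ (gadget N M sat h).cap u v := by
    refine sum_ite_le_of_exists hcap0 fun x hx hφ hne =>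
      (sum_ite_le_one hr1 (x := x) fun y hy hφ' => ?_).trans ?_
    · have := mul_add_inj (w := y.1) (w' := x.1) (hmem y hy).2 (hmem x hx).2 (by omega)
      exact Prod.ext this.1 this.2
    refine gadget_le_cap (e := ((x.1 * M + x.2) * 8 + 2, x.2 * 8 + 4, 1)) (hmem x hx).1
      (hmem x hx).2 ?_ u v hφ.1 hφ.2
    rw [gadgetBlock_eq (hmem x hx).2]
    simp
  have b4 : ∑ x ∈ K, (if u.val = x.2 * 8 + 4 ∧ v.val = c * M * 8 + 7 then r x else 0) ≤
      (gadget N M sat h).cap u v := by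
    refine sum_ite_le_of_exists hcap0 fun x hx hφ hne => (sum_ite_le_mul hr1).trans ?_
    refine gadget_le_cap (e := (x.2 * 8 + 4, c * M * 8 + 7, N * M)) hc (hmem x hx).2 ?_ u v
      hφ.1 hφ.2
    rw [gadgetBlock_eq (hmem x hx).2]
    simp [passWeight_ne_zero hne]
  have b5 : ∑ x ∈ K, (if u.val = c * M * 8 + 7 ∧ v.val = (c * M + k) * 8 + 6 then r x else 0) ≤
      (gadget N M sat h).cap u v := by
    refine sum_ite_le_of_exists hcap0 fun x hx hφ hne => (sum_ite_le_mul hr1).trans ?_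
    refine gadget_le_cap (e := (c * M * 8 + 7, (c * M + k) * 8 + 6, N * M)) hc hk ?_ u v hφ.1 hφ.2
    rw [gadgetBlock_eq hk]
    simp
  have b6 : ∑ x ∈ K, (if u.val = (x.1 * M + x.2) * 8 + 2 ∧ v.val = x.1 * M * 8 + 3
      then p x else 0) ≤ (gadget N M sat h).cap u v := by
    refine sum_ite_le_of_exists hcap0 fun x hx hφ hne =>
      (sum_ite_le_one hp1 (x := x) fun y hy hφ' => ?_).trans ?_
    · have := mul_add_inj (w := y.1) (w' := x.1) (hmem y hy).2 (hmem x hx).2 (by omega)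
      exact Prod.ext this.1 this.2
    refine gadget_le_cap (e := ((x.1 * M + x.2) * 8 + 2, x.1 * M * 8 + 3, 1)) (hmem x hx).1
      (hmem x hx).2 ?_ u v hφ.1 hφ.2
    rw [gadgetBlock_eq (hmem x hx).2]
    simp
  have b7 : ∑ x ∈ K, (if u.val = x.1 * M * 8 + 3 ∧ v.val = k * 8 + 5 then p x else 0) ≤
      (gadget N M sat h).cap u v := by
    refine sum_ite_le_of_exists hcap0 fun x hx hφ hne => ?_
    refine le_trans ?_ (gadget_le_cap (e := (x.1 * M * 8 + 3, k * 8 + 5, k + 1)) (hmem x hx).1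
      hk ?_ u v hφ.1 hφ.2)
    · rw [Finset.sum_product, Finset.sum_eq_single x.1]
      · dsimp only
        rw [Finset.sum_congr rfl fun j _ => if_pos hφ, sum_bottleneckWeight]
        exact_mod_cast min_le_left _ _
      · intro b _ hb
        refine Finset.sum_eq_zero fun j _ => if_neg ?_
        rintro ⟨h1, -⟩
        refine hb (Nat.eq_of_mul_eq_mul_right hM ?_)
        dsimp only at h1
        omega
      · exact fun hx' => absurd (Finset.mem_range.2 (hmem x hx).1) hx'
    · rw [gadgetBlock_eq hk]
      simp
  have b8 : ∑ x ∈ K, (if u.val = k * 8 + 5 ∧ v.val = (c * M + k) * 8 + 6 then p x else 0) ≤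
      (gadget N M sat h).cap u v := by
    refine sum_ite_le_of_exists hcap0 fun x hx hφ hne => (sum_ite_le_mul hp1).trans ?_
    refine gadget_le_cap (e := (k * 8 + 5, (c * M + k) * 8 + 6, N * M)) hc hk ?_ u v hφ.1 hφ.2
    rw [gadgetBlock_eq hk]
    simp
  -- the kinds of `u` and `v` leave at most one of the eight sums
  obtain ⟨q, hq⟩ : ∃ q, q = u.val % 8 * 8 + v.val % 8 := ⟨_, rfl⟩
  have z1 : q ≠ 1 → _ := fun hne => hz (fun x => r x + p x)
    (fun x => u.val = a * M * 8 ∧ v.val = x.2 * 8 + 1) (fun x => by omega)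
  have z2 : q ≠ 10 → _ := fun hne => hz (fun x => r x + p x)
    (fun x => u.val = x.2 * 8 + 1 ∧ v.val = (x.1 * M + x.2) * 8 + 2) (fun x => by omega)
  have z3 : q ≠ 20 → _ := fun hne => hz r
    (fun x => u.val = (x.1 * M + x.2) * 8 + 2 ∧ v.val = x.2 * 8 + 4) (fun x => by omega)
  have z4 : q ≠ 39 → _ := fun hne => hz r
    (fun x => u.val = x.2 * 8 + 4 ∧ v.val = c * M * 8 + 7) (fun x => by omega)
  have z5 : q ≠ 62 → _ := fun hne => hz r
    (fun x => u.val = c * M * 8 + 7 ∧ v.val = (c * M + k) * 8 + 6) (fun x => by omega)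
  have z6 : q ≠ 19 → _ := fun hne => hz p
    (fun x => u.val = (x.1 * M + x.2) * 8 + 2 ∧ v.val = x.1 * M * 8 + 3) (fun x => by omega)
  have z7 : q ≠ 29 → _ := fun hne => hz p
    (fun x => u.val = x.1 * M * 8 + 3 ∧ v.val = k * 8 + 5) (fun x => by omega)
  have z8 : q ≠ 46 → _ := fun hne => hz p
    (fun x => u.val = k * 8 + 5 ∧ v.val = (c * M + k) * 8 + 6) (fun x => by omega)
  by_cases q1 : q = 1
  · rw [z2 (by omega), z3 (by omega), z4 (by omega), z5 (by omega), z6 (by omega), z7 (by omega),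
      z8 (by omega)]
    linarith
  rw [z1 q1]
  by_cases q2 : q = 10
  · rw [z3 (by omega), z4 (by omega), z5 (by omega), z6 (by omega), z7 (by omega),
      z8 (by omega)]
    linarith
  rw [z2 q2]
  by_cases q3 : q = 20
  · rw [z4 (by omega), z5 (by omega), z6 (by omega), z7 (by omega), z8 (by omega)]
    linarith
  rw [z3 q3]
  by_cases q4 : q = 39
  · rw [z5 (by omega), z6 (by omega), z7 (by omega), z8 (by omega)]
    linarith
  rw [z4 q4]
  by_cases q5 : q = 62
  · rw [z6 (by omega), z7 (by omega), z8 (by omega)]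
    linarith
  rw [z5 q5]
  by_cases q6 : q = 19
  · rw [z7 (by omega), z8 (by omega)]
    linarith
  rw [z6 q6]
  by_cases q7 : q = 29
  · rw [z8 (by omega)]
    linarith
  rw [z7 q7]
  linarith

/-- The maximum flow values in the gadget network: the paths attain the capacity of the cut. -/
theorem gadget_isMaxFlowValue (ha : a < N) (hc : c < N) (hk : k < M)
    (s t : Fin (gadget N M sat h).n) (hs : s.val = a * M * 8)
    (ht : t.val = (c * M + k) * 8 + 6) :
    (gadget N M sat h).IsMaxFlowValue s t (gadgetFlow N M sat a c k) := by
  have hM : 0 < M := by omega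
  have hlen : 10 * (N * M) ≤ (gadget N M sat h).n := le_length_gadgetEdges
  have hlt : ∀ {w j}, w < N → j < M → (w * M + j) * 8 + 7 < (gadget N M sat h).n := by
    intro w j hw hj
    have := mul_add_lt hw hj
    omega
  have hMN : M ≤ N * M := Nat.le_mul_of_pos_left _ (by omega)
  have hst : s ≠ t := by
    rintro rfl
    omega
  constructor
  · have hsum : ∑ x ∈ Finset.range N ×ˢ Finset.range M,
        (passWeight sat a c x + bottleneckWeight M sat a c k x) = gadgetFlow N M sat a c k := by
      rw [Finset.sum_product, gadgetFlow, Nat.cast_sum]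
      refine Finset.sum_congr rfl fun b _ => ?_
      rw [Finset.sum_add_distrib, sum_passWeight, sum_bottleneckWeight, Nat.cast_add]
    rw [← hsum]
    refine Network.exists_isFlow_of_paths _ hst (l := 5) (p := passPath M a c k)
      (p' := bottleneckPath M a c k) (fun x _ => passWeight_nonneg x)
      (fun x _ => bottleneckWeight_nonneg x) ?_ ?_ (fun x _ => hs.symm) (fun x _ => hs.symm)
      (fun x _ => ht.symm) (fun x _ => ht.symm) (fun u v => pathFlow_le_cap ha hc hk u v)
    · intro x hx i _
      obtain ⟨h1, h2⟩ : x.1 < N ∧ x.2 < M := by simpa using hx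
      have e1 := hlt ha hM
      have e2 := hlt h1 h2
      have e3 := hlt hc hk
      have e4 := hlt hc hM
      rcases i with _ | _ | _ | _ | _ | i <;> simp only [passPath] <;> omega
    · intro x hx i _
      obtain ⟨h1, h2⟩ : x.1 < N ∧ x.2 < M := by simpa using hx
      have e1 := hlt ha hM
      have e2 := hlt h1 h2
      have e3 := hlt hc hk
      have e4 := hlt h1 hM
      rcases i with _ | _ | _ | _ | _ | i <;> simp only [bottleneckPath] <;> omega
  · rintro y ⟨f, hf, rfl⟩
    rw [← gadgetEdges_cut (sat := sat) (c := c) ha hk]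
    refine (hf.value_le (fun u => cutSide M sat a c k
      (fun b => decide (k + 1 ≤ unsatCount M sat a b c)) u.val = true) ?_ ?_).trans_eq ?_
    · rw [hs, cutSide_A hM]
      simp
    · rw [ht, cutSide_G hk]
      simp
    · exact congrArg Nat.cast (Network.ofEdges_cut (fun u => cutSide M sat a c k
        (fun b => decide (k + 1 ≤ unsatCount M sat a b c)) u = true))

end capacity

end RAM

/-! ### From maximum flow values to the number of satisfiable clauses -/

namespace RAM

/-- Comparing two thresholds detects an assignment with few violated clauses. As every assignment
violates a clause, threshold `1` is always attained. -/
theorem gadgetFlow_lt_iff {N M : ℕ} {sat : ℕ → ℕ → ℕ → Bool} {a c j : ℕ}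
    (h1 : ∀ b < N, 1 ≤ unsatCount M sat a b c) :
    gadgetFlow N M sat a c j < gadgetFlow N M sat a c 0 + N * j ↔
      ∃ b < N, unsatCount M sat a b c ≤ j := by
  have e : gadgetFlow N M sat a c 0 + N * j =
      ∑ b ∈ Finset.range N, (passCount M sat a b c + (j + 1)) := by
    have : ∑ b ∈ Finset.range N, (passCount M sat a b c + (j + 1)) =
        ∑ b ∈ Finset.range N,
          ((passCount M sat a b c + min (0 + 1) (unsatCount M sat a b c)) + j) :=
      Finset.sum_congr rfl fun b hb => by
        rw [min_eq_left (h1 b (Finset.mem_range.1 hb))]; ring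
    rw [this, Finset.sum_add_distrib, gadgetFlow]
    simp
  rw [e, gadgetFlow]
  constructor
  · intro hlt
    by_contra! h
    refine hlt.ne (Finset.sum_congr rfl fun b hb => ?_)
    rw [min_eq_left (h b (Finset.mem_range.1 hb))]
  · rintro ⟨b, hb, hu⟩
    refine Finset.sum_lt_sum (fun b _ => by gcongr; exact min_le_left _ _)
      ⟨b, Finset.mem_range.2 hb, ?_⟩
    have := min_le_right (j + 1) (unsatCount M sat a b c)
    omega

/-- The flow values that are compared in the final scan. -/
theorem scanGap_eq {N M E : ℕ} {sat : ℕ → ℕ → ℕ → Bool} {out : ℕ → ℕ} {a c j : ℕ}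
    (hc : c < N) (hj : j < M)
    (hout : ∀ j < M, out ((c * M + j) * 8 + 6 + a * M * 8 * E) = gadgetFlow N M sat a c j) :
    scanGap N M E out (a * (N * M) + (c * M + j)) =
      if gadgetFlow N M sat a c j < gadgetFlow N M sat a c 0 + N * j then M - j else 0 := by
  have hlt := mul_add_lt hc hj
  have h0 := hout 0 (by omega)
  rw [add_zero] at h0
  rw [scanGap, mul_add_div_of_lt hlt, mul_add_mod_of_lt hlt, mul_add_mod_of_lt hj,
    Nat.add_sub_cancel, hout j hj, h0]

end RAM

namespace CNF

variable (F : CNF)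

/-- The clauses as lists of codes of literals, and an additional empty clause, which is violated by
every assignment. -/
def codes : List (List ℕ) :=
  (F.clauses.map fun c => c.map fun l => 2 * l.1.val + l.2.toNat) ++ [[]]

/-- The number of variables in a block. Three blocks have room for at least `F.n` variables, and
assignments of the excess variables do no harm. -/
def blockLen : ℕ := F.n / 3 + 1

/-- The number of assignments of the variables of a block. -/
def numAsg : ℕ := 2 ^ F.blockLen

/-- Whether the assignment `w` of block `t` satisfies clause `j`. -/
def sat (t w j : ℕ) : Bool :=
  (F.codes.getD j []).any (RAM.litTrue F.blockLen F.numAsg (t * F.numAsg + w))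

theorem length_codes : F.codes.length = F.m + 1 := by simp [codes, m]

theorem numAsg_pos : 0 < F.numAsg := Nat.two_pow_pos _

/-- The empty clause costs nothing, as its length `0` already stands behind the end of the input. -/
theorem listArr_enc :
    RAM.listArr F.enc = RAM.listArr (F.n :: F.m :: RAM.clauseWords F.codes) := by
  have : F.n :: F.m :: RAM.clauseWords F.codes = F.enc ++ [0] := by
    simp [enc, codes, RAM.clauseWords, List.flatMap_map]
  rw [this, RAM.listArr_append_zero]

/-- The assignment that is composed of the assignments `a`, `b`, `c` of the three blocks. -/
def combine (a b c : ℕ) (v : Fin F.n) : Bool :=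
  (if v.val / F.blockLen = 0 then a else if v.val / F.blockLen = 1 then b else c).testBit
    (v.val % F.blockLen)

theorem litTrue_iff {t w : ℕ} (hw : w < F.numAsg) (v : ℕ) (s : Bool) :
    RAM.litTrue F.blockLen F.numAsg (t * F.numAsg + w) (2 * v + s.toNat) = true ↔
      v / F.blockLen = t ∧ w.testBit (v % F.blockLen) = s := by
  have h1 : (2 * v + s.toNat) / 2 = v := by cases s <;> simp; omega
  have h2 : (2 * v + s.toNat) % 2 = s.toNat := by cases s <;> simp
  rw [RAM.litTrue, RAM.mul_add_div_of_lt hw, RAM.mul_add_mod_of_lt hw, h1, h2, decide_eq_true_eq,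
    Nat.testBit_eq_decide_div_mod_eq, Nat.shiftRight_eq_div_pow]
  refine and_congr_right fun _ => ?_
  rcases Nat.mod_two_eq_zero_or_one (w / 2 ^ (v % F.blockLen)) with h | h <;> cases s <;> simp [h]

theorem combine_eq_iff {a b c : ℕ} (ha : a < F.numAsg) (hb : b < F.numAsg) (hc : c < F.numAsg)
    (v : Fin F.n) (s : Bool) : F.combine a b c v = s ↔
      RAM.litTrue F.blockLen F.numAsg (0 * F.numAsg + a) (2 * v.val + s.toNat) = true ∨
      RAM.litTrue F.blockLen F.numAsg (1 * F.numAsg + b) (2 * v.val + s.toNat) = true ∨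
      RAM.litTrue F.blockLen F.numAsg (2 * F.numAsg + c) (2 * v.val + s.toNat) = true := by
  rw [F.litTrue_iff ha, F.litTrue_iff hb, F.litTrue_iff hc, combine]
  have hlt : v.val / F.blockLen < 3 := by
    rw [Nat.div_lt_iff_lt_mul (by simp [blockLen])]
    have := v.isLt
    unfold blockLen
    omega
  generalize v.val / F.blockLen = q at *
  interval_cases q <;> simp

theorem exists_combine (x : Fin F.n → Bool) :
    ∃ a < F.numAsg, ∃ b < F.numAsg, ∃ c < F.numAsg, F.combine a b c = x := by
  let y : ℕ → ℕ := fun t => Nat.ofBits fun i : Fin F.blockLen =>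
    if h : t * F.blockLen + i < F.n then x ⟨t * F.blockLen + i, h⟩ else false
  have hy : ∀ t, y t < F.numAsg := fun t => Nat.ofBits_lt_two_pow _
  refine ⟨y 0, hy 0, y 1, hy 1, y 2, hy 2, ?_⟩
  funext v
  have hpos : 0 < F.blockLen := by simp [blockLen]
  have hbit : (y (v.val / F.blockLen)).testBit (v.val % F.blockLen) = x v := by
    rw [Nat.testBit_ofBits_lt _ _ (Nat.mod_lt _ hpos)]
    have h := Nat.div_add_mod' v.val F.blockLen
    simp only [h, v.isLt, dite_true]
  have hlt : v.val / F.blockLen < 3 := by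
    rw [Nat.div_lt_iff_lt_mul hpos]
    have := v.isLt
    unfold blockLen
    omega
  rw [← hbit, combine]
  congr 1
  generalize v.val / F.blockLen = q at *
  interval_cases q <;> rfl

theorem sum_range_getD {A : Type*} (l : List A) (d : A) (P : A → Bool) :
    ∑ j ∈ Finset.range l.length, (if P (l.getD j d) then 1 else 0) = l.countP P := by
  induction l with
  | nil => simp
  | cons x l ih =>
    rw [List.length_cons, Finset.sum_range_succ', List.countP_cons, ← ih]
    simp

theorem unsatCount_add_numSat {a b c : ℕ} (ha : a < F.numAsg) (hb : b < F.numAsg)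
    (hc : c < F.numAsg) :
    RAM.unsatCount F.codes.length F.sat a b c + F.numSat (F.combine a b c) = F.codes.length := by
  let P : List ℕ → Bool := fun cl =>
    cl.any (RAM.litTrue F.blockLen F.numAsg (0 * F.numAsg + a)) ||
    (cl.any (RAM.litTrue F.blockLen F.numAsg (1 * F.numAsg + b)) ||
    cl.any (RAM.litTrue F.blockLen F.numAsg (2 * F.numAsg + c)))
  have h1 : F.numSat (F.combine a b c) = F.codes.countP P := by
    rw [codes, List.countP_append, List.countP_map, numSat]
    have : List.countP P [[]] = 0 := by simp [P]
    rw [this, add_zero]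
    refine List.countP_congr fun cl _ => ?_
    simp only [P, Function.comp_apply, List.any_map, Bool.or_eq_true, List.any_eq_true, beq_iff_eq,
      F.combine_eq_iff ha hb hc]
    constructor
    · rintro ⟨l, hl, h | h | h⟩
      · exact Or.inl ⟨l, hl, h⟩
      · exact Or.inr (Or.inl ⟨l, hl, h⟩)
      · exact Or.inr (Or.inr ⟨l, hl, h⟩)
    · rintro (⟨l, hl, h⟩ | ⟨l, hl, h⟩ | ⟨l, hl, h⟩)
      · exact ⟨l, hl, Or.inl h⟩
      · exact ⟨l, hl, Or.inr (Or.inl h)⟩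
      · exact ⟨l, hl, Or.inr (Or.inr h)⟩
  rw [h1, ← sum_range_getD F.codes [] P, RAM.unsatCount, ← Finset.sum_add_distrib]
  conv_rhs => rw [← Finset.card_range F.codes.length, Finset.card_eq_sum_ones]
  refine Finset.sum_congr rfl fun j _ => ?_
  change (if ¬ F.sat 0 a j ∧ ¬ F.sat 1 b j ∧ ¬ F.sat 2 c j then 1 else 0) +
    (if (F.sat 0 a j || (F.sat 1 b j || F.sat 2 c j)) then 1 else 0) = 1
  cases F.sat 0 a j <;> cases F.sat 1 b j <;> cases F.sat 2 c j <;> rfl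

theorem numSat_le (x : Fin F.n → Bool) : F.numSat x ≤ F.m := List.countP_le_length

theorem one_le_unsatCount {a b c : ℕ} (ha : a < F.numAsg) (hb : b < F.numAsg)
    (hc : c < F.numAsg) : 1 ≤ RAM.unsatCount F.codes.length F.sat a b c := by
  have h1 := F.unsatCount_add_numSat ha hb hc
  have h2 := F.numSat_le (F.combine a b c)
  rw [length_codes] at h1
  rw [length_codes]
  omega

/-- The scan of the maximum flow values computes the maximum number of satisfied clauses. -/
theorem isGreatest_scan {E : ℕ} {out : ℕ → ℕ}
    (hout : ∀ a < F.numAsg, ∀ c < F.numAsg, ∀ j < F.codes.length,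
      out ((c * F.codes.length + j) * 8 + 6 + a * F.codes.length * 8 * E) =
        RAM.gadgetFlow F.numAsg F.codes.length F.sat a c j) :
    IsGreatest (Set.range F.numSat)
      ((Finset.range (F.numAsg * (F.numAsg * F.codes.length))).sup
        (RAM.scanGap F.numAsg F.codes.length E out)) := by
  set N := F.numAsg with hN
  set M := F.codes.length with hM
  have hMpos : 0 < M := by rw [hM, length_codes]; omega
  have hNM : 0 < N * M := Nat.mul_pos F.numAsg_pos hMpos
  have hgap : ∀ a < N, ∀ c < N, ∀ j < M, RAM.scanGap N M E out (a * (N * M) + (c * M + j)) =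
      if ∃ b < N, RAM.unsatCount M F.sat a b c ≤ j then M - j else 0 := by
    intro a ha c hc j hj
    rw [RAM.scanGap_eq hc hj (hout a ha c hc)]
    exact if_congr (RAM.gadgetFlow_lt_iff fun b hb => F.one_le_unsatCount ha hb hc) rfl rfl
  have hlow : ∀ x, F.numSat x ≤ (Finset.range (N * (N * M))).sup (RAM.scanGap N M E out) := by
    intro x
    obtain ⟨a, ha, b, hb, c, hc, rfl⟩ := F.exists_combine x
    have h : RAM.unsatCount M F.sat a b c + F.numSat (F.combine a b c) = M :=
      F.unsatCount_add_numSat ha hb hc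
    rcases Nat.eq_zero_or_pos (F.numSat (F.combine a b c)) with h0 | h0
    · omega
    have hj : RAM.unsatCount M F.sat a b c < M := by omega
    refine le_trans ?_ (Finset.le_sup (b := a * (N * M) + (c * M + RAM.unsatCount M F.sat a b c))
      (Finset.mem_range.2 (RAM.mul_add_lt ha (RAM.mul_add_lt hc hj))))
    rw [hgap a ha c hc _ hj, if_pos ⟨b, hb, le_rfl⟩]
    omega
  have hup : ∀ i ∈ Finset.range (N * (N * M)), ∃ x, RAM.scanGap N M E out i ≤ F.numSat x := by
    intro i hi
    have h1 : i / (N * M) < N := (Nat.div_lt_iff_lt_mul hNM).2 (Finset.mem_range.1 hi)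
    have h2 : i % (N * M) / M < N := (Nat.div_lt_iff_lt_mul hMpos).2 (Nat.mod_lt _ hNM)
    have h3 : i % (N * M) % M < M := Nat.mod_lt _ hMpos
    have h4 := hgap _ h1 _ h2 _ h3
    rw [Nat.div_add_mod', Nat.div_add_mod'] at h4
    rw [h4]
    split_ifs with h
    · obtain ⟨b, hb, hu⟩ := h
      refine ⟨F.combine (i / (N * M)) b (i % (N * M) / M), ?_⟩
      have : RAM.unsatCount M F.sat (i / (N * M)) b (i % (N * M) / M) +
          F.numSat (F.combine (i / (N * M)) b (i % (N * M) / M)) = M :=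
        F.unsatCount_add_numSat h1 hb h2
      omega
    · exact ⟨fun _ => false, Nat.zero_le _⟩
  obtain ⟨x, hx⟩ := Finite.exists_max F.numSat
  have heq : F.numSat x = (Finset.range (N * (N * M))).sup (RAM.scanGap N M E out) := by
    refine le_antisymm (hlow x) (Finset.sup_le fun i hi => ?_)
    obtain ⟨y, hy⟩ := hup i hi
    exact hy.trans (hx y)
  refine ⟨⟨x, heq⟩, ?_⟩
  rintro _ ⟨y, rfl⟩
  exact hlow y

end CNF

/-! ### Running time and word bound -/

namespace RAM

theorem passCount_le (M : ℕ) (sat : ℕ → ℕ → ℕ → Bool) (a b c : ℕ) : passCount M sat a b c ≤ M := by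
  refine (Finset.sum_le_card_nsmul _ _ 1 fun j _ => ?_).trans (by simp)
  split_ifs <;> simp

theorem unsatCount_le (M : ℕ) (sat : ℕ → ℕ → ℕ → Bool) (a b c : ℕ) :
    unsatCount M sat a b c ≤ M := by
  refine (Finset.sum_le_card_nsmul _ _ 1 fun j _ => ?_).trans (by simp)
  split_ifs <;> simp

theorem gadgetFlow_le (N M : ℕ) (sat : ℕ → ℕ → ℕ → Bool) (a c k : ℕ) :
    gadgetFlow N M sat a c k ≤ 2 * (N * M) := by
  refine (Finset.sum_le_card_nsmul _ _ (2 * M) fun b _ => ?_).trans (le_of_eq ?_)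
  · have h1 := passCount_le M sat a b c
    have h2 := unsatCount_le M sat a b c
    have h3 := min_le_right (k + 1) (unsatCount M sat a b c)
    omega
  · simp; ring

end RAM

namespace CNF

variable (F : CNF)

theorem codes_length_le : ∀ c ∈ F.codes, c.length ≤ 2 * F.n := by
  intro c hc
  rw [codes, List.mem_append, List.mem_map, List.mem_singleton] at hc
  rcases hc with ⟨cl, hcl, rfl⟩ | rfl
  · have := (F.nodup cl hcl).length_le_card
    simp at this
    rw [List.length_map]
    omega
  · simp

theorem codes_le : ∀ c ∈ F.codes, ∀ x ∈ c, x + 1 ≤ 2 * F.n + 1 := by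
  intro c hc x hx
  rw [codes, List.mem_append, List.mem_map, List.mem_singleton] at hc
  rcases hc with ⟨cl, hcl, rfl⟩ | rfl
  · obtain ⟨l, -, rfl⟩ := List.mem_map.1 hx
    have h1 := l.1.isLt
    have h2 := Bool.toNat_le l.2
    omega
  · simp at hx

theorem length_clauseWords_le :
    (RAM.clauseWords F.codes).length ≤ F.codes.length * (2 * F.n + 1) := by
  rw [RAM.clauseWords, List.length_flatMap]
  refine (List.sum_le_card_nsmul _ (2 * F.n + 1) ?_).trans (by simp)
  simp only [List.mem_map, List.length_cons]
  rintro x ⟨c, hc, rfl⟩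
  have := F.codes_length_le c hc
  omega

theorem n_lt_numAsg : F.n < 3 * F.numAsg := by
  have : F.blockLen < F.numAsg := Nat.lt_two_pow_self
  unfold blockLen at this
  omega

theorem mul_pos : 0 < F.numAsg * F.codes.length :=
  Nat.mul_pos F.numAsg_pos (by rw [length_codes]; omega)

/-- The gadget network of a formula. -/
def network : Network := RAM.gadget F.numAsg F.codes.length F.sat F.mul_pos

/-- The program solves MAX-CNF-SAT if it is given a correct output for the gadget network. -/
theorem solver_correct {p : RAM.Prog} {B Bp t : ℕ} {sp : RAM.State}
    (hB : 128 * (F.numAsg * F.codes.length) ^ 2 + 48 * (F.numAsg * F.codes.length) + 26 ≤ B)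
    (hBp : Bp ≤ B) (hp : RAM.Exec Bp p (RAM.init F.network.enc) t sp)
    (hc : AllPairsMaxFlow.Correct F.network (sp.arr 1)) :
    RAM.Halts B (RAM.solver p) (3 * F.numAsg * (F.codes.length * (2 * F.n * 19 + 10) + 7) +
      173 * (F.numAsg * F.codes.length) + 24 * (F.numAsg * (F.numAsg * F.codes.length)) + 31 + t)
      (fun s => IsGreatest (Set.range F.numSat) (s.arr 1 0) ∧ s.arr 0 = RAM.listArr F.enc)
      (RAM.init F.enc) := by
  set N := F.numAsg with hN
  set M := F.codes.length with hM
  have hN0 : 0 < N := F.numAsg_pos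
  have hM0 : 0 < M := by rw [hM, length_codes]; omega
  have hNM : N ≤ N * M := Nat.le_mul_of_pos_right _ hM0
  have hMN : M ≤ N * M := Nat.le_mul_of_pos_left _ hN0
  have hn : F.n < 3 * N := F.n_lt_numAsg
  have henc : F.network.enc = (RAM.gadgetEdges N M F.sat).length ::
      (RAM.gadgetEdges N M F.sat).length :: RAM.edgeWords (RAM.gadgetEdges N M F.sat) :=
    RAM.gadget_enc F.mul_pos
  have hlen : 10 * (N * M) ≤ F.network.n := RAM.le_length_gadgetEdges
  -- maximum flow values are unique, so the output has to be `gadgetFlow`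
  have hout : ∀ a < N, ∀ c < N, ∀ j < M,
      sp.arr 1 ((c * M + j) * 8 + 6 + a * M * 8 * (RAM.gadgetEdges N M F.sat).length) =
        RAM.gadgetFlow N M F.sat a c j := by
    intro a ha c hc' j hj
    have h1 : a * M * 8 < F.network.n := by
      have := RAM.mul_add_lt ha hM0
      omega
    have h2 : (c * M + j) * 8 + 6 < F.network.n := by
      have := RAM.mul_add_lt hc' hj
      omega
    have hne : (⟨_, h1⟩ : Fin F.network.n) ≠ ⟨_, h2⟩ := by
      intro h
      have := congrArg Fin.val h
      dsimp only at this
      omega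
    have h3 := hc ⟨_, h1⟩ ⟨_, h2⟩ hne
    have h4 := RAM.gadget_isMaxFlowValue (h := F.mul_pos) ha hc' hj ⟨_, h1⟩ ⟨_, h2⟩ rfl rfl
    have h5 := IsGreatest.unique h3 h4
    rw [add_comm]
    exact_mod_cast h5
  have hwords : (RAM.clauseWords F.codes).length ≤ M * (2 * F.n + 1) := F.length_clauseWords_le
  have hwords' : M * (2 * F.n + 1) ≤ M * (6 * N) := Nat.mul_le_mul_left _ (by omega)
  have hwords'' : M * (6 * N) = 6 * (N * M) := by ring
  refine (RAM.solver_halts (n := F.n) (m := F.m) (D := 2 * F.n) (V := 2 * (N * M)) (cs := F.codes)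
    (f := fun x => RAM.clauseFlag F.blockLen N (x / M) (F.codes.getD (x % M) [])) (sat := F.sat)
    (p := p) N rfl F.length_codes F.codes_length_le ?_ ?_ ?_ ?_ _ rfl
    (henc ▸ hp.mono hBp) ?_ (show 2 * (N * M) + N * M ≤ B by omega) (by omega) ?_ hB
    (RAM.init F.enc) rfl ?_ ?_).mono le_rfl ?_
  · intro w j hj
    rw [RAM.mul_add_div_of_lt hj, RAM.mul_add_mod_of_lt hj, List.getD_eq_getElem _ _ hj]
    rfl
  · intro i hi
    simp only [RAM.clauseFlag, sat, zero_mul, zero_add]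
    rfl
  · intro i hi
    have h1 : (N * M + i) / M = N + i / M := by
      rw [Nat.mul_comm, Nat.mul_add_div hM0]
    have h2 : (N * M + i) % M = i % M := by
      rw [Nat.mul_comm, Nat.mul_add_mod]
    simp only [RAM.clauseFlag, sat, one_mul, h1, h2, ← hM, ← hN]
  · intro i hi
    have h1 : (2 * (N * M) + i) / M = 2 * N + i / M := by
      rw [show 2 * (N * M) = M * (2 * N) by ring, Nat.mul_add_div hM0]
    have h2 : (2 * (N * M) + i) % M = i % M := by
      rw [show 2 * (N * M) = M * (2 * N) by ring, Nat.mul_add_mod]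
    simp only [RAM.clauseFlag, sat, h1, h2, ← hM, ← hN]
  · intro x hx
    have h1 : x / (N * M) < N := (Nat.div_lt_iff_lt_mul F.mul_pos).2 hx
    have h2 : x % (N * M) / M < N := (Nat.div_lt_iff_lt_mul hM0).2 (Nat.mod_lt _ F.mul_pos)
    have h3 := hout _ h1 _ h2 0 hM0
    have h4 : x % (N * M) - x % (N * M) % M = x % (N * M) / M * M + 0 := by
      have := Nat.div_add_mod' (x % (N * M)) M
      omega
    rw [h4, h3]
    exact RAM.gadgetFlow_le _ _ _ _ _ _
  · intro c hc x hx
    have := F.codes_le c hc x hx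
    omega
  · intro a ha
    simp [RAM.init, ha]
  · rw [← F.listArr_enc]
    rfl
  · rintro s ⟨h1, h2⟩
    refine ⟨?_, h2⟩
    rw [h1]
    exact F.isGreatest_scan hout

theorem numAsg_pow_three_le : F.numAsg ^ 3 ≤ 8 * 2 ^ F.n := by
  have : (8 : ℕ) * 2 ^ F.n = 2 ^ (F.n + 3) := by ring
  rw [this, numAsg, ← pow_mul]
  refine Nat.pow_le_pow_right (by norm_num) ?_
  unfold blockLen
  omega

theorem numAsg_sq_le {ε : ℝ} (hε : ε ≤ 1 / 3) :
    (F.numAsg : ℝ) ^ 2 ≤ 4 * (2 : ℝ) ^ ((1 - ε) * (F.n : ℝ)) := by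
  have h1 : (F.numAsg : ℝ) ^ 2 = 4 * (2 : ℝ) ^ ((2 * (F.n / 3) : ℕ) : ℝ) := by
    rw [Real.rpow_natCast, numAsg, blockLen]
    push_cast
    ring
  rw [h1]
  gcongr
  · norm_num
  have h2 : ((F.n / 3 : ℕ) : ℝ) ≤ (F.n : ℝ) / 3 := Nat.cast_div_le
  have h3 : (0 : ℝ) ≤ F.n := Nat.cast_nonneg _
  push_cast
  nlinarith

end CNF

/-- The time for All-Pairs Max-Flow on a network with `E` nodes and edges. -/
theorem rpow_le_of_cube_le {E A n : ℕ} {ε ε' : ℝ} (hE : 1 ≤ E) (hA : 1 ≤ A) (hε : ε' ≤ ε)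
    (hε0 : 0 ≤ ε') (hε1 : ε' ≤ 1) (h : E ^ 3 ≤ A * 2 ^ n) :
    ((E : ℝ) ^ 2 * (E : ℝ)) ^ (1 - ε) ≤ A * (2 : ℝ) ^ ((1 - ε') * (n : ℝ)) := by
  have hE' : (1 : ℝ) ≤ E := by exact_mod_cast hE
  have hA' : (1 : ℝ) ≤ A := by exact_mod_cast hA
  have e1 : (E : ℝ) ^ 2 * (E : ℝ) = (E : ℝ) ^ 3 := by ring
  calc ((E : ℝ) ^ 2 * (E : ℝ)) ^ (1 - ε) ≤ ((E : ℝ) ^ 3) ^ (1 - ε') := by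
        rw [e1]
        exact Real.rpow_le_rpow_of_exponent_le (one_le_pow₀ hE') (by linarith)
    _ ≤ ((A : ℝ) * 2 ^ n) ^ (1 - ε') :=
        Real.rpow_le_rpow (by positivity) (by exact_mod_cast h) (by linarith)
    _ = (A : ℝ) ^ (1 - ε') * (2 : ℝ) ^ ((1 - ε') * (n : ℝ)) := by
        rw [Real.mul_rpow (by positivity) (by positivity), ← Real.rpow_natCast 2 n,
          ← Real.rpow_mul (by norm_num), mul_comm (n : ℝ)]
    _ ≤ A * (2 : ℝ) ^ ((1 - ε') * (n : ℝ)) := by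
        gcongr
        calc (A : ℝ) ^ (1 - ε') ≤ (A : ℝ) ^ (1 : ℝ) :=
              Real.rpow_le_rpow_of_exponent_le hA' (by linarith)
          _ = A := Real.rpow_one _

/-- The reduction: a fast program for All-Pairs Max-Flow gives a fast program for MAX-CNF-SAT. The
exponent is limited by the subroutine and, as `ε' ≤ 1 / 3`, by the `N ^ 2` pairs of partial
assignments in the final scan. That the input survives allows a later comparison with the number of
clauses. -/
theorem exists_maxSat_program {ε ε' : ℝ} (hε : ε' ≤ ε) (hε0 : 0 < ε') (hε1 : ε' ≤ 1 / 3) {C : ℕ}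
    (hC : 1 ≤ C) (H : SolvableInTime AllPairsMaxFlow
        (fun G : Network => 1 ≤ G.n ∧ G.n ≤ G.m ∧ G.m ≤ C * G.n ∧ G.CapacitiesIn G.n)
        (fun G : Network => ((G.n : ℝ) ^ 2 * (G.m : ℝ)) ^ (1 - ε))) :
    ∃ (q : RAM.Prog) (K : ℕ), ∀ F : CNF, ∃ (B t : ℕ) (s : RAM.State),
      RAM.Exec B q (RAM.init F.enc) t s ∧ IsGreatest (Set.range F.numSat) (s.arr 1 0) ∧
      s.arr 0 = RAM.listArr F.enc ∧
      (t : ℝ) ≤ K * (((F.n : ℝ) + 1) * ((F.m : ℝ) + 1) ^ 3 * (2 : ℝ) ^ ((1 - ε') * (F.n : ℝ))) ∧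
      B ≤ (K * (2 ^ F.n * (F.m + 1))) ^ K := by
  obtain ⟨p, K, hp⟩ := H
  refine ⟨RAM.solver p, 1000000 * (K + 1), fun F => ?_⟩
  set N := F.numAsg with hN
  set M := F.codes.length with hM
  have hMm : M = F.m + 1 := F.length_codes
  set E := (RAM.gadgetEdges N M F.sat).length with hE
  have hGn : F.network.n = E := rfl
  have hGm : F.network.m = E := RAM.gadget_m F.mul_pos
  have hElow : 10 * (N * M) ≤ E := RAM.le_length_gadgetEdges
  have hEup : E ≤ 16 * (N * M) := RAM.length_gadgetEdges_le _ _ _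
  have hNM : 0 < N * M := F.mul_pos
  have hN0 : 0 < N := F.numAsg_pos
  have hM0 : 0 < M := by omega
  have hE1 : 1 ≤ E := by omega
  obtain ⟨Bp, t, sp, he, hc, ht, hB⟩ := hp F.network (by
    change 1 ≤ F.network.n ∧ F.network.n ≤ F.network.m ∧ F.network.m ≤ C * F.network.n ∧
      F.network.CapacitiesIn F.network.n
    rw [hGm]
    exact ⟨hE1, le_rfl, Nat.le_mul_of_pos_left _ hC, RAM.gadget_capacitiesIn F.mul_pos⟩)
  have hlen : (AllPairsMaxFlow.enc F.network).length = 3 * E + 2 := by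
    have : F.network.enc = E :: E :: RAM.edgeWords (RAM.gadgetEdges N M F.sat) :=
      RAM.gadget_enc F.mul_pos
    change F.network.enc.length = _
    rw [this, List.length_cons, List.length_cons, RAM.length_edgeWords]
  simp only [hGn, hGm] at ht hB
  rw [hlen] at hB
  have hcube : E ^ 3 ≤ 32768 * M ^ 3 * 2 ^ F.n := by
    calc E ^ 3 ≤ (16 * (N * M)) ^ 3 := Nat.pow_le_pow_left hEup 3
      _ = 4096 * M ^ 3 * N ^ 3 := by ring
      _ ≤ 4096 * M ^ 3 * (8 * 2 ^ F.n) := Nat.mul_le_mul_left _ F.numAsg_pow_three_le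
      _ = 32768 * M ^ 3 * 2 ^ F.n := by ring
  have hA1 : 1 ≤ 32768 * M ^ 3 := Nat.mul_pos (by norm_num) (pow_pos hM0 3)
  have hT := rpow_le_of_cube_le hE1 hA1 hε hε0.le (by linarith) hcube
  have hTE : ((E : ℝ) ^ 2 * (E : ℝ)) ^ (1 - ε) ≤ (E : ℝ) ^ 3 := by
    have hE' : (1 : ℝ) ≤ E := by exact_mod_cast hE1
    rw [show (E : ℝ) ^ 2 * (E : ℝ) = (E : ℝ) ^ 3 by ring]
    calc ((E : ℝ) ^ 3) ^ (1 - ε) ≤ ((E : ℝ) ^ 3) ^ (1 : ℝ) :=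
          Real.rpow_le_rpow_of_exponent_le (one_le_pow₀ hE') (by linarith)
      _ = _ := Real.rpow_one _
  -- the word bound of the subroutine
  set Y := 2 ^ F.n * M with hY
  have h2n : 1 ≤ 2 ^ F.n := Nat.one_le_two_pow
  have hY1 : 1 ≤ Y := Nat.mul_pos h2n hM0
  have hEY : E ^ 3 ≤ 32768 * Y ^ 3 := by
    refine hcube.trans ?_
    calc 32768 * M ^ 3 * 2 ^ F.n ≤ 32768 * M ^ 3 * (2 ^ F.n) ^ 3 :=
          Nat.mul_le_mul_left _ (Nat.le_self_pow (by norm_num) _)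
      _ = 32768 * Y ^ 3 := by rw [hY]; ring
  have hBp : Bp ≤ (1000000 * (K + 1) * Y) ^ (1000000 * (K + 1)) := by
    have h1 : (Bp : ℝ) ≤ ((K * (7 * E ^ 3) : ℕ) : ℝ) ^ K := by
      refine hB.trans (pow_le_pow_left₀ ?_ ?_ K)
      · have := Real.rpow_nonneg (show (0 : ℝ) ≤ (E : ℝ) ^ 2 * (E : ℝ) by positivity) (1 - ε)
        positivity
      · have h3 : (E : ℝ) ≤ (E : ℝ) ^ 3 := by exact_mod_cast Nat.le_self_pow (by norm_num) E
        have h4 : (1 : ℝ) ≤ E := by exact_mod_cast hE1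
        push_cast
        gcongr
        linarith
    have h2 : Bp ≤ (K * (7 * E ^ 3)) ^ K := by exact_mod_cast h1
    have h3 : K * (7 * E ^ 3) ≤ (1000000 * (K + 1) * Y) ^ 3 := by
      calc K * (7 * E ^ 3) ≤ K * (7 * (32768 * Y ^ 3)) := by gcongr
        _ = (229376 * K) * Y ^ 3 := by ring
        _ ≤ (1000000 * (K + 1)) ^ 3 * Y ^ 3 := by
            gcongr
            calc 229376 * K ≤ 1000000 * (K + 1) := by omega
              _ ≤ _ := Nat.le_self_pow (by norm_num) _
        _ = _ := by ring
    calc Bp ≤ (K * (7 * E ^ 3)) ^ K := h2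
      _ ≤ ((1000000 * (K + 1) * Y) ^ 3) ^ K := Nat.pow_le_pow_left h3 K
      _ = (1000000 * (K + 1) * Y) ^ (3 * K) := by rw [pow_mul]
      _ ≤ _ := Nat.pow_le_pow_right (Nat.mul_pos (by omega) hY1) (by omega)
  have hB₀ : 128 * (N * M) ^ 2 + 48 * (N * M) + 26 ≤
      (1000000 * (K + 1) * Y) ^ (1000000 * (K + 1)) := by
    have h1 : N ≤ 2 * 2 ^ F.n := by
      rw [hN, CNF.numAsg, CNF.blockLen, pow_succ, mul_comm]
      exact Nat.mul_le_mul_left _ (Nat.pow_le_pow_right (by norm_num) (Nat.div_le_self _ _))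
    have h2 : N * M ≤ 2 * Y := by
      rw [hY, ← mul_assoc]
      exact Nat.mul_le_mul_right _ h1
    have h3 : N * M ≤ (N * M) ^ 2 := Nat.le_self_pow (by norm_num) _
    have h4 : (N * M) ^ 2 ≤ (2 * Y) ^ 2 := Nat.pow_le_pow_left h2 2
    calc 128 * (N * M) ^ 2 + 48 * (N * M) + 26 ≤ 202 * (N * M) ^ 2 := by omega
      _ ≤ 202 * (2 * Y) ^ 2 := Nat.mul_le_mul_left _ h4
      _ = 808 * Y ^ 2 := by ring
      _ ≤ (1000000 * (K + 1)) ^ 2 * Y ^ 2 := by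
          gcongr
          calc 808 ≤ 1000000 * (K + 1) := by omega
            _ ≤ _ := Nat.le_self_pow (by norm_num) _
      _ = (1000000 * (K + 1) * Y) ^ 2 := by ring
      _ ≤ _ := Nat.pow_le_pow_right (Nat.mul_pos (by omega) hY1) (by omega)
  obtain ⟨t', s, ht', he', hmax, hs0⟩ := F.solver_correct hB₀ hBp he hc
  refine ⟨_, t', s, he', hmax, hs0, ?_, by rw [← hMm]⟩
  have hcount : 3 * N * (M * (2 * F.n * 19 + 10) + 7) + 173 * (N * M) + 24 * (N * (N * M)) + 31 ≤
      400 * (N ^ 2 * (F.n + 1) * M ^ 3) := by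
    have hM3 : M ≤ M ^ 3 := Nat.le_self_pow (by norm_num) _
    have hN2 : N ≤ N ^ 2 := Nat.le_self_pow (by norm_num) _
    have a1 : N * M ≤ N ^ 2 * M ^ 3 := Nat.mul_le_mul hN2 hM3
    have a2 : N * (N * M) ≤ N ^ 2 * M ^ 3 := by
      rw [← mul_assoc, ← sq]
      exact Nat.mul_le_mul_left _ hM3
    have a3 : N ≤ N * M := Nat.le_mul_of_pos_right _ hM0
    have a4 : N * M * F.n ≤ N ^ 2 * M ^ 3 * F.n := Nat.mul_le_mul_right _ a1
    have e1 : 3 * N * (M * (2 * F.n * 19 + 10) + 7) =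
        114 * (N * M * F.n) + 30 * (N * M) + 21 * N := by ring
    have e2 : N ^ 2 * (F.n + 1) * M ^ 3 = N ^ 2 * M ^ 3 * F.n + N ^ 2 * M ^ 3 := by ring
    omega
  have hN2 := F.numAsg_sq_le hε1
  have hMr : (M : ℝ) = (F.m : ℝ) + 1 := by rw [hMm]; push_cast; ring
  have htr : (t' : ℝ) ≤ 400 * ((N : ℝ) ^ 2 * ((F.n : ℝ) + 1) * (M : ℝ) ^ 3) + t := by
    exact_mod_cast ht'.trans (Nat.add_le_add_right hcount t)
  rw [← hMr]
  set W := (2 : ℝ) ^ ((1 - ε') * (F.n : ℝ)) with hW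
  have hW0 : 0 ≤ W := by positivity
  have hn1 : (1 : ℝ) ≤ (F.n : ℝ) + 1 := by
    have : (0 : ℝ) ≤ F.n := Nat.cast_nonneg _
    linarith
  push_cast at hT
  calc (t' : ℝ) ≤ 400 * ((N : ℝ) ^ 2 * ((F.n : ℝ) + 1) * (M : ℝ) ^ 3) + t := htr
    _ ≤ 400 * ((4 * W) * ((F.n : ℝ) + 1) * (M : ℝ) ^ 3) + K * (32768 * (M : ℝ) ^ 3 * W) := by
        gcongr
        exact ht.trans (by gcongr)
    _ ≤ 400 * ((4 * W) * ((F.n : ℝ) + 1) * (M : ℝ) ^ 3) +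
        K * (32768 * (M : ℝ) ^ 3 * W) * ((F.n : ℝ) + 1) := by
        have := le_mul_of_one_le_right
          (show (0 : ℝ) ≤ K * (32768 * (M : ℝ) ^ 3 * W) by positivity) hn1
        linarith
    _ = (1600 + 32768 * K) * (((F.n : ℝ) + 1) * (M : ℝ) ^ 3 * W) := by ring
    _ ≤ _ := by
        gcongr
        push_cast
        have : (0 : ℝ) ≤ K := Nat.cast_nonneg _
        linarith

/-- Polynomial factors are absorbed by a slightly larger exponent. -/
theorem exists_pow_mul_rpow_le {ε : ℝ} (hε : 0 < ε) (k : ℕ) :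
    ∃ A : ℕ, ∀ n : ℕ, ((n : ℝ) + 1) ^ k * (2 : ℝ) ^ ((1 - ε) * (n : ℝ)) ≤
      A * (2 : ℝ) ^ ((1 - ε / 2) * (n : ℝ)) := by
  set r : ℝ := (2 : ℝ) ^ (ε / 2) with hr
  have hr1 : 1 < r := Real.one_lt_rpow (by norm_num) (by positivity)
  have hr0 : 0 < r := by linarith
  obtain ⟨A, hA⟩ := (tendsto_pow_const_div_const_pow_of_one_lt k hr1).bddAbove_range
  obtain ⟨A', hA'⟩ := exists_nat_ge (A * r)
  refine ⟨A', fun n => ?_⟩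
  have h1 : ((n : ℝ) + 1) ^ k ≤ A' * r ^ n := by
    have h2 := hA ⟨n + 1, rfl⟩
    simp only [Nat.cast_add, Nat.cast_one] at h2
    rw [div_le_iff₀ (by positivity), pow_succ] at h2
    calc ((n : ℝ) + 1) ^ k ≤ A * (r ^ n * r) := h2
      _ = (A * r) * r ^ n := by ring
      _ ≤ A' * r ^ n := by gcongr
  have h3 : r ^ n * (2 : ℝ) ^ ((1 - ε) * (n : ℝ)) = (2 : ℝ) ^ ((1 - ε / 2) * (n : ℝ)) := by
    rw [hr, ← Real.rpow_natCast, ← Real.rpow_mul (by norm_num), ← Real.rpow_add (by norm_num)]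
    congr 1
    ring
  rw [← h3, ← mul_assoc]
  gcongr

/-- The word bound is polynomial in the length of the input and the time bound. -/
theorem word_bound_le {F : CNF} {δ T : ℝ} {B K K' : ℕ} (hδ : δ ≤ 1 / 2)
    (hT : (2 : ℝ) ^ ((1 - δ) * (F.n : ℝ)) ≤ T) (hB : B ≤ (K * (2 ^ F.n * (F.m + 1))) ^ K)
    (hK : 3 * K + 1 ≤ K') : (B : ℝ) ≤ (K' * (F.enc.length + T + 1)) ^ K' := by
  have hT0 : 0 < T := lt_of_lt_of_le (by positivity) hT
  have hm : (F.m : ℝ) + 2 ≤ F.enc.length := by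
    have h : F.m + 2 ≤ F.enc.length := by
      rw [CNF.enc, List.length_cons, List.length_cons, List.length_flatMap]
      have := List.card_nsmul_le_sum (F.clauses.map fun c =>
        (c.length :: c.map fun l => 2 * l.1.val + l.2.toNat).length) 1 (by
          simp only [List.mem_map, List.length_cons]
          rintro x ⟨c, -, rfl⟩
          omega)
      rw [List.length_map] at this
      change F.m • 1 ≤ _ at this
      rw [smul_eq_mul, mul_one] at this
      omega
    exact_mod_cast h
  set Y : ℝ := F.enc.length + T + 1 with hY
  have hm0 : (0 : ℝ) ≤ F.m := Nat.cast_nonneg _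
  have hY1 : 1 ≤ Y := by linarith
  have h2 : (2 : ℝ) ^ F.n ≤ Y ^ 2 := by
    calc (2 : ℝ) ^ F.n = (2 : ℝ) ^ (F.n : ℝ) := (Real.rpow_natCast _ _).symm
      _ ≤ (2 : ℝ) ^ ((1 - δ) * (F.n : ℝ) * (2 : ℕ)) := by
          refine Real.rpow_le_rpow_of_exponent_le (by norm_num) ?_
          have : (0 : ℝ) ≤ F.n := Nat.cast_nonneg _
          push_cast
          nlinarith
      _ = ((2 : ℝ) ^ ((1 - δ) * (F.n : ℝ))) ^ 2 := by
          rw [Real.rpow_mul (by norm_num), Real.rpow_natCast]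
      _ ≤ Y ^ 2 := by
          gcongr
          linarith
  have hB' : (B : ℝ) ≤ (K * ((2 : ℝ) ^ F.n * ((F.m : ℝ) + 1))) ^ K := by exact_mod_cast hB
  have hK' : (3 : ℝ) * K + 1 ≤ K' := by exact_mod_cast hK
  have hK0 : (0 : ℝ) ≤ K := Nat.cast_nonneg _
  have hKY : 1 ≤ K' * Y := by nlinarith
  calc (B : ℝ) ≤ (K * ((2 : ℝ) ^ F.n * ((F.m : ℝ) + 1))) ^ K := hB'
    _ ≤ (K' ^ 3 * (Y ^ 2 * Y)) ^ K := by
        gcongr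
        · calc (K : ℝ) ≤ K' := by linarith
            _ ≤ (K' : ℝ) ^ 3 := le_self_pow₀ (by linarith) (by norm_num)
        · linarith
    _ = (K' * Y) ^ (3 * K) := by rw [pow_mul]; congr 1; ring
    _ ≤ (K' * Y) ^ K' := pow_le_pow_right₀ hKY (by omega)

/-- Compares the number of satisfiable clauses with the number of clauses. -/
def decideSat : RAM.Prog :=
  .seq (.const 0 0) (.seq (.const 1 1) (.seq (.load 2 1 0) (.seq (.load 3 0 1)
    (.ite 2 3 (.store 1 0 0) (.store 1 0 1)))))

theorem decideSat_halts {F : CNF} {B : ℕ} {s : RAM.State} (hB : 1 ≤ B)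
    (hmax : IsGreatest (Set.range F.numSat) (s.arr 1 0)) (h0 : s.arr 0 = RAM.listArr F.enc) :
    RAM.Halts B decideSat 6 (fun s' => CNFSAT.Correct F (s'.arr 1)) s := by
  have hm : s.arr 0 1 = F.m := by rw [h0]; rfl
  have hiff : F.Satisfiable ↔ ¬ s.arr 1 0 < F.m := by
    have key : ∀ a, F.numSat a = F.m ↔ ∀ c ∈ F.clauses, ∃ l ∈ c, a l.1 = l.2 := by
      intro a
      rw [CNF.numSat, CNF.m, List.countP_eq_length]
      simp
    constructor
    · rintro ⟨a, ha⟩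
      have := hmax.2 ⟨a, rfl⟩
      rw [(key a).2 ha] at this
      omega
    · intro h
      obtain ⟨a, ha⟩ := hmax.1
      exact ⟨a, (key a).1 (le_antisymm (F.numSat_le a) (by omega))⟩
  refine (RAM.Halts.seq <| RAM.Halts.const (by omega) <| RAM.Halts.seq <| RAM.Halts.const hB <|
    RAM.Halts.seq <| RAM.Halts.load (v := s.arr 1 0) (by simp) <|
    RAM.Halts.seq <| RAM.Halts.load (v := F.m) (by simp [hm]) <|
    RAM.Halts.ite (fun hlt => RAM.Halts.store ?_) (fun hlt => RAM.Halts.store ?_)).mono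
    (by norm_num) (fun _ h => h)
  · simp at hlt
    exact Or.inr ⟨fun h => hiff.1 h hlt, by simp [RAM.State.setArr_arr]⟩
  · simp at hlt
    exact Or.inl ⟨hiff.2 (not_lt.2 hlt), by simp [RAM.State.setArr_arr]⟩

theorem theorem2 (ε : ℝ) (hε : 0 < ε) :
    ∃ δ : ℝ, 0 < δ ∧ ∀ C : ℕ, 1 ≤ C →
      SolvableInTime AllPairsMaxFlow
        (fun G : Network => 1 ≤ G.n ∧ G.n ≤ G.m ∧ G.m ≤ C * G.n ∧ G.CapacitiesIn G.n)
        (fun G : Network => ((G.n : ℝ) ^ 2 * (G.m : ℝ)) ^ (1 - ε)) →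
      (∀ C' : ℕ, SolvableInTime MaxCNFSAT
        (fun F : CNF => F.m ≤ C' * F.n)
        (fun F : CNF => (2 : ℝ) ^ ((1 - δ) * (F.n : ℝ)))) ∧
      ¬ SETH := by
  -- the final scan takes time about `2 ^ (2 * n / 3)`, so more than `1 / 3` cannot be saved
  obtain ⟨ε', hε', h0, h1⟩ : ∃ ε' : ℝ, ε' ≤ ε ∧ 0 < ε' ∧ ε' ≤ 1 / 3 :=
    ⟨min ε (1 / 3), min_le_left _ _, lt_min hε (by norm_num), min_le_right _ _⟩
  refine ⟨ε' / 2, by positivity, fun C hC H => ?_⟩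
  obtain ⟨q, K, hq⟩ := exists_maxSat_program hε' h0 h1 hC H
  constructor
  · intro C'
    obtain ⟨A, hA⟩ := exists_pow_mul_rpow_le h0 4
    refine ⟨q, 3 * K + 1 + K * (C' + 1) ^ 3 * A, fun F hF => ?_⟩
    obtain ⟨B, t, s, he, hmax, -, ht, hB⟩ := hq F
    refine ⟨B, t, s, he, hmax, ?_, word_bound_le (by linarith) le_rfl hB (by omega)⟩
    have hm : (F.m : ℝ) + 1 ≤ (C' + 1) * ((F.n : ℝ) + 1) := by
      have h : F.m + 1 ≤ (C' + 1) * (F.n + 1) := by nlinarith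
      exact_mod_cast h
    calc (t : ℝ) ≤ K * (((F.n : ℝ) + 1) * ((F.m : ℝ) + 1) ^ 3 *
          (2 : ℝ) ^ ((1 - ε') * (F.n : ℝ))) := ht
      _ ≤ K * (((F.n : ℝ) + 1) * ((C' + 1) * ((F.n : ℝ) + 1)) ^ 3 *
          (2 : ℝ) ^ ((1 - ε') * (F.n : ℝ))) := by gcongr
      _ = K * (C' + 1) ^ 3 * (((F.n : ℝ) + 1) ^ 4 * (2 : ℝ) ^ ((1 - ε') * (F.n : ℝ))) := by ring
      _ ≤ K * (C' + 1) ^ 3 * (A * (2 : ℝ) ^ ((1 - ε' / 2) * (F.n : ℝ))) :=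
          mul_le_mul_of_nonneg_left (hA F.n) (by positivity)
      _ = (K * (C' + 1) ^ 3 * A) * (2 : ℝ) ^ ((1 - ε' / 2) * (F.n : ℝ)) := by ring
      _ ≤ _ := by
          gcongr
          push_cast
          have : (0 : ℝ) ≤ K := Nat.cast_nonneg _
          linarith
  · intro hS
    obtain ⟨k, -, hk⟩ := hS (ε' / 2) (by positivity)
    obtain ⟨A, hA⟩ := exists_pow_mul_rpow_le h0 1
    refine hk 3 ⟨.seq q decideSat, 3 * (K + 1) + 1 + K * A + 6, fun F _ => ?_⟩
    obtain ⟨B, t, s, he, hmax, hs0, ht, hB⟩ := hq F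
    have hY : 1 ≤ 2 ^ F.n * (F.m + 1) := Nat.mul_pos (Nat.two_pow_pos _) (by omega)
    have hB' : max B 1 ≤ ((K + 1) * (2 ^ F.n * (F.m + 1))) ^ (K + 1) := by
      refine max_le (hB.trans ?_) (Nat.one_le_pow _ _ (Nat.mul_pos (by omega) hY))
      calc (K * (2 ^ F.n * (F.m + 1))) ^ K ≤ ((K + 1) * (2 ^ F.n * (F.m + 1))) ^ K := by
            gcongr
            omega
        _ ≤ _ := Nat.pow_le_pow_right (Nat.mul_pos (by omega) hY) (by omega)
    obtain ⟨t', s', ht', he', hc⟩ := decideSat_halts (le_max_right B 1) hmax hs0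
    have hW : (1 : ℝ) ≤ (2 : ℝ) ^ ((1 - ε' / 2) * (F.n : ℝ)) :=
      Real.one_le_rpow (by norm_num) (mul_nonneg (by linarith) (Nat.cast_nonneg _))
    have hM : (1 : ℝ) ≤ ((F.m : ℝ) + 1) ^ 3 := by
      have : (0 : ℝ) ≤ F.m := Nat.cast_nonneg _
      exact one_le_pow₀ (by linarith)
    refine ⟨max B 1, t + t', s', .seq (he.mono (le_max_left _ _)) he', hc, ?_,
      word_bound_le (by linarith) (le_mul_of_one_le_right (by linarith) hM) hB' (by omega)⟩
    set W := (2 : ℝ) ^ ((1 - ε' / 2) * (F.n : ℝ)) with hWdef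
    have hA' := hA F.n
    rw [pow_one] at hA'
    have hWM : 1 ≤ W * ((F.m : ℝ) + 1) ^ 3 := one_le_mul_of_one_le_of_one_le hW hM
    have ht6 : (t' : ℝ) ≤ 6 := by exact_mod_cast ht'
    have hK : (0 : ℝ) ≤ K := Nat.cast_nonneg _
    calc ((t + t' : ℕ) : ℝ) = t + t' := by push_cast; ring
      _ ≤ K * (((F.n : ℝ) + 1) * ((F.m : ℝ) + 1) ^ 3 * (2 : ℝ) ^ ((1 - ε') * (F.n : ℝ))) + 6 := by
          linarith
      _ = K * ((((F.n : ℝ) + 1) * (2 : ℝ) ^ ((1 - ε') * (F.n : ℝ))) * ((F.m : ℝ) + 1) ^ 3) + 6 := by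
          ring
      _ ≤ K * ((A * W) * ((F.m : ℝ) + 1) ^ 3) + 6 * (W * ((F.m : ℝ) + 1) ^ 3) := by
          gcongr
          linarith
      _ = (K * A + 6) * (W * ((F.m : ℝ) + 1) ^ 3) := by ring
      _ ≤ _ := by
          gcongr
          push_cast
          linarith
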